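/- Let $m\ge 2$, let $a_2,\dots,a_m\in\mathbb R$ with $a_m\ne 0$, and put $\nu(x)=\sum_{p=2}^m \frac{a_p^2}{p!}x^p$, $\psi(x)=\nu'(x)+x\nu''(x)$, $\Gamma=\{(s,t):0\le t\le s\}$. A pair $(R,C)\in\mathcal C(\Gamma)\times\mathcal C(\mathbb R_+^2)$ is called admissible if $R(t,t)=C(t,t)=1$ and $C(s,t)=C(t,s)$ for all $s,t\ge 0$. For $\beta>0$ and an admissible pair let $$\mu_{R,C}(s)=\tfrac12+\beta^2\int_0^s\psi(C(s,u))R(s,u)\,du .$$ (Derivatives below are one-sided at $s=t$, respectively at $\tau=0$.) The spherical equations for an admissible pair $(R,C)$ are, for all $s\ge t\ge 0$, $$\partial_sR(s,t)=-\mu_{R,C}(s)R(s,t)+\beta^2\int_t^sR(u,t)R(s,u)\nu''(C(s,u))\,du,$$ $$\partial_sC(s,t)=-\mu_{R,C}(s)C(s,t)+\beta^2\int_0^sC(u,t)R(s,u)\nu''(C(s,u))\,du+\beta^2\int_0^t\nu'(C(s,u))R(t,u)\,du .$$ The map $\Psi:(R,C)\mapsto(\widetilde R,\widetilde C)$ sends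 an admissible pair of non-negative functions to the admissible pair solving, for $s\ge t\ge0$, $$\partial_s\widetilde R(s,t)=-\mu_{R,C}(s)\widetilde R(s,t)+\beta^2\int_t^s\widetilde R(u,t)\widetilde R(s,u)\nu''(C(s,u))\,du,$$ $$\partial_s\widetilde C(s,t)=-\mu_{R,C}(s)\widetilde C(s,t)+\beta^2\int_0^sC(u,t)R(s,u)\nu''(C(s,u))\,du+\beta^2\int_0^t\nu'(C(s,u))R(t,u)\,du .$$ Let $\mathcal A(\delta,r,\rho,c)$ be the set of admissible pairs with $0\le C(s,t)\le ce^{-\delta|s-t|}$ and $0\le R(s,t)\le\rho(r|s-t|+1)^{-3/2}e^{-\delta(s-t)}$ for $s\ge t\ge0$; let $\mathcal S(\delta,r,\rho,c)$ be the set of those $(R,C)\in\mathcal A(\delta,r,\rho,c)$ for which $R_{\rm fdt}(\tau)=\lim_{t\to\infty}R(t+\tau,t)$ and $C_{\rm fdt}(\tau)=C_{\rm fdt}(-\tau)=\lim_{t\to\infty}C(t+\tau,t)$ exist for every $\tau\ge0$; and let $\mathcal B(\delta,r,\rho,c)$ be the set of pairs $R:\mathbb R_+\to\mathbb R$, $C:\mathbb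 R\to\mathbb R$ with $R(0)=C(0)=1$, $0\le C(\tau)=C(-\tau)\le ce^{-\delta|\tau|}$ for all $\tau$, and $0\le R(\tau)\le\rho(r\tau+1)^{-3/2}e^{-\delta\tau}$ for $\tau\ge 0$. **Proposition.** There are universal constants $c_1>0$ and $M_1\ge2$ (independent of $m$, $(a_p)$ and $\beta$) such that, with $\delta=1/6$, $\rho=c_1$, $c=2$ and $r=r(\beta)=\beta\sqrt{\nu''(2)}$, for every $\nu$ as above: (0) whenever $\beta>0$ and $r(\beta)\le 1/(3M_1)$, $\Psi$ is a well-defined map on $\mathcal A(\delta,r,\rho,c)$ (the pair $(\widetilde R,\widetilde C)$ exists and is unique), $\Psi(\mathcal A(\delta,r,\rho,c))\subseteq\mathcal A(\delta,r,\rho,c)$ and $\Psi(\mathcal S(\delta,r,\rho,c))\subseteq\mathcal S(\delta,r,\rho,c)$. Moreover there is $\beta_1=\beta_1(\nu)>0$ such that for every $0<\beta<\beta_1$ one has $r(\beta)\le1/(3M_1)$ and: (1) $\Psi$ is a contraction on $\mathcal A(\delta,r,\rho,c)$ for the norm $\|(R,C)\|=\sup_{\Gamma}|R|+\sup_{\mathbb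 R_+^2}|C|$, i.e. there is $k\in[0,1)$ with $\|\Psi(P_1)-\Psi(P_2)\|\le k\|P_1-P_2\|$ for all $P_1,P_2\in\mathcal A(\delta,r,\rho,c)$; (2) the spherical equations have exactly one admissible solution $(R,C)$; it lies in $\mathcal S(\delta,r,\rho,c)$ and is the unique fixed point of $\Psi$ in $\mathcal S(\delta,r,\rho,c)$; (3) consequently the limits $R_{\rm fdt}$, $C_{\rm fdt}$ of this solution exist, and $(R_{\rm fdt},C_{\rm fdt})$ is the unique solution in $\mathcal B(\delta,r,\rho,c)$ of the FDT equations, for all $\tau\ge0$, $$R'(\tau)=-\mu R(\tau)+\beta^2\int_0^\tau R(\tau-\theta)R(\theta)\nu''(C(\theta))\,d\theta,$$ $$C'(\tau)=-\mu C(\tau)+\beta^2\int_0^\infty C(\tau-\theta)R(\theta)\nu''(C(\theta))\,d\theta+\beta^2\int_\tau^\infty\nu'(C(\theta))R(\theta-\tau)\,d\theta+{\bf I},$$ $$\mu=\tfrac12+\beta^2\int_0^\infty\psi(C(\theta))R(\theta)\,d\theta+{\bf I},$$ with ${\bf I}=0$. -/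

import Mathlib

open Set Filter Topology

noncomputable section

namespace SphericalSpinGlass

/-- The covariance polynomial `ν(x) = ∑_{p=2}^m (a_p² / p!) x^p`. -/
def nu (m : ℕ) (a : ℕ → ℝ) : Polynomial ℝ :=
  ∑ p ∈ Finset.Icc 2 m, Polynomial.monomial p ((a p) ^ 2 / (Nat.factorial p : ℝ))

/-- `ν'`. -/
def nu1 (m : ℕ) (a : ℕ → ℝ) (x : ℝ) : ℝ := (nu m a).derivative.eval x

/-- `ν''`. -/
def nu2 (m : ℕ) (a : ℕ → ℝ) (x : ℝ) : ℝ := (nu m a).derivative.derivative.eval x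

/-- `ψ(x) = ν'(x) + x ν''(x)`. -/
def psi (m : ℕ) (a : ℕ → ℝ) (x : ℝ) : ℝ := nu1 m a x + x * nu2 m a x

/-- The domain `Γ = {(s,t) : 0 ≤ t ≤ s}`. -/
def Gam : Set (ℝ × ℝ) := {p | 0 ≤ p.2 ∧ p.2 ≤ p.1}

/-- The quadrant `ℝ₊ × ℝ₊`. -/
def Quad : Set (ℝ × ℝ) := {p | 0 ≤ p.1 ∧ 0 ≤ p.2}

/-- A pair `(R, C)` of two-time functions. Only the values of `R = P.1` on `Γ` and of `C = P.2` on
`ℝ₊ × ℝ₊` are meaningful; see `Agree`. -/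
abbrev TwoTime : Type := (ℝ → ℝ → ℝ) × (ℝ → ℝ → ℝ)

/-- Equality of two pairs, as functions on `Γ` and on `ℝ₊ × ℝ₊` respectively. -/
def Agree (P Q : TwoTime) : Prop :=
  (∀ s t, 0 ≤ t → t ≤ s → P.1 s t = Q.1 s t) ∧ (∀ s t, 0 ≤ s → 0 ≤ t → P.2 s t = Q.2 s t)

/-- `(R, C) ∈ 𝒞(Γ) × 𝒞(ℝ₊ × ℝ₊)` with `R(t,t) = C(t,t) = 1` and `C` symmetric. -/
structure IsAdmissible (P : TwoTime) : Prop where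
  continuous_R : ContinuousOn (fun p : ℝ × ℝ => P.1 p.1 p.2) Gam
  continuous_C : ContinuousOn (fun p : ℝ × ℝ => P.2 p.1 p.2) Quad
  diag_R : ∀ t, 0 ≤ t → P.1 t t = 1
  diag_C : ∀ t, 0 ≤ t → P.2 t t = 1
  symm_C : ∀ s t, 0 ≤ s → 0 ≤ t → P.2 s t = P.2 t s

/-- The set `𝒜⁺` of admissible pairs of non-negative functions. -/
def APlus : Set TwoTime :=
  {P | IsAdmissible P ∧ (∀ s t, 0 ≤ t → t ≤ s → 0 ≤ P.1 s t) ∧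
    (∀ s t, 0 ≤ s → 0 ≤ t → 0 ≤ P.2 s t)}

/-- The set `𝒜(δ,r,ρ,c)`. -/
def ASet (δ r ρ c : ℝ) : Set TwoTime :=
  {P | P ∈ APlus ∧ ∀ s t, 0 ≤ t → t ≤ s →
    P.2 s t ≤ c * Real.exp (-δ * |s - t|) ∧
    P.1 s t ≤ ρ * (r * |s - t| + 1) ^ (-(3 / 2) : ℝ) * Real.exp (-δ * (s - t))}

/-- `R_fdt(τ) = lim_{t → ∞} R(t+τ,t)` and `C_fdt(τ) = lim_{t → ∞} C(t+τ,t)` for all `τ ≥ 0`. -/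
def HasFdtLimits (P : TwoTime) (Rf Cf : ℝ → ℝ) : Prop :=
  ∀ τ, 0 ≤ τ → Tendsto (fun t => P.1 (t + τ) t) atTop (𝓝 (Rf τ)) ∧
    Tendsto (fun t => P.2 (t + τ) t) atTop (𝓝 (Cf τ))

/-- The set `𝒮(δ,r,ρ,c)`. -/
def SSet (δ r ρ c : ℝ) : Set TwoTime :=
  {P | P ∈ ASet δ r ρ c ∧ ∃ Rf Cf : ℝ → ℝ, HasFdtLimits P Rf Cf}

/-- The set `ℬ(δ,r,ρ,c)` of pairs `(R, C)` of one-time functions, `R` on `ℝ₊` and `C` on `ℝ`. -/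
def BSet (δ r ρ c : ℝ) : Set ((ℝ → ℝ) × (ℝ → ℝ)) :=
  {q | q.1 0 = 1 ∧ q.2 0 = 1 ∧
    (∀ τ, 0 ≤ q.2 τ ∧ q.2 τ = q.2 (-τ) ∧ q.2 τ ≤ c * Real.exp (-δ * |τ|)) ∧
    (∀ τ, 0 ≤ τ → 0 ≤ q.1 τ ∧
      q.1 τ ≤ ρ * (r * τ + 1) ^ (-(3 / 2) : ℝ) * Real.exp (-δ * τ))}

/-- `μ_{R,C}(s) = 1/2 + β² ∫_0^s ψ(C(s,u)) R(s,u) du`. -/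
def muRC (m : ℕ) (a : ℕ → ℝ) (β : ℝ) (P : TwoTime) (s : ℝ) : ℝ :=
  1 / 2 + β ^ 2 * ∫ u in (0 : ℝ)..s, psi m a (P.2 s u) * P.1 s u

/-- `I₁(s,t) = ∫_0^s C(u,t) R(s,u) ν''(C(s,u)) du`. -/
def I1 (m : ℕ) (a : ℕ → ℝ) (P : TwoTime) (s t : ℝ) : ℝ :=
  ∫ u in (0 : ℝ)..s, P.2 u t * P.1 s u * nu2 m a (P.2 s u)

/-- `I₂(s,t) = ∫_0^t ν'(C(s,u)) R(t,u) du`. -/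
def I2 (m : ℕ) (a : ℕ → ℝ) (P : TwoTime) (s t : ℝ) : ℝ :=
  ∫ u in (0 : ℝ)..t, nu1 m a (P.2 s u) * P.1 t u

/-- The graph of the map `Ψ`: `Q = (R̃, C̃)` is the image of `P = (R, C)`. The partial derivative in
`s` is two-sided for `s > t` and right-sided at `s = t`. -/
structure IsPsi (m : ℕ) (a : ℕ → ℝ) (β : ℝ) (P Q : TwoTime) : Prop where
  admissible : IsAdmissible Q
  eq_R : ∀ s t, 0 ≤ t → t ≤ s →
    HasDerivWithinAt (fun v => Q.1 v t)
      (-(muRC m a β P s) * Q.1 s t +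
        β ^ 2 * ∫ u in t..s, Q.1 u t * Q.1 s u * nu2 m a (P.2 s u)) (Ici t) s
  eq_C : ∀ s t, 0 ≤ t → t ≤ s →
    HasDerivWithinAt (fun v => Q.2 v t)
      (-(muRC m a β P s) * Q.2 s t + β ^ 2 * I1 m a P s t + β ^ 2 * I2 m a P s t) (Ici t) s

/-- `Ψ` is a well-defined map on `X` (existence and uniqueness of the image), with values in `Y`. -/
def PsiMapsTo (m : ℕ) (a : ℕ → ℝ) (β : ℝ) (X Y : Set TwoTime) : Prop :=
  ∀ P ∈ X, ∃ Q ∈ Y, IsPsi m a β P Q ∧ ∀ Q', IsPsi m a β P Q' → Agree Q' Q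

/-- The uniform distance `sup_Γ |R₁ - R₂| + sup_{ℝ₊ × ℝ₊} |C₁ - C₂|`; both suprema are over bounded
sets when the pairs are in some `𝒜(δ,r,ρ,c)` with `δ, r ≥ 0`. -/
def udist (P Q : TwoTime) : ℝ :=
  (⨆ p : Gam, |P.1 p.1.1 p.1.2 - Q.1 p.1.1 p.1.2|) +
    ⨆ p : Quad, |P.2 p.1.1 p.1.2 - Q.2 p.1.1 p.1.2|

/-- `Ψ` is a contraction of `X` for the uniform norm. -/
def PsiContracts (m : ℕ) (a : ℕ → ℝ) (β : ℝ) (X : Set TwoTime) : Prop :=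
  PsiMapsTo m a β X X ∧ ∃ k : ℝ, 0 ≤ k ∧ k < 1 ∧
    ∀ P₁ ∈ X, ∀ P₂ ∈ X, ∀ Q₁ Q₂, IsPsi m a β P₁ Q₁ → IsPsi m a β P₂ Q₂ →
      udist Q₁ Q₂ ≤ k * udist P₁ P₂

/-- `(R, C)` solves the spherical (Cugliandolo-Kurchan) equations with `C(t,t) = R(t,t) = 1`. -/
structure IsSphericalSolution (m : ℕ) (a : ℕ → ℝ) (β : ℝ) (P : TwoTime) : Prop where
  admissible : IsAdmissible P
  eq_R : ∀ s t, 0 ≤ t → t ≤ s →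
    HasDerivWithinAt (fun v => P.1 v t)
      (-(muRC m a β P s) * P.1 s t +
        β ^ 2 * ∫ u in t..s, P.1 u t * P.1 s u * nu2 m a (P.2 s u)) (Ici t) s
  eq_C : ∀ s t, 0 ≤ t → t ≤ s →
    HasDerivWithinAt (fun v => P.2 v t)
      (-(muRC m a β P s) * P.2 s t +
        β ^ 2 * (∫ u in (0 : ℝ)..s, P.2 u t * P.1 s u * nu2 m a (P.2 s u)) +
        β ^ 2 * ∫ u in (0 : ℝ)..t, nu1 m a (P.2 s u) * P.1 t u) (Ici t) s

/-- `μ = 1/2 + β² ∫_0^∞ ψ(C(θ)) R(θ) dθ + I`. -/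
def muFdt (m : ℕ) (a : ℕ → ℝ) (β I : ℝ) (R C : ℝ → ℝ) : ℝ :=
  1 / 2 + β ^ 2 * (∫ θ in Ioi (0 : ℝ), psi m a (C θ) * R θ) + I

/-- The stationary FDT equations with constant `I`, for all `τ ≥ 0` (right derivatives at `τ = 0`).
For solutions in some `ℬ(δ,r,ρ,c)`, `δ > 0`, `r ≥ 0`, all integrands are continuous on the domain of
integration and decay exponentially, so the integrals converge. -/
structure IsFdtSolution (m : ℕ) (a : ℕ → ℝ) (β I : ℝ) (R C : ℝ → ℝ) : Prop where
  eq_R : ∀ τ, 0 ≤ τ →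
    HasDerivWithinAt R
      (-(muFdt m a β I R C) * R τ +
        β ^ 2 * ∫ θ in (0 : ℝ)..τ, R (τ - θ) * R θ * nu2 m a (C θ)) (Ici 0) τ
  eq_C : ∀ τ, 0 ≤ τ →
    HasDerivWithinAt C
      (-(muFdt m a β I R C) * C τ +
        β ^ 2 * (∫ θ in Ioi (0 : ℝ), C (τ - θ) * R θ * nu2 m a (C θ)) +
        β ^ 2 * (∫ θ in Ioi τ, nu1 m a (C θ) * R (θ - τ)) + I) (Ici 0) τ

/-- `r(β) = β √(ν''(2))`. -/
def rate (m : ℕ) (a : ℕ → ℝ) (β : ℝ) : ℝ := β * Real.sqrt (nu2 m a 2)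

end SphericalSpinGlass

end

/-! For given memory terms each equation is a linear ODE in `s`, with damping `μ ≥ 1/2` because `R`,
`C` and the coefficients of `ν` are non-negative. The task is to find a decay bound that the memory
integrals reproduce with a small factor. Exponential decay alone fails: the convolution of
`e^{-τ/6}` with itself is `τ e^{-τ/6}`. The extra weight `(rτ+1)^{-3/2}` repairs this, since its
integral is at most `2/r` and its self-convolution is at most `12/r` times itself (`wt_mul_wt_le`,
`integral_wt_le`). As `β² ν''(2) = r²`, the quadratic memory term is at most `12 r` times the
barrier, and for small `r` the damping absorbs it (`IsStep.mem_ASet`).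

The map `Ψ` is implicit, because its response enters quadratically. Freezing that term at a function
`f` gives the explicitly solvable problem `IsStep`. By `IsStep.near` its solution depends on `f`
with Lipschitz constant `1/4` as soon as `r ≤ 1/300`, and on `P` with constant `432 β² L`, where `L`
depends on `ν`. The first constant gives existence of `Ψ(P)` as a fixed point in `f`, with a
universal threshold on `r`. Both together, for small `β`, make `Ψ` a contraction, and also the map
`Q ↦ stepMap Q Q.1`, whose fixed points solve the spherical equations. The contraction principle
`exists_agree_fixed` applies in any invariant set closed under uniform convergence: `𝒜`, `𝒮`, or the
set `LimSet` of pairs with prescribed limits.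

Uniqueness of `Ψ(P)` and of the spherical solution is claimed among all admissible pairs, without
sign or decay. It comes from a Grönwall argument on bounded time intervals (`IsPsi.agree`,
`IsSphericalSolution.agree`).

By dominated convergence the step map acts on limits through a one-time map `fdtStep`
(`hasFdtLimits_stepMap`). Hence the limits of the spherical solution are fixed by `fdtStep`, which
amounts to the FDT equations. Uniqueness in `ℬ` is reduced to the two-time problem: an FDT solution
`(R, C)` makes `LimSet r R C` invariant, and this set contains the pair `R(s-t)`, `C(s-t)`. It
therefore contains a spherical solution, necessarily the only one, so the limits of that solution
are `R` and `C`. -/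

namespace SphericalSpinGlass

/-! ### Bounds for `ν'`, `ν''` and `ψ`. -/

section Polynomials

variable (m : ℕ) (a : ℕ → ℝ)

theorem continuous_nu1 : Continuous (nu1 m a) := (nu m a).derivative.continuous

theorem continuous_nu2 : Continuous (nu2 m a) := (nu m a).derivative.derivative.continuous

theorem continuous_psi : Continuous (psi m a) :=
  (continuous_nu1 m a).add (continuous_id.mul (continuous_nu2 m a))

theorem nu1_eq_sum (x : ℝ) : nu1 m a x =
    ∑ p ∈ Finset.Icc 2 m, (a p) ^ 2 / (Nat.factorial p : ℝ) * p * x ^ (p - 1) := by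
  simp [nu1, nu, Polynomial.derivative_monomial, Polynomial.eval_finsetSum]

theorem nu2_eq_sum (x : ℝ) : nu2 m a x =
    ∑ p ∈ Finset.Icc 2 m,
      (a p) ^ 2 / (Nat.factorial p : ℝ) * p * ((p - 1 : ℕ) : ℝ) * x ^ (p - 1 - 1) := by
  simp only [nu2, nu, Polynomial.derivative_monomial, Polynomial.eval_finsetSum,
    Polynomial.derivative_sum, Polynomial.eval_monomial]

theorem nu1_nonneg {x : ℝ} (hx : 0 ≤ x) : 0 ≤ nu1 m a x := by
  rw [nu1_eq_sum]; exact Finset.sum_nonneg fun p _ => by positivity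

theorem nu2_nonneg {x : ℝ} (hx : 0 ≤ x) : 0 ≤ nu2 m a x := by
  rw [nu2_eq_sum]; exact Finset.sum_nonneg fun p _ => by positivity

theorem nu2_mono {x y : ℝ} (hx : 0 ≤ x) (hxy : x ≤ y) : nu2 m a x ≤ nu2 m a y := by
  rw [nu2_eq_sum, nu2_eq_sum]
  exact Finset.sum_le_sum fun p _ => by gcongr

/-- Passing from `ν'` to `x ν''` multiplies the coefficient of index `p` by `p - 1`, which is at
least 1 because the sum starts at `p = 2`. -/
theorem nu1_le {x : ℝ} (hx : 0 ≤ x) : nu1 m a x ≤ x * nu2 m a x := by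
  rw [nu2_eq_sum, nu1_eq_sum, Finset.mul_sum]
  refine Finset.sum_le_sum fun p hp => ?_
  have h2 : 2 ≤ p := (Finset.mem_Icc.1 hp).1
  have e : x ^ (p - 1) = x * x ^ (p - 1 - 1) := by
    rw [← pow_succ']; congr 1; omega
  have h1 : (1 : ℝ) ≤ ((p - 1 : ℕ) : ℝ) := by exact_mod_cast (by omega : 1 ≤ p - 1)
  rw [e]
  have : 0 ≤ (a p) ^ 2 / (Nat.factorial p : ℝ) * p * (x * x ^ (p - 1 - 1)) := by positivity
  nlinarith

theorem nu2_two_pos (hm : 2 ≤ m) (ha : a m ≠ 0) : 0 < nu2 m a 2 := by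
  rw [nu2_eq_sum]
  refine Finset.sum_pos' (fun p _ => by positivity) ⟨m, Finset.mem_Icc.2 ⟨hm, le_rfl⟩, ?_⟩
  have h1 : (0 : ℝ) < ((m - 1 : ℕ) : ℝ) := by exact_mod_cast (by omega : 0 < m - 1)
  have h2 : (0 : ℝ) < m := by exact_mod_cast (by omega : 0 < m)
  positivity

theorem psi_nonneg {x : ℝ} (hx : 0 ≤ x) : 0 ≤ psi m a x :=
  add_nonneg (nu1_nonneg m a hx) (mul_nonneg hx (nu2_nonneg m a hx))

/-- Correlations in `𝒜` take values in `[0, 2]`, since `c = 2`. Linear vanishing at 0 is what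
transfers the decay of `C` to `ν'(C)`, and to `ψ(C)` in the companion bound. -/
theorem nu1_le_mul_two {x : ℝ} (hx : 0 ≤ x) (h2 : x ≤ 2) : nu1 m a x ≤ nu2 m a 2 * x :=
  (nu1_le m a hx).trans (by
    have := nu2_mono m a hx h2
    nlinarith)

theorem psi_le_mul_two {x : ℝ} (hx : 0 ≤ x) (h2 : x ≤ 2) : psi m a x ≤ 2 * nu2 m a 2 * x := by
  have h := nu1_le_mul_two m a hx h2
  have := nu2_mono m a hx h2
  unfold psi
  nlinarith

theorem exists_lipschitz_bound (p : Polynomial ℝ) (K : ℝ) :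
    ∃ L : ℝ, 0 ≤ L ∧ ∀ x y, |x| ≤ K → |y| ≤ K →
      |p.eval x - p.eval y| ≤ L * |x - y| ∧ |p.eval x| ≤ L := by
  obtain ⟨L₁, h₁⟩ := (isCompact_Icc (a := -K) (b := K)).exists_bound_of_continuousOn
    p.derivative.continuous.continuousOn
  obtain ⟨L₂, h₂⟩ := (isCompact_Icc (a := -K) (b := K)).exists_bound_of_continuousOn
    p.continuous.continuousOn
  refine ⟨max 0 (max L₁ L₂), le_max_left _ _, fun x y hx hy => ⟨?_, ?_⟩⟩
  · have := (convex_Icc (-K) K).norm_image_sub_le_of_norm_deriv_le (f := fun x => p.eval x)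
      (C := max 0 (max L₁ L₂)) (x := y) (y := x)
      (fun z _ => p.differentiableAt)
      (fun z hz => by
        rw [Polynomial.deriv]
        exact (h₁ z hz).trans ((le_max_left _ _).trans (le_max_right _ _)))
      (abs_le.1 hy) (abs_le.1 hx)
    simpa [Real.norm_eq_abs] using this
  · exact (h₂ x (abs_le.1 hx)).trans ((le_max_right _ _).trans (le_max_right _ _))

/-- On bounded sets `ν'`, `ν''` and `ψ` are bounded and Lipschitz with a common constant. -/
theorem exists_common_lipschitz (K : ℝ) :
    ∃ L : ℝ, 1 ≤ L ∧ ∀ x y, |x| ≤ K → |y| ≤ K →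
      (|nu1 m a x - nu1 m a y| ≤ L * |x - y| ∧ |nu1 m a x| ≤ L) ∧
      (|nu2 m a x - nu2 m a y| ≤ L * |x - y| ∧ |nu2 m a x| ≤ L) ∧
      (|psi m a x - psi m a y| ≤ L * |x - y| ∧ |psi m a x| ≤ L) := by
  obtain ⟨L₁, h₁, H₁⟩ := exists_lipschitz_bound (nu m a).derivative K
  obtain ⟨L₂, h₂, H₂⟩ := exists_lipschitz_bound (nu m a).derivative.derivative K
  obtain ⟨L₃, h₃, H₃⟩ := exists_lipschitz_bound
    ((nu m a).derivative + Polynomial.X * (nu m a).derivative.derivative) K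
  have e : ∀ x, ((nu m a).derivative + Polynomial.X * (nu m a).derivative.derivative).eval x
      = psi m a x := by
    intro x; simp [psi, nu1, nu2]
  refine ⟨1 + L₁ + L₂ + L₃, by linarith, fun x y hx hy => ?_⟩
  have A₁ := H₁ x y hx hy
  have A₂ := H₂ x y hx hy
  have A₃ := H₃ x y hx hy
  rw [e, e] at A₃
  have hd := abs_nonneg (x - y)
  have key : ∀ L', L' ≤ 1 + L₁ + L₂ + L₃ → L' * |x - y| ≤ (1 + L₁ + L₂ + L₃) * |x - y| :=
    fun L' h => mul_le_mul_of_nonneg_right h hd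
  exact ⟨⟨A₁.1.trans (key _ (by linarith)), A₁.2.trans (by linarith)⟩,
    ⟨A₂.1.trans (key _ (by linarith)), A₂.2.trans (by linarith)⟩,
    ⟨A₃.1.trans (key _ (by linarith)), A₃.2.trans (by linarith)⟩⟩

end Polynomials

/-! ### Comparison principles for damped linear equations. -/

section Comparison

/-- Comparison for a linear equation `h' = -μ h + g` with `μ ≥ 1/2`. -/
theorem le_of_linear_ode {h μ g B B' : ℝ → ℝ} {t : ℝ}
    (hh : ∀ s, t ≤ s → HasDerivWithinAt h (-(μ s) * h s + g s) (Ici t) s)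
    (hμ : ∀ s, t ≤ s → 1 / 2 ≤ μ s)
    (hB : ∀ s, t ≤ s → HasDerivWithinAt B (B' s) (Ici t) s)
    (hB0 : ∀ s, t ≤ s → 0 ≤ B s) (h0 : h t ≤ B t)
    (hg : ∀ s, t ≤ s → g s ≤ B' s + B s / 2) : ∀ s, t ≤ s → h s ≤ B s := by
  intro s hs
  -- The barrier `B + ε` is strict: where `h = B + ε`, one has `h' ≤ -(B + ε)/2 + B' + B/2 < B'`.
  refine le_of_forall_pos_le_add fun ε hε => ?_
  refine image_le_of_deriv_right_lt_deriv_boundary' (f := h) (a := t) (b := s)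
    (f' := fun x => -(μ x) * h x + g x) (B := fun x => B x + ε) (B' := B')
    (fun x hx => ((hh x hx.1).mono Icc_subset_Ici_self).continuousWithinAt)
    (fun x hx => (hh x hx.1).mono (Ici_subset_Ici.2 hx.1))
    (by linarith)
    (fun x hx => (((hB x hx.1).add_const ε).mono Icc_subset_Ici_self).continuousWithinAt)
    (fun x hx => ((hB x hx.1).add_const ε).mono (Ici_subset_Ici.2 hx.1))
    (fun x hx e => ?_) ⟨hs, le_rfl⟩
  have h1 := hμ x hx.1
  have h2 := hB0 x hx.1
  have h3 := hg x hx.1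
  have e : h x = B x + ε := e
  change -(μ x) * h x + g x < B' x
  rw [e]
  nlinarith

/-- The constants `±B` are barriers, because damping at least `1/2` dominates a forcing of size
`B/2`. The bound does not grow with time, which is what allows contraction in the uniform norm on
all of `Γ`. -/
theorem abs_le_of_linear_ode {h μ g : ℝ → ℝ} {t B : ℝ}
    (hh : ∀ s, t ≤ s → HasDerivWithinAt h (-(μ s) * h s + g s) (Ici t) s)
    (hμ : ∀ s, t ≤ s → 1 / 2 ≤ μ s) (h0 : h t = 0)
    (hg : ∀ s, t ≤ s → |g s| ≤ B / 2) : ∀ s, t ≤ s → |h s| ≤ B := by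
  intro s hs
  have hB : 0 ≤ B := by have := (abs_nonneg _).trans (hg t le_rfl); linarith
  have h1 := le_of_linear_ode hh hμ (B := fun _ => B) (B' := fun _ => 0)
    (fun s _ => hasDerivWithinAt_const _ _ _) (fun _ _ => hB) (by rw [h0]; exact hB)
    (fun s hs => by have := (abs_le.1 (hg s hs)).2; simpa using this) s hs
  have h2 := le_of_linear_ode (h := fun s => -h s) (μ := μ) (g := fun s => -g s)
    (fun s hs => by
      have := (hh s hs).neg
      refine this.congr_deriv ?_
      ring) hμ (B := fun _ => B) (B' := fun _ => 0)
    (fun s _ => hasDerivWithinAt_const _ _ _) (fun _ _ => hB) (by rw [h0]; simpa using hB)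
    (fun s hs => by have := (abs_le.1 (hg s hs)).1; simp only [zero_add]; linarith) s hs
  exact abs_le.2 ⟨by linarith, h1⟩

theorem nonneg_of_linear_ode {h μ g : ℝ → ℝ} {t : ℝ}
    (hh : ∀ s, t ≤ s → HasDerivWithinAt h (-(μ s) * h s + g s) (Ici t) s)
    (hμ : ∀ s, t ≤ s → 1 / 2 ≤ μ s) (h0 : 0 ≤ h t)
    (hg : ∀ s, t ≤ s → 0 ≤ g s) : ∀ s, t ≤ s → 0 ≤ h s := by
  intro s hs
  have h2 := le_of_linear_ode (h := fun s => -h s) (μ := μ) (g := fun s => -g s)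
    (fun s hs => by
      have := (hh s hs).neg
      refine this.congr_deriv ?_
      ring) hμ (B := fun _ => 0) (B' := fun _ => 0)
    (fun s _ => hasDerivWithinAt_const _ _ _) (fun _ _ => le_rfl) (by simpa using h0)
    (fun s hs => by have := hg s hs; simp only [zero_add]; linarith) s hs
  linarith

end Comparison

/-! ### The exponential and polynomial weights. -/

section Weights

theorem integral_exp_abs_le (c : ℝ) {x y : ℝ} (h : x ≤ y) :
    ∫ u in x..y, Real.exp (-(1 / 6) * |u - c|) ≤ 12 := by
  have hv : ∫ u : ℝ, Real.exp (-(1 / 6) * |u|) = 12 := by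
    rw [integral_comp_abs (f := fun u => Real.exp (-(1 / 6) * u))]
    rw [integral_exp_mul_Ioi (by norm_num)]
    norm_num
  -- The integral of a non-integrable function is 0 by convention, so the value 12 just computed
  -- already forces integrability.
  have hi : MeasureTheory.Integrable (fun u : ℝ => Real.exp (-(1 / 6) * |u|)) :=
    .of_integral_ne_zero (by rw [hv]; norm_num)
  rw [intervalIntegral.integral_comp_sub_right (fun u => Real.exp (-(1 / 6) * |u|)),
    intervalIntegral.integral_of_le (by linarith), ← hv]
  exact MeasureTheory.setIntegral_le_integral hi (Eventually.of_forall fun u => (Real.exp_pos _).le)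

/-- The polynomial part of the weight in the definition of `ASet`. -/
noncomputable def wt (r x : ℝ) : ℝ := (r * x + 1) ^ (-(3 / 2) : ℝ)

variable {r : ℝ}

theorem wt_zero : wt r 0 = 1 := by simp [wt]

theorem wt_pos (hr : 0 < r) {x : ℝ} (hx : 0 ≤ x) : 0 < wt r x := by
  unfold wt; positivity

theorem wt_le_one (hr : 0 < r) {x : ℝ} (hx : 0 ≤ x) : wt r x ≤ 1 :=
  Real.rpow_le_one_of_one_le_of_nonpos (by nlinarith) (by norm_num)

theorem hasDerivAt_wt (hr : 0 < r) {x : ℝ} (hx : 0 ≤ x) :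
    HasDerivAt (wt r) (r * (-(3 / 2)) * (r * x + 1) ^ (-(3 / 2) - 1 : ℝ)) x := by
  have h : HasDerivAt (fun x : ℝ => r * x + 1) r x := by
    simpa using ((hasDerivAt_id x).const_mul r).add_const 1
  exact h.rpow_const (Or.inl (by positivity))

/-- The logarithmic derivative of the weight is at least `-3r/2`, so the weight costs the barrier
argument only a term of order `r`. -/
theorem wt_deriv_ge (hr : 0 < r) {x : ℝ} (hx : 0 ≤ x) :
    -(3 / 2 * r * wt r x) ≤ r * (-(3 / 2)) * (r * x + 1) ^ (-(3 / 2) - 1 : ℝ) := by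
  have : (r * x + 1) ^ (-(3 / 2) - 1 : ℝ) ≤ wt r x :=
    Real.rpow_le_rpow_of_exponent_le (by nlinarith) (by norm_num)
  nlinarith

theorem continuousOn_wt (hr : 0 < r) : ContinuousOn (wt r) (Ici 0) :=
  fun _ hx => (hasDerivAt_wt hr hx).continuousAt.continuousWithinAt

theorem intervalIntegrable_wt (hr : 0 < r) {x : ℝ} (hx : 0 ≤ x) :
    IntervalIntegrable (wt r) MeasureTheory.volume 0 x :=
  ((continuousOn_wt hr).mono (by rw [uIcc_of_le hx]; exact Icc_subset_Ici_self)).intervalIntegrable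

/-- The primitive of `r * wt r` is `-2 (r u + 1)^{-1/2}`. The exponent `3/2 > 1` makes the integral
bounded uniformly in `x`. -/
theorem integral_wt_le (hr : 0 < r) {x : ℝ} (hx : 0 ≤ x) : r * ∫ u in (0 : ℝ)..x, wt r u ≤ 2 := by
  have key : ∫ u in (0 : ℝ)..x, r * wt r u
      = -2 * (r * x + 1) ^ (-(1 / 2) : ℝ) - -2 * (r * 0 + 1) ^ (-(1 / 2) : ℝ) := by
    refine intervalIntegral.integral_eq_sub_of_hasDerivAt
      (f := fun u => -2 * (r * u + 1) ^ (-(1 / 2) : ℝ)) (fun u hu => ?_)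
      ((intervalIntegrable_wt hr hx).const_mul r)
    rw [uIcc_of_le hx] at hu
    have h : HasDerivAt (fun x : ℝ => r * x + 1) r u := by
      simpa using ((hasDerivAt_id u).const_mul r).add_const 1
    have hp : r * u + 1 ≠ 0 := by have := hu.1; positivity
    refine ((h.rpow_const (p := -(1 / 2)) (Or.inl hp)).const_mul (-2)).congr_deriv ?_
    rw [wt, show (-(1 / 2) - 1 : ℝ) = -(3 / 2) by norm_num]
    ring
  rw [← intervalIntegral.integral_const_mul, key]
  have : 0 ≤ (r * x + 1) ^ (-(1 / 2) : ℝ) := by positivity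
  simp
  linarith

/-- The larger of `x` and `y` is at least `(x + y)/2`, and halving the argument costs a factor at
most `2^{3/2} ≤ 3`. The other factor stays available for integration, so the weight is stable under
convolution. -/
theorem wt_mul_wt_le (hr : 0 < r) {x y : ℝ} (hx : 0 ≤ x) (hy : 0 ≤ y) :
    wt r x * wt r y ≤ 3 * wt r (x + y) * (wt r x + wt r y) := by
  have key : ∀ x y : ℝ, 0 ≤ x → x ≤ y → wt r y ≤ 3 * wt r (x + y) := by
    intro x y hx hxy
    have h1 : (r * (x + y) + 1) / 2 ≤ r * y + 1 := by nlinarith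
    have hp : 0 < r * (x + y) + 1 := by nlinarith
    have h2 : wt r y ≤ ((r * (x + y) + 1) / 2) ^ (-(3 / 2) : ℝ) :=
      Real.rpow_le_rpow_of_nonpos (by positivity) h1 (by norm_num)
    refine h2.trans ?_
    rw [Real.div_rpow hp.le (by norm_num), div_eq_mul_inv, ← Real.rpow_neg (by norm_num), mul_comm]
    refine mul_le_mul_of_nonneg_right ?_ (wt_pos hr (by linarith)).le
    -- The inequality `2^{3/2} ≤ 3` is read as `8^{1/2} ≤ 9^{1/2}`. The rewriting also hits the 3 in
    -- the exponent, which the second rewrite restores.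
    rw [show (3 : ℝ) = (9 : ℝ) ^ (1 / 2 : ℝ) by
        rw [← Real.sqrt_eq_rpow, show (9 : ℝ) = 3 ^ 2 by norm_num, Real.sqrt_sq (by norm_num)],
      show -(-(((9 : ℝ) ^ (1 / 2 : ℝ)) / 2)) = 3 * (1 / 2) by
        rw [← Real.sqrt_eq_rpow, show (9 : ℝ) = 3 ^ 2 by norm_num, Real.sqrt_sq (by norm_num)]
        norm_num, Real.rpow_mul (by norm_num)]
    exact Real.rpow_le_rpow (by positivity) (by norm_num) (by norm_num)
  have hx' := wt_pos hr hx
  have hy' := wt_pos hr hy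
  have hxy := wt_pos hr (add_nonneg hx hy)
  rcases le_total x y with h | h
  · have := key x y hx h
    nlinarith [mul_pos hxy hy', mul_pos hxy hx']
  · have := key y x hy h
    rw [add_comm y x] at this
    nlinarith [mul_pos hxy hy', mul_pos hxy hx']

end Weights

theorem continuous_parametric_integral {X : Type*} [TopologicalSpace X] {f : X → ℝ → ℝ}
    (hf : Continuous (Function.uncurry f)) {b c : X → ℝ} (hb : Continuous b) (hc : Continuous c) :
    Continuous fun x => ∫ u in b x..c x, f x u := by
  have e : (fun x => ∫ u in b x..c x, f x u) =
      fun x => (∫ u in (0 : ℝ)..c x, f x u) - ∫ u in (0 : ℝ)..b x, f x u := by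
    ext x
    have hx : Continuous (f x) := hf.comp (by fun_prop : Continuous fun u => (x, u))
    rw [intervalIntegral.integral_interval_sub_left (hx.intervalIntegrable _ _)
      (hx.intervalIntegrable _ _)]
  rw [e]
  exact (intervalIntegral.continuous_parametric_intervalIntegral_of_continuous hf hc).sub
    (intervalIntegral.continuous_parametric_intervalIntegral_of_continuous hf hb)

end SphericalSpinGlass

/-! ### The linearised map and its explicit solution. -/

namespace SphericalSpinGlass

/-- The memory integral `∫_t^s f(u,t) f(s,u) ν''(C(s,u)) du` of the response equation. -/
noncomputable def memR (m : ℕ) (a : ℕ → ℝ) (P : TwoTime) (f : ℝ → ℝ → ℝ) (s t : ℝ) : ℝ :=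
  ∫ u in t..s, f u t * f s u * nu2 m a (P.2 s u)

/-- The linearised form of `IsPsi`: the quadratic term of the equation for the response is
evaluated at a given function `f`. -/
structure IsStep (m : ℕ) (a : ℕ → ℝ) (β : ℝ) (P : TwoTime) (f : ℝ → ℝ → ℝ) (Q : TwoTime) :
    Prop where
  admissible : IsAdmissible Q
  eq_R : ∀ s t, 0 ≤ t → t ≤ s →
    HasDerivWithinAt (fun v => Q.1 v t)
      (-(muRC m a β P s) * Q.1 s t + β ^ 2 * memR m a P f s t) (Ici t) s
  eq_C : ∀ s t, 0 ≤ t → t ≤ s →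
    HasDerivWithinAt (fun v => Q.2 v t)
      (-(muRC m a β P s) * Q.2 s t + β ^ 2 * (I1 m a P s t + I2 m a P s t)) (Ici t) s

/-- Two functions agree on `Γ`. -/
def AgreeR (f g : ℝ → ℝ → ℝ) : Prop := ∀ s t, 0 ≤ t → t ≤ s → f s t = g s t

variable {m : ℕ} {a : ℕ → ℝ} {β : ℝ} {P P' Q Q' : TwoTime} {f f' : ℝ → ℝ → ℝ}

/-- The implicit definition of `Ψ(P)` becomes a fixed-point problem for the frozen response `f`. -/
theorem isPsi_iff_isStep : IsPsi m a β P Q ↔ IsStep m a β P Q.1 Q :=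
  ⟨fun h => ⟨h.admissible, h.eq_R, fun s t h0 h1 => (h.eq_C s t h0 h1).congr_deriv (by ring)⟩,
    fun h => ⟨h.admissible, h.eq_R, fun s t h0 h1 => (h.eq_C s t h0 h1).congr_deriv (by ring)⟩⟩

theorem isSphericalSolution_iff_isPsi : IsSphericalSolution m a β P ↔ IsPsi m a β P P :=
  ⟨fun h => ⟨h.admissible, h.eq_R, h.eq_C⟩, fun h => ⟨h.admissible, h.eq_R, h.eq_C⟩⟩

section Congruence

theorem Agree.symm (h : Agree P Q) : Agree Q P :=
  ⟨fun s t h0 h1 => (h.1 s t h0 h1).symm, fun s t h0 h1 => (h.2 s t h0 h1).symm⟩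

theorem Agree.trans {S : TwoTime} (h : Agree P Q) (h' : Agree Q S) : Agree P S :=
  ⟨fun s t h0 h1 => (h.1 s t h0 h1).trans (h'.1 s t h0 h1),
    fun s t h0 h1 => (h.2 s t h0 h1).trans (h'.2 s t h0 h1)⟩

theorem IsAdmissible.congr (h : IsAdmissible P) (hP : Agree P P') : IsAdmissible P' where
  continuous_R := h.continuous_R.congr fun p hp => (hP.1 p.1 p.2 hp.1 hp.2).symm
  continuous_C := h.continuous_C.congr fun p hp => (hP.2 p.1 p.2 hp.1 hp.2).symm
  diag_R t ht := by rw [← hP.1 t t ht le_rfl, h.diag_R t ht]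
  diag_C t ht := by rw [← hP.2 t t ht ht, h.diag_C t ht]
  symm_C s t hs ht := by rw [← hP.2 s t hs ht, ← hP.2 t s ht hs, h.symm_C s t hs ht]

theorem muRC_congr (hP : Agree P P') {s : ℝ} (hs : 0 ≤ s) : muRC m a β P s = muRC m a β P' s := by
  unfold muRC
  congr 2
  refine intervalIntegral.integral_congr fun u hu => ?_
  rw [uIcc_of_le hs] at hu
  simp only [hP.2 s u hs hu.1, hP.1 s u hu.1 hu.2]

theorem memR_congr (hP : Agree P P') (hf : AgreeR f f') {s t : ℝ} (ht : 0 ≤ t) (hs : t ≤ s) :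
    memR m a P f s t = memR m a P' f' s t := by
  refine intervalIntegral.integral_congr fun u hu => ?_
  rw [uIcc_of_le hs] at hu
  have hu0 := ht.trans hu.1
  simp only [hP.2 s u (ht.trans hs) hu0, hf s u hu0 hu.2, hf u t ht hu.1]

theorem I1_congr (hP : Agree P P') {s t : ℝ} (ht : 0 ≤ t) (hs : t ≤ s) :
    I1 m a P s t = I1 m a P' s t := by
  have hs0 := ht.trans hs
  refine intervalIntegral.integral_congr fun u hu => ?_
  rw [uIcc_of_le hs0] at hu
  simp only [hP.2 s u hs0 hu.1, hP.1 s u hu.1 hu.2, hP.2 u t hu.1 ht]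

theorem I2_congr (hP : Agree P P') {s t : ℝ} (ht : 0 ≤ t) (hs : t ≤ s) :
    I2 m a P s t = I2 m a P' s t := by
  have hs0 := ht.trans hs
  refine intervalIntegral.integral_congr fun u hu => ?_
  rw [uIcc_of_le ht] at hu
  simp only [hP.2 s u hs0 hu.1, hP.1 t u hu.1 hu.2]

/-- All integrals and derivatives involved see only `Γ` and the quadrant. The data may thus be
replaced by representatives continuous on the whole plane, for which integrability and continuity in
parameters are immediate. -/
theorem IsStep.congr (h : IsStep m a β P f Q) (hP : Agree P P') (hf : AgreeR f f')
    (hQ : Agree Q Q') : IsStep m a β P' f' Q' where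
  admissible := h.admissible.congr hQ
  eq_R s t ht hs := by
    rw [← muRC_congr hP (ht.trans hs), ← memR_congr hP hf ht hs, ← hQ.1 s t ht hs]
    exact (h.eq_R s t ht hs).congr (fun v hv => (hQ.1 v t ht hv).symm) (hQ.1 s t ht hs).symm
  eq_C s t ht hs := by
    rw [← muRC_congr hP (ht.trans hs), ← I1_congr hP ht hs, ← I2_congr hP ht hs,
      ← hQ.2 s t (ht.trans hs) ht]
    exact (h.eq_C s t ht hs).congr (fun v hv => (hQ.2 v t (ht.trans hv) ht).symm)
      (hQ.2 s t (ht.trans hs) ht).symm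

end Congruence

section Clamp

/-- Extension of a function on `Γ` to the plane. -/
noncomputable def clampR (f : ℝ → ℝ → ℝ) (s t : ℝ) : ℝ := f (max s (max t 0)) (max t 0)

/-- Extension of a pair of functions on `Γ` and on the quadrant to the plane. -/
noncomputable def clamp (P : TwoTime) : TwoTime :=
  (clampR P.1, fun s t => P.2 (max s 0) (max t 0))

theorem agreeR_clampR (f : ℝ → ℝ → ℝ) : AgreeR f (clampR f) := by
  intro s t ht hs
  simp [clampR, max_eq_left ht, max_eq_left hs]

theorem agree_clamp (P : TwoTime) : Agree P (clamp P) :=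
  ⟨agreeR_clampR P.1, fun s t hs ht => by simp [clamp, max_eq_left ht, max_eq_left hs]⟩

theorem continuous_clampR (hf : ContinuousOn (fun p : ℝ × ℝ => f p.1 p.2) Gam) :
    Continuous fun p : ℝ × ℝ => clampR f p.1 p.2 :=
  hf.comp_continuous
    (f := fun p : ℝ × ℝ => ((max p.1 (max p.2 0), max p.2 0) : ℝ × ℝ)) (by fun_prop)
    fun _ => ⟨le_max_right _ _, le_max_right _ _⟩

theorem continuous_clamp_C (hf : ContinuousOn (fun p : ℝ × ℝ => P.2 p.1 p.2) Quad) :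
    Continuous fun p : ℝ × ℝ => (clamp P).2 p.1 p.2 :=
  hf.comp_continuous
    (f := fun p : ℝ × ℝ => ((max p.1 0, max p.2 0) : ℝ × ℝ)) (by fun_prop)
    fun _ => ⟨le_max_right _ _, le_max_right _ _⟩

end Clamp

section Existence

/-- Both components of a pair are continuous on the whole plane. -/
def IsCont (P : TwoTime) : Prop :=
  (Continuous fun p : ℝ × ℝ => P.1 p.1 p.2) ∧ Continuous fun p : ℝ × ℝ => P.2 p.1 p.2

theorem IsAdmissible.isCont_clamp (h : IsAdmissible P) : IsCont (clamp P) :=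
  ⟨continuous_clampR h.continuous_R, continuous_clamp_C h.continuous_C⟩

theorem continuous_section {X : Type*} [TopologicalSpace X] {f : ℝ → ℝ → ℝ}
    (hf : Continuous fun p : ℝ × ℝ => f p.1 p.2)
    {x y : X → ℝ} (hx : Continuous x) (hy : Continuous y) : Continuous fun z => f (x z) (y z) :=
  hf.comp (hx.prodMk hy)

theorem continuous_muRC (h : IsCont P) : Continuous (muRC m a β P) := by
  unfold muRC
  refine continuous_const.add (continuous_const.mul
    (continuous_parametric_integral ?_ continuous_const continuous_id))
  exact ((continuous_psi m a).comp (continuous_section h.2 continuous_fst continuous_snd)).mul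
    (continuous_section h.1 continuous_fst continuous_snd)

theorem continuous_memR (h : IsCont P) (hf : Continuous fun p : ℝ × ℝ => f p.1 p.2) :
    Continuous fun p : ℝ × ℝ => memR m a P f p.1 p.2 := by
  refine continuous_parametric_integral ?_ continuous_snd continuous_fst
  exact ((continuous_section hf continuous_snd (by fun_prop)).mul
    (continuous_section hf (by fun_prop) continuous_snd)).mul
    ((continuous_nu2 m a).comp (continuous_section h.2 (by fun_prop) continuous_snd))

theorem continuous_I1 (h : IsCont P) : Continuous fun p : ℝ × ℝ => I1 m a P p.1 p.2 := by
  refine continuous_parametric_integral ?_ continuous_const continuous_fst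
  exact ((continuous_section h.2 continuous_snd (by fun_prop)).mul
    (continuous_section h.1 (by fun_prop) continuous_snd)).mul
    ((continuous_nu2 m a).comp (continuous_section h.2 (by fun_prop) continuous_snd))

theorem continuous_I2 (h : IsCont P) : Continuous fun p : ℝ × ℝ => I2 m a P p.1 p.2 := by
  refine continuous_parametric_integral ?_ continuous_const continuous_snd
  exact ((continuous_nu1 m a).comp (continuous_section h.2 (by fun_prop) continuous_snd)).mul
    (continuous_section h.1 (by fun_prop) continuous_snd)

/-- The solution of `∂_s h(s,t) = -μ(s) h(s,t) + g(s,t)`, `h(t,t) = 1`. -/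
noncomputable def linSol (μ : ℝ → ℝ) (g : ℝ → ℝ → ℝ) (s t : ℝ) : ℝ :=
  Real.exp (-∫ x in (0 : ℝ)..s, μ x) *
    (Real.exp (∫ x in (0 : ℝ)..t, μ x) + ∫ v in t..s, Real.exp (∫ x in (0 : ℝ)..v, μ x) * g v t)

variable {μ : ℝ → ℝ} {g : ℝ → ℝ → ℝ}

theorem linSol_diag (t : ℝ) : linSol μ g t t = 1 := by
  simp [linSol, ← Real.exp_add]

theorem continuous_linSol (hμ : Continuous μ) (hg : Continuous fun p : ℝ × ℝ => g p.1 p.2) :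
    Continuous fun p : ℝ × ℝ => linSol μ g p.1 p.2 := by
  have hM : Continuous fun s => ∫ x in (0 : ℝ)..s, μ x :=
    intervalIntegral.continuous_primitive (fun _ _ => hμ.intervalIntegrable _ _) 0
  have h1 : Continuous fun p : ℝ × ℝ =>
      ∫ v in p.2..p.1, Real.exp (∫ x in (0 : ℝ)..v, μ x) * g v p.2 := by
    refine continuous_parametric_integral ?_ continuous_snd continuous_fst
    exact (Real.continuous_exp.comp (hM.comp continuous_snd)).mul
      (continuous_section hg continuous_snd (by fun_prop))
  exact (Real.continuous_exp.comp (hM.comp continuous_fst).neg).mul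
    ((Real.continuous_exp.comp (hM.comp continuous_snd)).add h1)

theorem hasDerivAt_linSol (hμ : Continuous μ) (hg : Continuous fun p : ℝ × ℝ => g p.1 p.2)
    (s t : ℝ) : HasDerivAt (fun v => linSol μ g v t) (-(μ s) * linSol μ g s t + g s t) s := by
  have hM : Continuous fun s => ∫ x in (0 : ℝ)..s, μ x :=
    intervalIntegral.continuous_primitive (fun _ _ => hμ.intervalIntegrable _ _) 0
  have d1 : HasDerivAt (fun s => ∫ x in (0 : ℝ)..s, μ x) (μ s) s :=
    (hμ.integral_hasStrictDerivAt 0 s).hasDerivAt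
  have hi : Continuous fun v => Real.exp (∫ x in (0 : ℝ)..v, μ x) * g v t :=
    (Real.continuous_exp.comp hM).mul (continuous_section hg continuous_id continuous_const)
  have d2 := (hi.integral_hasStrictDerivAt t s).hasDerivAt
  refine ((d1.neg.exp).mul (d2.const_add (Real.exp (∫ x in (0 : ℝ)..t, μ x)))).congr_deriv ?_
  have e : Real.exp (-∫ x in (0 : ℝ)..s, μ x) * Real.exp (∫ x in (0 : ℝ)..s, μ x) = 1 := by
    rw [← Real.exp_add]; simp
  simp only [linSol]
  linear_combination (g s t) * e

/-- The explicit solution of `IsStep` for globally continuous data. -/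
noncomputable def stepSol (m : ℕ) (a : ℕ → ℝ) (β : ℝ) (P : TwoTime) (f : ℝ → ℝ → ℝ) : TwoTime :=
  (linSol (muRC m a β P) fun s t => β ^ 2 * memR m a P f s t,
    fun s t => linSol (muRC m a β P) (fun s t => β ^ 2 * (I1 m a P s t + I2 m a P s t))
      (max s t) (min s t))

theorem isStep_stepSol (h : IsCont P) (hf : Continuous fun p : ℝ × ℝ => f p.1 p.2) :
    IsStep m a β P f (stepSol m a β P f) := by
  have hμ := continuous_muRC (m := m) (a := a) (β := β) h
  have hR : Continuous fun p : ℝ × ℝ => β ^ 2 * memR m a P f p.1 p.2 :=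
    continuous_const.mul (continuous_memR h hf)
  have hC : Continuous fun p : ℝ × ℝ => β ^ 2 * (I1 m a P p.1 p.2 + I2 m a P p.1 p.2) :=
    continuous_const.mul ((continuous_I1 (m := m) (a := a) h).add (continuous_I2 (m := m) (a := a) h))
  have hR' := continuous_linSol (g := fun s t => β ^ 2 * memR m a P f s t) hμ hR
  have hC' := continuous_linSol
    (g := fun s t => β ^ 2 * (I1 m a P s t + I2 m a P s t)) hμ hC
  refine ⟨⟨hR'.continuousOn, ?_, fun t _ => by simp [stepSol, linSol_diag],
    fun t _ => ?_, fun s t _ _ => ?_⟩, fun s t ht hs => ?_, fun s t ht hs => ?_⟩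
  · exact (continuous_section hC'
      (continuous_fst.max continuous_snd) (continuous_fst.min continuous_snd)).continuousOn
  · simp [stepSol, linSol_diag]
  · simp [stepSol, max_comm, min_comm]
  · exact (hasDerivAt_linSol (g := fun s t => β ^ 2 * memR m a P f s t) hμ hR s t).hasDerivWithinAt
  · have e : ∀ v, v ∈ Ici t → (stepSol m a β P f).2 v t =
        linSol (muRC m a β P) (fun s t => β ^ 2 * (I1 m a P s t + I2 m a P s t)) v t := by
      intro v hv
      simp [stepSol, max_eq_left (mem_Ici.1 hv), min_eq_right (mem_Ici.1 hv)]
    rw [e s hs]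
    exact (hasDerivAt_linSol
      (g := fun s t => β ^ 2 * (I1 m a P s t + I2 m a P s t)) hμ hC s t).hasDerivWithinAt.congr e (e s hs)

/-- A solution of `IsStep`. -/
noncomputable def stepMap (m : ℕ) (a : ℕ → ℝ) (β : ℝ) (P : TwoTime) (f : ℝ → ℝ → ℝ) : TwoTime :=
  stepSol m a β (clamp P) (clampR f)

theorem isStep_stepMap (h : IsAdmissible P) (hf : ContinuousOn (fun p : ℝ × ℝ => f p.1 p.2) Gam) :
    IsStep m a β P f (stepMap m a β P f) :=
  (isStep_stepSol h.isCont_clamp (continuous_clampR hf)).congr (agree_clamp P).symm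
    (fun s t ht hs => (agreeR_clampR f s t ht hs).symm)
    ⟨fun _ _ _ _ => rfl, fun _ _ _ _ => rfl⟩

end Existence

end SphericalSpinGlass

namespace SphericalSpinGlass

variable {m : ℕ} {a : ℕ → ℝ} {β r : ℝ} {P P' Q Q' : TwoTime} {f f' : ℝ → ℝ → ℝ}

/-! ### Invariance of the decay bounds. -/

section WeightIntegrals

theorem intervalIntegrable_wt_sub_left (hr : 0 < r) {s t : ℝ} (h : t ≤ s) :
    IntervalIntegrable (fun u => wt r (s - u)) MeasureTheory.volume t s := by
  refine ContinuousOn.intervalIntegrable ?_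
  rw [uIcc_of_le h]
  exact (continuousOn_wt hr).comp (by fun_prop) fun u hu => mem_Ici.2 (sub_nonneg.2 hu.2)

theorem intervalIntegrable_wt_sub_right (hr : 0 < r) {s t : ℝ} (h : t ≤ s) :
    IntervalIntegrable (fun u => wt r (u - t)) MeasureTheory.volume t s := by
  refine ContinuousOn.intervalIntegrable ?_
  rw [uIcc_of_le h]
  exact (continuousOn_wt hr).comp (by fun_prop) fun u hu => mem_Ici.2 (sub_nonneg.2 hu.1)

theorem integral_wt_sub_left_le (hr : 0 < r) {s t : ℝ} (h : t ≤ s) :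
    r * ∫ u in t..s, wt r (s - u) ≤ 2 := by
  rw [intervalIntegral.integral_comp_sub_left, sub_self]
  exact integral_wt_le hr (by linarith)

theorem integral_wt_sub_right_le (hr : 0 < r) {s t : ℝ} (h : t ≤ s) :
    r * ∫ u in t..s, wt r (u - t) ≤ 2 := by
  rw [intervalIntegral.integral_comp_sub_right, sub_self]
  exact integral_wt_le hr (by linarith)

end WeightIntegrals

section Bounds

/-- The constraint on the response in `ASet (1 / 6) r 1 2`. -/
def RBound (r : ℝ) (f : ℝ → ℝ → ℝ) : Prop :=
  ∀ s t, 0 ≤ t → t ≤ s → 0 ≤ f s t ∧ f s t ≤ wt r (s - t) * Real.exp (-(1 / 6) * (s - t))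

/-- The constraint on the correlation in `ASet (1 / 6) r 1 2`. -/
def CBound (c : ℝ → ℝ → ℝ) : Prop :=
  ∀ s t, 0 ≤ s → 0 ≤ t → 0 ≤ c s t ∧ c s t ≤ 2 * Real.exp (-(1 / 6) * |s - t|)

theorem mem_ASet_iff :
    P ∈ ASet (1 / 6) r 1 2 ↔ IsAdmissible P ∧ RBound r P.1 ∧ CBound P.2 := by
  constructor
  · rintro ⟨⟨h1, h2, h3⟩, h4⟩
    refine ⟨h1, fun s t ht hs => ⟨h2 s t ht hs, ?_⟩, fun s t hs ht => ⟨h3 s t hs ht, ?_⟩⟩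
    · have := (h4 s t ht hs).2
      rwa [one_mul, abs_of_nonneg (sub_nonneg.2 hs)] at this
    · rcases le_total t s with h | h
      · exact (h4 s t ht h).1
      · rw [h1.symm_C s t hs ht, abs_sub_comm]
        exact (h4 t s hs h).1
  · rintro ⟨h1, h2, h3⟩
    refine ⟨⟨h1, fun s t ht hs => (h2 s t ht hs).1, fun s t hs ht => (h3 s t hs ht).1⟩,
      fun s t ht hs => ⟨(h3 s t (ht.trans hs) ht).2, ?_⟩⟩
    rw [one_mul, abs_of_nonneg (sub_nonneg.2 hs)]
    exact (h2 s t ht hs).2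

theorem RBound.congr (h : RBound r f) (hf : AgreeR f f') : RBound r f' := by
  intro s t ht hs
  rw [← hf s t ht hs]
  exact h s t ht hs

theorem mem_ASet_congr (h : P ∈ ASet (1 / 6) r 1 2) (hP : Agree P P') :
    P' ∈ ASet (1 / 6) r 1 2 := by
  rw [mem_ASet_iff] at h ⊢
  refine ⟨h.1.congr hP, h.2.1.congr hP.1, fun s t hs ht => ?_⟩
  rw [← hP.2 s t hs ht]
  exact h.2.2 s t hs ht

theorem RBound.le_exp (hr : 0 < r) (h : RBound r f) {s t : ℝ} (ht : 0 ≤ t) (hs : t ≤ s) :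
    f s t ≤ Real.exp (-(1 / 6) * (s - t)) :=
  (h s t ht hs).2.trans (mul_le_of_le_one_left (Real.exp_pos _).le
    (wt_le_one hr (sub_nonneg.2 hs)))

theorem RBound.le_one (hr : 0 < r) (h : RBound r f) {s t : ℝ} (ht : 0 ≤ t) (hs : t ≤ s) :
    f s t ≤ 1 :=
  (h.le_exp hr ht hs).trans (Real.exp_le_one_iff.2 (by linarith))

theorem CBound.le_two {c : ℝ → ℝ → ℝ} (h : CBound c) {s t : ℝ} (hs : 0 ≤ s) (ht : 0 ≤ t) :
    c s t ≤ 2 := by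
  have h1 := (h s t hs ht).2
  have h2 : Real.exp (-(1 / 6) * |s - t|) ≤ 1 :=
    Real.exp_le_one_iff.2 (by have := abs_nonneg (s - t); linarith)
  linarith

/-- For non-negative `R` and `C` the memory term can only increase the damping. -/
theorem half_le_muRC (hR : RBound r P.1) (hC : CBound P.2) {s : ℝ} (hs : 0 ≤ s) :
    1 / 2 ≤ muRC m a β P s := by
  unfold muRC
  have : 0 ≤ ∫ u in (0 : ℝ)..s, psi m a (P.2 s u) * P.1 s u :=
    intervalIntegral.integral_nonneg hs fun u hu =>
      mul_nonneg (psi_nonneg m a (hC s u hs hu.1).1) (hR s u hu.1 hu.2).1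
  nlinarith [sq_nonneg β]

theorem memR_nonneg (hC : CBound P.2) (hf : RBound r f) {s t : ℝ} (ht : 0 ≤ t) (hs : t ≤ s) :
    0 ≤ memR m a P f s t :=
  intervalIntegral.integral_nonneg hs fun u hu =>
    mul_nonneg (mul_nonneg (hf u t ht hu.1).1 (hf s u (ht.trans hu.1) hu.2).1)
      (nu2_nonneg m a (hC s u (ht.trans hs) (ht.trans hu.1)).1)

theorem I1_nonneg (hR : RBound r P.1) (hC : CBound P.2) {s t : ℝ} (ht : 0 ≤ t) (hs : t ≤ s) :
    0 ≤ I1 m a P s t :=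
  intervalIntegral.integral_nonneg (ht.trans hs) fun u hu =>
    mul_nonneg (mul_nonneg (hC u t hu.1 ht).1 (hR s u hu.1 hu.2).1)
      (nu2_nonneg m a (hC s u (ht.trans hs) hu.1).1)

theorem I2_nonneg (hR : RBound r P.1) (hC : CBound P.2) {s t : ℝ} (ht : 0 ≤ t) (hs : t ≤ s) :
    0 ≤ I2 m a P s t :=
  intervalIntegral.integral_nonneg ht fun u hu =>
    mul_nonneg (nu1_nonneg m a (hC s u (ht.trans hs) hu.1).1) (hR t u hu.1 hu.2).1

theorem intervalIntegrable_memR (h : IsCont P) (hf : Continuous fun p : ℝ × ℝ => f p.1 p.2)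
    (s t x y : ℝ) : IntervalIntegrable (fun u => f u t * f s u * nu2 m a (P.2 s u))
      MeasureTheory.volume x y := by
  refine Continuous.intervalIntegrable ?_ _ _
  exact ((continuous_section hf continuous_id continuous_const).mul
    (continuous_section hf continuous_const continuous_id)).mul
    ((continuous_nu2 m a).comp (continuous_section h.2 continuous_const continuous_id))

theorem intervalIntegrable_I1 (h : IsCont P) (s t x y : ℝ) :
    IntervalIntegrable (fun u => P.2 u t * P.1 s u * nu2 m a (P.2 s u))
      MeasureTheory.volume x y := by
  refine Continuous.intervalIntegrable ?_ _ _
  exact ((continuous_section h.2 continuous_id continuous_const).mul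
    (continuous_section h.1 continuous_const continuous_id)).mul
    ((continuous_nu2 m a).comp (continuous_section h.2 continuous_const continuous_id))

theorem intervalIntegrable_I2 (h : IsCont P) (s t x y : ℝ) :
    IntervalIntegrable (fun u => nu1 m a (P.2 s u) * P.1 t u)
      MeasureTheory.volume x y := by
  refine Continuous.intervalIntegrable ?_ _ _
  exact ((continuous_nu1 m a).comp (continuous_section h.2 continuous_const continuous_id)).mul
    (continuous_section h.1 continuous_const continuous_id)

theorem intervalIntegrable_muRC (h : IsCont P) (s x y : ℝ) :
    IntervalIntegrable (fun u => psi m a (P.2 s u) * P.1 s u)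
      MeasureTheory.volume x y := by
  refine Continuous.intervalIntegrable ?_ _ _
  exact ((continuous_psi m a).comp (continuous_section h.2 continuous_const continuous_id)).mul
    (continuous_section h.1 continuous_const continuous_id)

/-- The two exponentials multiply exactly to `e^{-(s-t)/6}`, and the product of the two weights is
split by `wt_mul_wt_le`. The remaining integrals contribute `3 * (2 + 2) / r` against the prefactor
`r²`, leaving `12 r`. -/
theorem memR_le (hr : 0 < r) (hβ : β ^ 2 * nu2 m a 2 = r ^ 2) (h : IsCont P) (hC : CBound P.2)
    (hfc : Continuous fun p : ℝ × ℝ => f p.1 p.2) (hf : RBound r f)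
    {s t : ℝ} (ht : 0 ≤ t) (hs : t ≤ s) :
    β ^ 2 * memR m a P f s t ≤ 12 * r * (wt r (s - t) * Real.exp (-(1 / 6) * (s - t))) := by
  have hK := nu2_nonneg m a (x := 2) (by norm_num)
  have key : memR m a P f s t ≤ ∫ u in t..s, nu2 m a 2 *
      (3 * (wt r (s - t) * Real.exp (-(1 / 6) * (s - t)))) * (wt r (u - t) + wt r (s - u)) := by
    refine intervalIntegral.integral_mono_on hs (intervalIntegrable_memR h hfc s t _ _)
      (((intervalIntegrable_wt_sub_right hr hs).add
        (intervalIntegrable_wt_sub_left hr hs)).const_mul _) fun u hu => ?_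
    have hu0 := ht.trans hu.1
    obtain ⟨a1, a2⟩ := hf u t ht hu.1
    obtain ⟨b1, b2⟩ := hf s u hu0 hu.2
    have c1 := (hC s u (ht.trans hs) hu0).1
    have c2 := nu2_mono m a c1 (hC.le_two (ht.trans hs) hu0)
    have c3 := nu2_nonneg m a c1
    have d := wt_mul_wt_le hr (sub_nonneg.2 hu.1) (sub_nonneg.2 hu.2)
    rw [show u - t + (s - u) = s - t by ring] at d
    have e : Real.exp (-(1 / 6) * (u - t)) * Real.exp (-(1 / 6) * (s - u)) =
        Real.exp (-(1 / 6) * (s - t)) := by rw [← Real.exp_add]; ring_nf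
    calc f u t * f s u * nu2 m a (P.2 s u)
        ≤ (wt r (u - t) * Real.exp (-(1 / 6) * (u - t))) *
          (wt r (s - u) * Real.exp (-(1 / 6) * (s - u))) * nu2 m a 2 :=
          mul_le_mul (mul_le_mul a2 b2 b1 (a1.trans a2)) c2 c3
            (mul_nonneg (a1.trans a2) (b1.trans b2))
      _ = (wt r (u - t) * wt r (s - u)) * (Real.exp (-(1 / 6) * (s - t)) * nu2 m a 2) := by
          rw [← e]; ring
      _ ≤ (3 * wt r (s - t) * (wt r (u - t) + wt r (s - u))) *
            (Real.exp (-(1 / 6) * (s - t)) * nu2 m a 2) :=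
          mul_le_mul_of_nonneg_right d (mul_nonneg (Real.exp_pos _).le hK)
      _ = _ := by ring
  rw [intervalIntegral.integral_const_mul, intervalIntegral.integral_add
    (intervalIntegrable_wt_sub_right hr hs) (intervalIntegrable_wt_sub_left hr hs)] at key
  have h1 := integral_wt_sub_right_le hr hs
  have h2 := integral_wt_sub_left_le hr hs
  have hG : 0 ≤ wt r (s - t) * Real.exp (-(1 / 6) * (s - t)) :=
    mul_nonneg (wt_pos hr (sub_nonneg.2 hs)).le (Real.exp_pos _).le
  set G := wt r (s - t) * Real.exp (-(1 / 6) * (s - t))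
  set A := ∫ u in t..s, wt r (u - t)
  set B := ∫ u in t..s, wt r (s - u)
  calc β ^ 2 * memR m a P f s t ≤ β ^ 2 * (nu2 m a 2 * (3 * G) * (A + B)) :=
        mul_le_mul_of_nonneg_left key (sq_nonneg β)
    _ = (β ^ 2 * nu2 m a 2) * (3 * G) * (A + B) := by ring
    _ = (3 * r * G) * (r * A + r * B) := by rw [hβ]; ring
    _ ≤ (3 * r * G) * (2 + 2) := mul_le_mul_of_nonneg_left (add_le_add h1 h2) (by positivity)
    _ = _ := by ring

/-- Here `C` carries no polynomial weight, and none is needed: `|u - t| + (s - u) ≥ s - t` yields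
the full exponential, and the weight of the single response integrates to at most `2/r`. The bound
for `I2` works alike, with `(s - u) + (t - u) ≥ s - t`. -/
theorem I1_le (hr : 0 < r) (hβ : β ^ 2 * nu2 m a 2 = r ^ 2) (h : IsCont P) (hR : RBound r P.1)
    (hC : CBound P.2) {s t : ℝ} (ht : 0 ≤ t) (hs : t ≤ s) :
    β ^ 2 * I1 m a P s t ≤ 4 * r * Real.exp (-(1 / 6) * (s - t)) := by
  have hK := nu2_nonneg m a (x := 2) (by norm_num)
  have hs0 := ht.trans hs
  have key : I1 m a P s t ≤ ∫ u in (0 : ℝ)..s,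
      (2 * Real.exp (-(1 / 6) * (s - t)) * nu2 m a 2) * wt r (s - u) := by
    refine intervalIntegral.integral_mono_on hs0 (intervalIntegrable_I1 h s t _ _)
      ((intervalIntegrable_wt_sub_left hr hs0).const_mul _) fun u hu => ?_
    obtain ⟨a1, a2⟩ := hC u t hu.1 ht
    obtain ⟨b1, b2⟩ := hR s u hu.1 hu.2
    have c1 := (hC s u hs0 hu.1).1
    have c2 := nu2_mono m a c1 (hC.le_two hs0 hu.1)
    have c3 := nu2_nonneg m a c1
    have e : Real.exp (-(1 / 6) * |u - t|) * Real.exp (-(1 / 6) * (s - u)) ≤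
        Real.exp (-(1 / 6) * (s - t)) := by
      rw [← Real.exp_add]
      exact Real.exp_le_exp.2 (by have := le_abs_self (u - t); linarith)
    have hw := (wt_pos hr (sub_nonneg.2 hu.2)).le
    calc P.2 u t * P.1 s u * nu2 m a (P.2 s u)
        ≤ (2 * Real.exp (-(1 / 6) * |u - t|)) *
          (wt r (s - u) * Real.exp (-(1 / 6) * (s - u))) * nu2 m a 2 :=
          mul_le_mul (mul_le_mul a2 b2 b1 (a1.trans a2)) c2 c3
            (mul_nonneg (a1.trans a2) (b1.trans b2))
      _ = (Real.exp (-(1 / 6) * |u - t|) * Real.exp (-(1 / 6) * (s - u))) *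
          (2 * wt r (s - u) * nu2 m a 2) := by ring
      _ ≤ Real.exp (-(1 / 6) * (s - t)) * (2 * wt r (s - u) * nu2 m a 2) :=
          mul_le_mul_of_nonneg_right e (by positivity)
      _ = _ := by ring
  rw [intervalIntegral.integral_const_mul] at key
  have h2 := integral_wt_sub_left_le hr hs0
  set E := Real.exp (-(1 / 6) * (s - t))
  have hE : 0 ≤ E := (Real.exp_pos _).le
  set B := ∫ u in (0 : ℝ)..s, wt r (s - u)
  calc β ^ 2 * I1 m a P s t ≤ β ^ 2 * ((2 * E * nu2 m a 2) * B) :=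
        mul_le_mul_of_nonneg_left key (sq_nonneg β)
    _ = (β ^ 2 * nu2 m a 2) * (2 * E) * B := by ring
    _ = (2 * r * E) * (r * B) := by rw [hβ]; ring
    _ ≤ (2 * r * E) * 2 := mul_le_mul_of_nonneg_left h2 (by positivity)
    _ = _ := by ring

theorem I2_le (hr : 0 < r) (hβ : β ^ 2 * nu2 m a 2 = r ^ 2) (h : IsCont P) (hR : RBound r P.1)
    (hC : CBound P.2) {s t : ℝ} (ht : 0 ≤ t) (hs : t ≤ s) :
    β ^ 2 * I2 m a P s t ≤ 4 * r * Real.exp (-(1 / 6) * (s - t)) := by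
  have hK := nu2_nonneg m a (x := 2) (by norm_num)
  have hs0 := ht.trans hs
  have key : I2 m a P s t ≤ ∫ u in (0 : ℝ)..t,
      (2 * Real.exp (-(1 / 6) * (s - t)) * nu2 m a 2) * wt r (t - u) := by
    refine intervalIntegral.integral_mono_on ht (intervalIntegrable_I2 h s t _ _)
      ((intervalIntegrable_wt_sub_left hr ht).const_mul _) fun u hu => ?_
    obtain ⟨a1, a2⟩ := hC s u hs0 hu.1
    obtain ⟨b1, b2⟩ := hR t u hu.1 hu.2
    have c2 := nu1_le_mul_two m a a1 (hC.le_two hs0 hu.1)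
    rw [abs_of_nonneg (by linarith [hu.2])] at a2
    have hw := (wt_pos hr (sub_nonneg.2 hu.2)).le
    have e : Real.exp (-(1 / 6) * (s - u)) * Real.exp (-(1 / 6) * (t - u)) ≤
        Real.exp (-(1 / 6) * (s - t)) := by
      rw [← Real.exp_add]
      exact Real.exp_le_exp.2 (by linarith [hu.2])
    calc nu1 m a (P.2 s u) * P.1 t u
        ≤ (nu2 m a 2 * (2 * Real.exp (-(1 / 6) * (s - u)))) *
          (wt r (t - u) * Real.exp (-(1 / 6) * (t - u))) :=
          mul_le_mul (c2.trans (mul_le_mul_of_nonneg_left a2 hK)) b2 b1 (by positivity)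
      _ = (Real.exp (-(1 / 6) * (s - u)) * Real.exp (-(1 / 6) * (t - u))) *
          (2 * wt r (t - u) * nu2 m a 2) := by ring
      _ ≤ Real.exp (-(1 / 6) * (s - t)) * (2 * wt r (t - u) * nu2 m a 2) :=
          mul_le_mul_of_nonneg_right e (by positivity)
      _ = _ := by ring
  rw [intervalIntegral.integral_const_mul] at key
  have h2 := integral_wt_sub_left_le hr ht
  set E := Real.exp (-(1 / 6) * (s - t))
  have hE : 0 ≤ E := (Real.exp_pos _).le
  set B := ∫ u in (0 : ℝ)..t, wt r (t - u)
  calc β ^ 2 * I2 m a P s t ≤ β ^ 2 * ((2 * E * nu2 m a 2) * B) :=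
        mul_le_mul_of_nonneg_left key (sq_nonneg β)
    _ = (β ^ 2 * nu2 m a 2) * (2 * E) * B := by ring
    _ = (2 * r * E) * (r * B) := by rw [hβ]; ring
    _ ≤ (2 * r * E) * 2 := mul_le_mul_of_nonneg_left h2 (by positivity)
    _ = _ := by ring

theorem isCont_clamp_of_mem (hP : P ∈ ASet (1 / 6) r 1 2) : IsCont (clamp P) :=
  (mem_ASet_iff.1 hP).1.isCont_clamp

/-- The step map preserves `ASet`. -/
theorem IsStep.mem_ASet (hr : 0 < r) (hr' : r ≤ 1 / 300) (hβ : β ^ 2 * nu2 m a 2 = r ^ 2)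
    (hP : P ∈ ASet (1 / 6) r 1 2) (hfc : ContinuousOn (fun p : ℝ × ℝ => f p.1 p.2) Gam)
    (hf : RBound r f) (hQ : IsStep m a β P f Q) : Q ∈ ASet (1 / 6) r 1 2 := by
  have hQ' := hQ.congr (agree_clamp P) (agreeR_clampR f) (Q' := Q)
    ⟨fun _ _ _ _ => rfl, fun _ _ _ _ => rfl⟩
  have hc := isCont_clamp_of_mem hP
  obtain ⟨-, hR, hC⟩ := mem_ASet_iff.1 (mem_ASet_congr hP (agree_clamp P))
  have hfc' := continuous_clampR hfc
  have hf' := hf.congr (agreeR_clampR f)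
  have hμ : ∀ t, 0 ≤ t → ∀ s, t ≤ s → 1 / 2 ≤ muRC m a β (clamp P) s :=
    fun t ht s hs => half_le_muRC hR hC (ht.trans hs)
  have hexp : ∀ t s : ℝ, HasDerivAt (fun s => Real.exp (-(1 / 6) * (s - t)))
      (-(1 / 6) * Real.exp (-(1 / 6) * (s - t))) s := by
    intro t s
    have := (((hasDerivAt_id s).sub_const t).const_mul (-(1 / 6 : ℝ))).exp
    refine this.congr_deriv ?_
    simp; ring
  have hRQ : RBound r Q.1 := by
    intro s t ht hs
    refine ⟨nonneg_of_linear_ode (fun s hs => hQ'.eq_R s t ht hs) (hμ t ht)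
      (by rw [hQ.admissible.diag_R t ht]; norm_num)
      (fun s hs => mul_nonneg (sq_nonneg β) (memR_nonneg hC hf' ht hs)) s hs, ?_⟩
    refine le_of_linear_ode (fun s hs => hQ'.eq_R s t ht hs) (hμ t ht)
      (B := fun s => wt r (s - t) * Real.exp (-(1 / 6) * (s - t)))
      (fun s hs => (((hasDerivAt_wt hr (sub_nonneg.2 hs)).comp_sub_const s t).mul
        (hexp t s)).hasDerivWithinAt)
      (fun s hs => mul_nonneg (wt_pos hr (sub_nonneg.2 hs)).le (Real.exp_pos _).le)
      (by simp [wt_zero, hQ.admissible.diag_R t ht]) (fun s hs => ?_) s hs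
    -- The barrier `W E` has derivative at least `-(3r/2 + 1/6) W E`, so the requirement is `12 r +
    -- 3r/2 ≤ 1/2 - 1/6`.
    refine (memR_le hr hβ hc hC hfc' hf' ht hs).trans ?_
    have h1 := wt_deriv_ge hr (sub_nonneg.2 hs)
    have h2 := wt_pos hr (sub_nonneg.2 hs)
    have h3 := Real.exp_pos (-(1 / 6) * (s - t))
    set W' := r * (-(3 / 2)) * (r * (s - t) + 1) ^ (-(3 / 2) - 1 : ℝ)
    set W := wt r (s - t)
    set E := Real.exp (-(1 / 6) * (s - t))
    have h4 : -(3 / 2 * r * W) * E ≤ W' * E := mul_le_mul_of_nonneg_right h1 h3.le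
    have h5 : 0 < W * E := mul_pos h2 h3
    nlinarith
  have hCQ : ∀ s t, 0 ≤ t → t ≤ s → 0 ≤ Q.2 s t ∧ Q.2 s t ≤ 2 * Real.exp (-(1 / 6) * (s - t)) := by
    intro s t ht hs
    refine ⟨nonneg_of_linear_ode (fun s hs => hQ'.eq_C s t ht hs) (hμ t ht)
      (by rw [hQ.admissible.diag_C t ht]; norm_num)
      (fun s hs => mul_nonneg (sq_nonneg β)
        (add_nonneg (I1_nonneg hR hC ht hs) (I2_nonneg hR hC ht hs))) s hs, ?_⟩
    refine le_of_linear_ode (fun s hs => hQ'.eq_C s t ht hs) (hμ t ht)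
      (B := fun s => 2 * Real.exp (-(1 / 6) * (s - t)))
      (fun s hs => ((hexp t s).const_mul 2).hasDerivWithinAt)
      (fun s hs => by positivity)
      (by simp [hQ.admissible.diag_C t ht]) (fun s hs => ?_) s hs
    -- The two memory terms total `8 r E`, against `2 (1/2 - 1/6) E` left by the damping.
    have h1 := I1_le hr hβ hc hR hC ht hs
    have h2 := I2_le hr hβ hc hR hC ht hs
    have h3 := Real.exp_pos (-(1 / 6) * (s - t))
    nlinarith
  refine mem_ASet_iff.2 ⟨hQ.admissible, hRQ, fun s t hs ht => ?_⟩
  rcases le_total t s with h | h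
  · rw [abs_of_nonneg (sub_nonneg.2 h)]
    exact hCQ s t ht h
  · rw [hQ.admissible.symm_C s t hs ht, abs_sub_comm, abs_of_nonneg (sub_nonneg.2 h)]
    exact hCQ t s hs h

end Bounds

end SphericalSpinGlass

namespace SphericalSpinGlass

variable {m : ℕ} {a : ℕ → ℝ} {β r : ℝ} {P P' Q Q' P₁ P₂ Q₁ Q₂ : TwoTime} {f f' f₁ f₂ : ℝ → ℝ → ℝ}

/-! ### Uniform Lipschitz estimates. -/

section Contraction

/-- `f` and `g` are uniformly `ε`-close on `Γ`. -/
def NearR (f g : ℝ → ℝ → ℝ) (ε : ℝ) : Prop := ∀ s t, 0 ≤ t → t ≤ s → |f s t - g s t| ≤ ε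

/-- Two pairs are uniformly `ε`-close in each component. -/
def Near (P Q : TwoTime) (ε : ℝ) : Prop :=
  NearR P.1 Q.1 ε ∧ ∀ s t, 0 ≤ s → 0 ≤ t → |P.2 s t - Q.2 s t| ≤ ε

theorem Near.congr {ε : ℝ} (h : Near P Q ε) (hP : Agree P P') (hQ : Agree Q Q') :
    Near P' Q' ε :=
  ⟨fun s t ht hs => by rw [← hP.1 s t ht hs, ← hQ.1 s t ht hs]; exact h.1 s t ht hs,
    fun s t hs ht => by rw [← hP.2 s t hs ht, ← hQ.2 s t hs ht]; exact h.2 s t hs ht⟩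

theorem NearR.congr {ε : ℝ} (h : NearR f₁ f₂ ε) (h₁ : AgreeR f₁ f) (h₂ : AgreeR f₂ f') :
    NearR f f' ε :=
  fun s t ht hs => by rw [← h₁ s t ht hs, ← h₂ s t ht hs]; exact h s t ht hs

/-- In a difference of products, the factor being compared is only uniformly small and loses its
decay. The surviving decay may be centred at either end of the memory interval, hence two centres.
The factor 12 is the integral of `e^{-|u|/6}` over the line. -/
theorem abs_integral_sub_le_of_exp {F G : ℝ → ℝ} {x y c d A B : ℝ} (hxy : x ≤ y)
    (hF : IntervalIntegrable F MeasureTheory.volume x y)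
    (hG : IntervalIntegrable G MeasureTheory.volume x y) (hA : 0 ≤ A) (hB : 0 ≤ B)
    (h : ∀ u, x ≤ u → u ≤ y → |F u - G u| ≤
      A * Real.exp (-(1 / 6) * |u - c|) + B * Real.exp (-(1 / 6) * |u - d|)) :
    |(∫ u in x..y, F u) - ∫ u in x..y, G u| ≤ 12 * (A + B) := by
  have hi : ∀ A c : ℝ, IntervalIntegrable (fun u => A * Real.exp (-(1 / 6) * |u - c|))
      MeasureTheory.volume x y := fun A c => Continuous.intervalIntegrable (by fun_prop) _ _
  rw [← intervalIntegral.integral_sub hF hG, ← Real.norm_eq_abs]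
  refine (intervalIntegral.norm_integral_le_of_norm_le hxy
    (Eventually.of_forall fun u hu => h u hu.1.le hu.2) ((hi A c).add (hi B d))).trans ?_
  rw [intervalIntegral.integral_add (hi A c) (hi B d), intervalIntegral.integral_const_mul,
    intervalIntegral.integral_const_mul]
  have h1 := mul_le_mul_of_nonneg_left (integral_exp_abs_le c hxy) hA
  have h2 := mul_le_mul_of_nonneg_left (integral_exp_abs_le d hxy) hB
  linarith

theorem abs_mul_sub_mul_le (x y x' y' : ℝ) :
    |x * y - x' * y'| ≤ |x - x'| * |y| + |x'| * |y - y'| := by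
  rw [← abs_mul, ← abs_mul]
  refine le_trans (le_of_eq ?_) (abs_add_le _ _)
  congr 1; ring

theorem abs_mul_mul_sub_le (x y z x' y' z' : ℝ) : |x * y * z - x' * y' * z'| ≤
    |x - x'| * |y| * |z| + |x'| * |y - y'| * |z| + |x'| * |y'| * |z - z'| := by
  simp only [← abs_mul]
  refine le_trans (le_of_eq ?_) (abs_add_three _ _ _)
  congr 1; ring

/-- `L` bounds `ν''`, and is a Lipschitz constant of `ν'`, `ν''` and `ψ`, on `[0, 2]`. -/
structure LipBound (m : ℕ) (a : ℕ → ℝ) (L : ℝ) : Prop where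
  one_le : 1 ≤ L
  nu2_le : nu2 m a 2 ≤ L
  lip : ∀ x y, 0 ≤ x → x ≤ 2 → 0 ≤ y → y ≤ 2 →
    |nu1 m a x - nu1 m a y| ≤ L * |x - y| ∧ |nu2 m a x - nu2 m a y| ≤ L * |x - y| ∧
      |psi m a x - psi m a y| ≤ L * |x - y|

theorem exists_lipBound (m : ℕ) (a : ℕ → ℝ) : ∃ L, LipBound m a L := by
  obtain ⟨L, h1, h⟩ := exists_common_lipschitz m a 2
  refine ⟨L, h1, (le_abs_self _).trans (h 2 2 (by norm_num) (by norm_num)).2.1.2,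
    fun x y hx hx2 hy hy2 => ?_⟩
  have := h x y (by rwa [abs_of_nonneg hx]) (by rwa [abs_of_nonneg hy])
  exact ⟨this.1.1, this.2.1.1, this.2.2.1⟩

variable {L ε η : ℝ}

theorem exp_neg_abs_le_one (x : ℝ) : Real.exp (-(1 / 6) * |x|) ≤ 1 :=
  Real.exp_le_one_iff.2 (by have := abs_nonneg x; linarith)

theorem abs_le_exp_of_rBound (hr : 0 < r) (h : RBound r f) {s t : ℝ} (ht : 0 ≤ t) (hs : t ≤ s) :
    |f s t| ≤ Real.exp (-(1 / 6) * |s - t|) := by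
  rw [abs_of_nonneg (h s t ht hs).1, abs_of_nonneg (sub_nonneg.2 hs)]
  exact h.le_exp hr ht hs

theorem abs_muRC_sub_le (hL : LipBound m a L) (hr : 0 < r) (h₁ : IsCont P₁) (h₂ : IsCont P₂)
    (hR₁ : RBound r P₁.1) (hC₁ : CBound P₁.2) (hC₂ : CBound P₂.2)
    (hP : Near P₁ P₂ ε) {s : ℝ} (hs : 0 ≤ s) :
    |muRC m a β P₁ s - muRC m a β P₂ s| ≤ 60 * (β ^ 2 * L * ε) := by
  have hε : 0 ≤ ε := (abs_nonneg _).trans (hP.1 0 0 le_rfl le_rfl)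
  have hL0 := hL.one_le
  have hL2 := hL.nu2_le
  have hK := nu2_nonneg m a (x := 2) (by norm_num)
  have key := abs_integral_sub_le_of_exp (A := L * ε) (B := 4 * L * ε) (c := s) (d := s) hs
    (intervalIntegrable_muRC (m := m) (a := a) h₁ s 0 s)
    (intervalIntegrable_muRC (m := m) (a := a) h₂ s 0 s)
    (by positivity) (by positivity) fun u hu0 hus => by
      obtain ⟨c1, -⟩ := hC₁ s u hs hu0
      obtain ⟨c2, c2'⟩ := hC₂ s u hs hu0
      have d2 := hC₂.le_two hs hu0
      have l := (hL.lip _ _ c1 (hC₁.le_two hs hu0) c2 d2).2.2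
      have l' := mul_le_mul_of_nonneg_left (hP.2 s u hs hu0) (by positivity : 0 ≤ L)
      have b := abs_le_exp_of_rBound hr hR₁ hu0 hus
      have p := psi_le_mul_two m a c2 d2
      have p0 := psi_nonneg m a c2
      rw [abs_sub_comm u s]
      set E := Real.exp (-(1 / 6) * |s - u|)
      have hE : 0 < E := Real.exp_pos _
      refine (abs_mul_sub_mul_le _ _ _ _).trans (add_le_add ?_ ?_)
      · exact mul_le_mul (l.trans l') b (abs_nonneg _) (by positivity)
      · have p' : |psi m a (P₂.2 s u)| ≤ 4 * L * E := by
          rw [abs_of_nonneg p0]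
          refine p.trans ?_
          have := mul_le_mul hL2 c2' c2 (by positivity)
          linarith
        calc |psi m a (P₂.2 s u)| * |P₁.1 s u - P₂.1 s u| ≤ (4 * L * E) * ε :=
              mul_le_mul p' (hP.1 s u hu0 hus) (abs_nonneg _) (by positivity)
          _ = _ := by ring
  unfold muRC
  rw [show ∀ x y : ℝ, 1 / 2 + β ^ 2 * x - (1 / 2 + β ^ 2 * y) = β ^ 2 * (x - y) by
    intro x y; ring, abs_mul, abs_of_nonneg (sq_nonneg β)]
  refine (mul_le_mul_of_nonneg_left key (sq_nonneg β)).trans (le_of_eq ?_)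
  ring

/-- The coefficient of `η` is kept as `ν''(2)` rather than `L`: after multiplication by `β²` it
becomes `24 r²`, small under the universal condition on `r`. By contrast `β² L` is small only for
`β` depending on `ν`. -/
theorem abs_memR_sub_le (hL : LipBound m a L) (hr : 0 < r) (h₁ : IsCont P₁) (h₂ : IsCont P₂)
    (hC₁ : CBound P₁.2) (hC₂ : CBound P₂.2) (hP : Near P₁ P₂ ε)
    (hf₁ : Continuous fun p : ℝ × ℝ => f₁ p.1 p.2) (hf₂ : Continuous fun p : ℝ × ℝ => f₂ p.1 p.2)
    (hb₁ : RBound r f₁) (hb₂ : RBound r f₂) (hf : NearR f₁ f₂ η)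
    {s t : ℝ} (ht : 0 ≤ t) (hs : t ≤ s) :
    |memR m a P₁ f₁ s t - memR m a P₂ f₂ s t| ≤ 24 * (nu2 m a 2 * η) + 12 * (L * ε) := by
  have hε : 0 ≤ ε := (abs_nonneg _).trans (hP.1 0 0 le_rfl le_rfl)
  have hη : 0 ≤ η := (abs_nonneg _).trans (hf 0 0 le_rfl le_rfl)
  have hL0 := hL.one_le
  have hK := nu2_nonneg m a (x := 2) (by norm_num)
  have hs0 := ht.trans hs
  have key := abs_integral_sub_le_of_exp (A := nu2 m a 2 * η + L * ε) (B := nu2 m a 2 * η)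
    (c := s) (d := t) hs
    (intervalIntegrable_memR (m := m) (a := a) h₁ hf₁ s t t s)
    (intervalIntegrable_memR (m := m) (a := a) h₂ hf₂ s t t s)
    (by positivity) (by positivity) fun u htu hus => by
      have hu0 := ht.trans htu
      obtain ⟨c1, -⟩ := hC₁ s u hs0 hu0
      obtain ⟨c2, -⟩ := hC₂ s u hs0 hu0
      have d1 := hC₁.le_two hs0 hu0
      have l := (hL.lip _ _ c1 d1 c2 (hC₂.le_two hs0 hu0)).2.1
      have l' := mul_le_mul_of_nonneg_left (hP.2 s u hs0 hu0) (by positivity : 0 ≤ L)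
      have n := nu2_mono m a c1 d1
      rw [← abs_of_nonneg (nu2_nonneg m a c1)] at n
      have b1 := abs_le_exp_of_rBound hr hb₁ hu0 hus
      have b2 := abs_le_exp_of_rBound hr hb₂ hu0 hus
      have b3 := abs_le_exp_of_rBound hr hb₂ ht htu
      have b4 := b3.trans (exp_neg_abs_le_one _)
      have e1 := hf u t ht htu
      have e2 := hf s u hu0 hus
      rw [abs_sub_comm u s]
      set E := Real.exp (-(1 / 6) * |s - u|)
      set F := Real.exp (-(1 / 6) * |u - t|)
      have hE : 0 < E := Real.exp_pos _
      have hF : 0 < F := Real.exp_pos _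
      have t1 : |f₁ u t - f₂ u t| * |f₁ s u| * |nu2 m a (P₁.2 s u)| ≤ η * E * nu2 m a 2 :=
        mul_le_mul (mul_le_mul e1 b1 (abs_nonneg _) hη) n (abs_nonneg _) (by positivity)
      have t2 : |f₂ u t| * |f₁ s u - f₂ s u| * |nu2 m a (P₁.2 s u)| ≤ F * η * nu2 m a 2 :=
        mul_le_mul (mul_le_mul b3 e2 (abs_nonneg _) hF.le) n (abs_nonneg _) (by positivity)
      have t3 : |f₂ u t| * |f₂ s u| * |nu2 m a (P₁.2 s u) - nu2 m a (P₂.2 s u)|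
          ≤ 1 * E * (L * ε) :=
        mul_le_mul (mul_le_mul b4 b2 (abs_nonneg _) zero_le_one) (l.trans l') (abs_nonneg _)
          (by positivity)
      refine (abs_mul_mul_sub_le _ _ _ _ _ _).trans ?_
      linarith
  refine key.trans (le_of_eq ?_)
  ring

theorem abs_I1_sub_le (hL : LipBound m a L) (hr : 0 < r) (h₁ : IsCont P₁) (h₂ : IsCont P₂)
    (hR₁ : RBound r P₁.1) (hR₂ : RBound r P₂.1) (hC₁ : CBound P₁.2) (hC₂ : CBound P₂.2)
    (hP : Near P₁ P₂ ε) {s t : ℝ} (ht : 0 ≤ t) (hs : t ≤ s) :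
    |I1 m a P₁ s t - I1 m a P₂ s t| ≤ 60 * (L * ε) := by
  have hε : 0 ≤ ε := (abs_nonneg _).trans (hP.1 0 0 le_rfl le_rfl)
  have hL0 := hL.one_le
  have hs0 := ht.trans hs
  have key := abs_integral_sub_le_of_exp (A := 3 * (L * ε)) (B := 2 * (L * ε))
    (c := s) (d := t) hs0
    (intervalIntegrable_I1 (m := m) (a := a) h₁ s t 0 s)
    (intervalIntegrable_I1 (m := m) (a := a) h₂ s t 0 s)
    (by positivity) (by positivity) fun u hu0 hus => by
      obtain ⟨c1, -⟩ := hC₁ s u hs0 hu0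
      obtain ⟨c2, -⟩ := hC₂ s u hs0 hu0
      obtain ⟨c3, c3'⟩ := hC₂ u t hu0 ht
      have d1 := hC₁.le_two hs0 hu0
      have l := (hL.lip _ _ c1 d1 c2 (hC₂.le_two hs0 hu0)).2.1
      have l' := mul_le_mul_of_nonneg_left (hP.2 s u hs0 hu0) (by positivity : 0 ≤ L)
      have n := (nu2_mono m a c1 d1).trans hL.nu2_le
      rw [← abs_of_nonneg (nu2_nonneg m a c1)] at n
      have b1 := abs_le_exp_of_rBound hr hR₁ hu0 hus
      have b2 := abs_le_exp_of_rBound hr hR₂ hu0 hus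
      rw [← abs_of_nonneg c3] at c3'
      have b4 : |P₂.2 u t| ≤ 2 := by
        rw [abs_of_nonneg c3]; exact hC₂.le_two hu0 ht
      have e1 := hP.2 u t hu0 ht
      have e2 := hP.1 s u hu0 hus
      rw [abs_sub_comm u s]
      set E := Real.exp (-(1 / 6) * |s - u|)
      set F := Real.exp (-(1 / 6) * |u - t|)
      have hE : 0 < E := Real.exp_pos _
      have hF : 0 < F := Real.exp_pos _
      have t1 : |P₁.2 u t - P₂.2 u t| * |P₁.1 s u| * |nu2 m a (P₁.2 s u)| ≤ ε * E * L :=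
        mul_le_mul (mul_le_mul e1 b1 (abs_nonneg _) hε) n (abs_nonneg _) (by positivity)
      have t2 : |P₂.2 u t| * |P₁.1 s u - P₂.1 s u| * |nu2 m a (P₁.2 s u)| ≤ 2 * F * ε * L :=
        mul_le_mul (mul_le_mul c3' e2 (abs_nonneg _) (by positivity)) n (abs_nonneg _)
          (by positivity)
      have t3 : |P₂.2 u t| * |P₂.1 s u| * |nu2 m a (P₁.2 s u) - nu2 m a (P₂.2 s u)|
          ≤ 2 * E * (L * ε) :=
        mul_le_mul (mul_le_mul b4 b2 (abs_nonneg _) zero_le_two) (l.trans l') (abs_nonneg _)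
          (by positivity)
      refine (abs_mul_mul_sub_le _ _ _ _ _ _).trans ?_
      linarith
  refine key.trans (le_of_eq ?_)
  ring

theorem abs_I2_sub_le (hL : LipBound m a L) (hr : 0 < r) (h₁ : IsCont P₁) (h₂ : IsCont P₂)
    (hR₁ : RBound r P₁.1) (hC₁ : CBound P₁.2) (hC₂ : CBound P₂.2)
    (hP : Near P₁ P₂ ε) {s t : ℝ} (ht : 0 ≤ t) (hs : t ≤ s) :
    |I2 m a P₁ s t - I2 m a P₂ s t| ≤ 36 * (L * ε) := by
  have hε : 0 ≤ ε := (abs_nonneg _).trans (hP.1 0 0 le_rfl le_rfl)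
  have hL0 := hL.one_le
  have hL2 := hL.nu2_le
  have hK := nu2_nonneg m a (x := 2) (by norm_num)
  have hs0 := ht.trans hs
  have key := abs_integral_sub_le_of_exp (A := L * ε) (B := 2 * (L * ε)) (c := t) (d := s) ht
    (intervalIntegrable_I2 (m := m) (a := a) h₁ s t 0 t)
    (intervalIntegrable_I2 (m := m) (a := a) h₂ s t 0 t)
    (by positivity) (by positivity) fun u hu0 hut => by
      obtain ⟨c1, -⟩ := hC₁ s u hs0 hu0
      obtain ⟨c2, c2'⟩ := hC₂ s u hs0 hu0
      have d2 := hC₂.le_two hs0 hu0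
      have l := (hL.lip _ _ c1 (hC₁.le_two hs0 hu0) c2 d2).1
      have l' := mul_le_mul_of_nonneg_left (hP.2 s u hs0 hu0) (by positivity : 0 ≤ L)
      have b := abs_le_exp_of_rBound hr hR₁ hu0 hut
      have p := nu1_le_mul_two m a c2 d2
      rw [abs_sub_comm u s, abs_sub_comm u t]
      set E := Real.exp (-(1 / 6) * |s - u|)
      set F := Real.exp (-(1 / 6) * |t - u|)
      have hE : 0 < E := Real.exp_pos _
      have hF : 0 < F := Real.exp_pos _
      refine (abs_mul_sub_mul_le _ _ _ _).trans (add_le_add ?_ ?_)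
      · exact mul_le_mul (l.trans l') b (abs_nonneg _) (by positivity)
      · have p' : |nu1 m a (P₂.2 s u)| ≤ 2 * L * E := by
          rw [abs_of_nonneg (nu1_nonneg m a c2)]
          refine p.trans ?_
          have := mul_le_mul hL2 c2' c2 (by positivity)
          linarith
        calc |nu1 m a (P₂.2 s u)| * |P₁.1 t u - P₂.1 t u| ≤ (2 * L * E) * ε :=
              mul_le_mul p' (hP.1 t u hu0 hut) (abs_nonneg _) (by positivity)
          _ = _ := by ring
  refine key.trans (le_of_eq ?_)
  ring

theorem agree_refl (P : TwoTime) : Agree P P := ⟨fun _ _ _ _ => rfl, fun _ _ _ _ => rfl⟩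

/-- Lipschitz dependence of the solution of `IsStep` on the data. -/
theorem IsStep.near (hL : LipBound m a L) (hr : 0 < r) (hr' : r ≤ 1 / 300)
    (hβ : β ^ 2 * nu2 m a 2 = r ^ 2)
    (hP₁ : P₁ ∈ ASet (1 / 6) r 1 2) (hP₂ : P₂ ∈ ASet (1 / 6) r 1 2)
    (hf₁ : ContinuousOn (fun p : ℝ × ℝ => f₁ p.1 p.2) Gam) (hb₁ : RBound r f₁)
    (hf₂ : ContinuousOn (fun p : ℝ × ℝ => f₂ p.1 p.2) Gam) (hb₂ : RBound r f₂)
    (hQ₁ : IsStep m a β P₁ f₁ Q₁) (hQ₂ : IsStep m a β P₂ f₂ Q₂)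
    (hP : Near P₁ P₂ ε) (hf : NearR f₁ f₂ η) :
    Near Q₁ Q₂ (η / 4 + 432 * (β ^ 2 * L * ε)) := by
  -- Bounds on `Q₂` are needed because subtracting the equations produces the term `(μ₁ - μ₂) Q₂`.
  have hQ₂A := hQ₂.mem_ASet hr hr' hβ hP₂ hf₂ hb₂
  have hε : 0 ≤ ε := (abs_nonneg _).trans (hP.1 0 0 le_rfl le_rfl)
  have hη : 0 ≤ η := (abs_nonneg _).trans (hf 0 0 le_rfl le_rfl)
  have hL0 := hL.one_le
  replace hQ₁ := hQ₁.congr (agree_clamp P₁) (agreeR_clampR f₁) (agree_refl _)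
  replace hQ₂ := hQ₂.congr (agree_clamp P₂) (agreeR_clampR f₂) (agree_refl _)
  have hc₁ := isCont_clamp_of_mem hP₁
  have hc₂ := isCont_clamp_of_mem hP₂
  replace hP := hP.congr (agree_clamp P₁) (agree_clamp P₂)
  obtain ⟨-, hR₁, hC₁⟩ := mem_ASet_iff.1 (mem_ASet_congr hP₁ (agree_clamp P₁))
  obtain ⟨-, hR₂, hC₂⟩ := mem_ASet_iff.1 (mem_ASet_congr hP₂ (agree_clamp P₂))
  replace hf := hf.congr (agreeR_clampR f₁) (agreeR_clampR f₂)
  replace hf₁ := continuous_clampR hf₁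
  replace hf₂ := continuous_clampR hf₂
  replace hb₁ := hb₁.congr (agreeR_clampR f₁)
  replace hb₂ := hb₂.congr (agreeR_clampR f₂)
  obtain ⟨-, hRQ, hCQ⟩ := mem_ASet_iff.1 hQ₂A
  have hμ : ∀ t, 0 ≤ t → ∀ s, t ≤ s → 1 / 2 ≤ muRC m a β (clamp P₁) s :=
    fun t ht s hs => half_le_muRC hR₁ hC₁ (ht.trans hs)
  set X := β ^ 2 * L * ε with hX
  have hX0 : 0 ≤ X := by positivity
  -- This gives `24 r² ≤ 1/8`, half of the target constant `1/4`, as `abs_le_of_linear_ode`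
  -- requires.
  have hr2 : r ^ 2 ≤ 1 / 192 := by nlinarith
  have hdμ : ∀ s t, 0 ≤ t → t ≤ s →
      |muRC m a β (clamp P₁) s - muRC m a β (clamp P₂) s| ≤ 60 * X := fun s t ht hs =>
    abs_muRC_sub_le hL hr hc₁ hc₂ hR₁ hC₁ hC₂ hP (ht.trans hs)
  have hRR : ∀ s t, 0 ≤ t → t ≤ s → |Q₁.1 s t - Q₂.1 s t| ≤ η / 4 + 432 * X := by
    intro s t ht hs
    refine abs_le_of_linear_ode (μ := muRC m a β (clamp P₁)) (h := fun s => Q₁.1 s t - Q₂.1 s t)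
      (g := fun s => β ^ 2 * (memR m a (clamp P₁) (clampR f₁) s t
        - memR m a (clamp P₂) (clampR f₂) s t)
        - (muRC m a β (clamp P₁) s - muRC m a β (clamp P₂) s) * Q₂.1 s t)
      (fun s hs => ((hQ₁.eq_R s t ht hs).sub (hQ₂.eq_R s t ht hs)).congr_deriv (by ring))
      (hμ t ht) (by rw [hQ₁.admissible.diag_R t ht, hQ₂.admissible.diag_R t ht, sub_self])
      (fun s hs => ?_) s hs
    have h1 := abs_memR_sub_le hL hr hc₁ hc₂ hC₁ hC₂ hP hf₁ hf₂ hb₁ hb₂ hf ht hs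
    have h2 := hdμ s t ht hs
    have h3 : |Q₂.1 s t| ≤ 1 := by
      rw [abs_of_nonneg (hRQ s t ht hs).1]; exact hRQ.le_one hr ht hs
    refine (abs_sub _ _).trans ?_
    rw [abs_mul, abs_mul, abs_of_nonneg (sq_nonneg β)]
    have h4 := mul_le_mul_of_nonneg_left h1 (sq_nonneg β)
    have h5 := mul_le_mul h2 h3 (abs_nonneg _) (by positivity)
    have h6 : β ^ 2 * (24 * (nu2 m a 2 * η) + 12 * (L * ε)) = 24 * r ^ 2 * η + 12 * X := by
      rw [← hβ, hX]; ring
    have h7 := mul_le_mul_of_nonneg_right hr2 hη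
    linarith
  have hCC : ∀ s t, 0 ≤ t → t ≤ s → |Q₁.2 s t - Q₂.2 s t| ≤ η / 4 + 432 * X := by
    intro s t ht hs
    refine abs_le_of_linear_ode (μ := muRC m a β (clamp P₁)) (h := fun s => Q₁.2 s t - Q₂.2 s t)
      (g := fun s => β ^ 2 * ((I1 m a (clamp P₁) s t - I1 m a (clamp P₂) s t) +
        (I2 m a (clamp P₁) s t - I2 m a (clamp P₂) s t))
        - (muRC m a β (clamp P₁) s - muRC m a β (clamp P₂) s) * Q₂.2 s t)
      (fun s hs => ((hQ₁.eq_C s t ht hs).sub (hQ₂.eq_C s t ht hs)).congr_deriv (by ring))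
      (hμ t ht) (by rw [hQ₁.admissible.diag_C t ht, hQ₂.admissible.diag_C t ht, sub_self])
      (fun s hs => ?_) s hs
    have h1 := abs_I1_sub_le hL hr hc₁ hc₂ hR₁ hR₂ hC₁ hC₂ hP ht hs
    have h1' := abs_I2_sub_le hL hr hc₁ hc₂ hR₁ hC₁ hC₂ hP ht hs
    have h2 := hdμ s t ht hs
    have h3 : |Q₂.2 s t| ≤ 2 := by
      rw [abs_of_nonneg (hCQ s t (ht.trans hs) ht).1]; exact hCQ.le_two (ht.trans hs) ht
    refine (abs_sub _ _).trans ?_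
    rw [abs_mul, abs_mul, abs_of_nonneg (sq_nonneg β)]
    have h4 := mul_le_mul_of_nonneg_left ((abs_add_le _ _).trans (add_le_add h1 h1'))
      (sq_nonneg β)
    have h5 := mul_le_mul h2 h3 (abs_nonneg _) (by positivity)
    -- The correlation fixes the constant: `96 + 2 * 60 = 216`, half of 432. The response needs only
    -- `12 + 60`.
    have h6 : β ^ 2 * (60 * (L * ε) + 36 * (L * ε)) = 96 * X := by
      rw [hX]; ring
    linarith
  refine ⟨hRR, fun s t hs ht => ?_⟩
  rcases le_total t s with h | h
  · exact hCC s t ht h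
  · rw [hQ₁.admissible.symm_C s t hs ht, hQ₂.admissible.symm_C s t hs ht]
    exact hCC t s hs h

end Contraction

end SphericalSpinGlass

namespace SphericalSpinGlass

variable {m : ℕ} {a : ℕ → ℝ} {β r : ℝ} {P P' Q Q' P₁ P₂ Q₁ Q₂ : TwoTime} {f f' f₁ f₂ : ℝ → ℝ → ℝ}

/-! ### Uniqueness among all admissible pairs. -/

section Uniqueness

theorem IsPsi.congr (h : IsPsi m a β P Q) (hP : Agree P P') (hQ : Agree Q Q') :
    IsPsi m a β P' Q' :=
  isPsi_iff_isStep.2 ((isPsi_iff_isStep.1 h).congr hP hQ.1 hQ)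

/-- The two pairs differ by at most `N e^{l s}` at times `0 ≤ t ≤ s ≤ T`. -/
def NearExp (T l N : ℝ) (P Q : TwoTime) : Prop :=
  ∀ s t, 0 ≤ t → t ≤ s → s ≤ T →
    |P.1 s t - Q.1 s t| ≤ N * Real.exp (l * s) ∧ |P.2 s t - Q.2 s t| ≤ N * Real.exp (l * s)

theorem NearExp.congr {T l N : ℝ} (h : NearExp T l N P Q) (hP : Agree P P') (hQ : Agree Q Q') :
    NearExp T l N P' Q' := by
  intro s t ht hs hT
  rw [← hP.1 s t ht hs, ← hQ.1 s t ht hs, ← hP.2 s t (ht.trans hs) ht,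
    ← hQ.2 s t (ht.trans hs) ht]
  exact h s t ht hs hT

theorem abs_integral_sub_le_of_const {F G : ℝ → ℝ} {x y T D : ℝ} (hxy : x ≤ y) (hT : y - x ≤ T)
    (hD : 0 ≤ D) (hF : IntervalIntegrable F MeasureTheory.volume x y)
    (hG : IntervalIntegrable G MeasureTheory.volume x y)
    (h : ∀ u, x ≤ u → u ≤ y → |F u - G u| ≤ D) :
    |(∫ u in x..y, F u) - ∫ u in x..y, G u| ≤ D * T := by
  rw [← intervalIntegral.integral_sub hF hG, ← Real.norm_eq_abs]
  refine (intervalIntegral.norm_integral_le_of_norm_le_const (C := D) fun u hu => ?_).trans ?_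
  · rw [uIoc_of_le hxy] at hu
    exact h u hu.1.le hu.2
  · rw [abs_of_nonneg (sub_nonneg.2 hxy)]
    exact mul_le_mul_of_nonneg_left hT hD

/-- Integrating `K N e^{2Kv}` gives at most `(N/2) e^{2Ks}`: a weight growing at twice the Lipschitz
rate turns a Lipschitz bound into a contraction by `1/2`. -/
theorem abs_le_of_abs_deriv_le {h h' : ℝ → ℝ} {s t K N : ℝ} (hs : t ≤ s) (hN : 0 ≤ N)
    (h0 : h t = 0)
    (hd : ∀ v, t ≤ v → HasDerivWithinAt h (h' v) (Ici t) v)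
    (hb : ∀ v, t ≤ v → v ≤ s → |h' v| ≤ K * (N * Real.exp (2 * K * v))) :
    |h s| ≤ N / 2 * Real.exp (2 * K * s) := by
  refine image_norm_le_of_norm_deriv_right_le_deriv_boundary (a := t) (b := s)
    (f := h) (f' := h')
    (fun v hv => ((hd v hv.1).mono Icc_subset_Ici_self).continuousWithinAt)
    (fun v hv => (hd v hv.1).mono (Ici_subset_Ici.2 hv.1))
    (B := fun v => N / 2 * Real.exp (2 * K * v))
    (B' := fun v => K * (N * Real.exp (2 * K * v))) (by rw [h0, norm_zero]; positivity)
    (fun v => ?_) (fun v hv => hb v hv.1 hv.2.le) ⟨hs, le_rfl⟩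
  have := ((((hasDerivAt_id v).const_mul (2 * K))).exp).const_mul (N / 2)
  refine this.congr_deriv ?_
  simp; ring

theorem IsCont.exists_bound (h : IsCont P) (T : ℝ) :
    ∃ M, ∀ s t, 0 ≤ s → s ≤ T → 0 ≤ t → t ≤ T → |P.1 s t| ≤ M ∧ |P.2 s t| ≤ M := by
  obtain ⟨M₁, h₁⟩ := (isCompact_Icc (a := ((0, 0) : ℝ × ℝ)) (b := (T, T))).exists_bound_of_continuousOn
    h.1.continuousOn
  obtain ⟨M₂, h₂⟩ := (isCompact_Icc (a := ((0, 0) : ℝ × ℝ)) (b := (T, T))).exists_bound_of_continuousOn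
    h.2.continuousOn
  refine ⟨max M₁ M₂, fun s t hs hsT ht htT => ?_⟩
  have hm : ((s, t) : ℝ × ℝ) ∈ Icc ((0, 0) : ℝ × ℝ) (T, T) := ⟨⟨hs, ht⟩, ⟨hsT, htT⟩⟩
  exact ⟨(h₁ _ hm).trans (le_max_left _ _), (h₂ _ hm).trans (le_max_right _ _)⟩

/-- No sign or decay is available, but on `[0, T]` all functions are bounded by compactness and the
equations are of Volterra type: the derivative at `s` involves only times up to `s`. The rate `l`
does not depend on `N`, so the conclusion can be iterated. Both `P₁ = P₂` and `P = Q` are used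
later. -/
theorem IsPsi.exists_nearExp_of_isCont (hc₁ : IsCont P₁) (hc₂ : IsCont P₂) (hd₁ : IsCont Q₁)
    (hd₂ : IsCont Q₂) (hP₁ : IsAdmissible P₁) (hP₂ : IsAdmissible P₂)
    (h₁ : IsPsi m a β P₁ Q₁) (h₂ : IsPsi m a β P₂ Q₂) (T : ℝ) :
    ∃ l, 0 < l ∧ ∀ N, 0 ≤ N → NearExp T l N P₁ P₂ → NearExp T l N Q₁ Q₂ →
      NearExp T l (N / 2) Q₁ Q₂ := by
  rcases lt_or_ge T 0 with hT | hT
  · exact ⟨1, one_pos, fun N _ _ _ s t ht hs hsT => by linarith⟩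
  rw [isPsi_iff_isStep] at h₁ h₂
  obtain ⟨M₁, hM₁⟩ := hc₁.exists_bound T
  obtain ⟨M₂, hM₂⟩ := hc₂.exists_bound T
  obtain ⟨M₃, hM₃⟩ := hd₁.exists_bound T
  obtain ⟨M₄, hM₄⟩ := hd₂.exists_bound T
  obtain ⟨M, hM, b₁, b₂, b₃, b₄⟩ : ∃ M : ℝ, 1 ≤ M ∧ M₁ ≤ M ∧ M₂ ≤ M ∧ M₃ ≤ M ∧ M₄ ≤ M := by
    refine ⟨max 1 (max (max M₁ M₂) (max M₃ M₄)), ?_⟩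
    simp
  replace hM₁ : ∀ s t, 0 ≤ s → s ≤ T → 0 ≤ t → t ≤ T → |P₁.1 s t| ≤ M ∧ |P₁.2 s t| ≤ M :=
    fun s t x y z w => ⟨(hM₁ s t x y z w).1.trans b₁, (hM₁ s t x y z w).2.trans b₁⟩
  replace hM₂ : ∀ s t, 0 ≤ s → s ≤ T → 0 ≤ t → t ≤ T → |P₂.1 s t| ≤ M ∧ |P₂.2 s t| ≤ M :=
    fun s t x y z w => ⟨(hM₂ s t x y z w).1.trans b₂, (hM₂ s t x y z w).2.trans b₂⟩
  replace hM₃ : ∀ s t, 0 ≤ s → s ≤ T → 0 ≤ t → t ≤ T → |Q₁.1 s t| ≤ M ∧ |Q₁.2 s t| ≤ M :=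
    fun s t x y z w => ⟨(hM₃ s t x y z w).1.trans b₃, (hM₃ s t x y z w).2.trans b₃⟩
  replace hM₄ : ∀ s t, 0 ≤ s → s ≤ T → 0 ≤ t → t ≤ T → |Q₂.1 s t| ≤ M ∧ |Q₂.2 s t| ≤ M :=
    fun s t x y z w => ⟨(hM₄ s t x y z w).1.trans b₄, (hM₄ s t x y z w).2.trans b₄⟩
  obtain ⟨L, hL1, hL⟩ := exists_common_lipschitz m a M
  set A := 3 * M ^ 2 * L * T with hA
  have hA0 : 0 ≤ A := by positivity
  -- The bound on `|μ|` gives `1/2 + β² A`, the difference of the dampings times `Q₂` gives `β² A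
  -- M`, and the two memory terms of the correlation give `2 β² A`.
  set K := 1 / 2 + β ^ 2 * A * (3 + M) with hK
  have hKpos : 0 < K := by positivity
  refine ⟨2 * K, by positivity, fun N hN hNP hNQ => ?_⟩
  -- uniform form of the hypotheses
  have mono : ∀ u s : ℝ, u ≤ s → N * Real.exp (2 * K * u) ≤ N * Real.exp (2 * K * s) :=
    fun u s h => by gcongr
  have dPR : ∀ s u v, 0 ≤ v → v ≤ u → u ≤ s → s ≤ T →
      |P₁.1 u v - P₂.1 u v| ≤ N * Real.exp (2 * K * s) := fun s u v hv hu hus hs =>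
    (hNP u v hv hu (hus.trans hs)).1.trans (mono u s hus)
  have dQR : ∀ s u v, 0 ≤ v → v ≤ u → u ≤ s → s ≤ T →
      |Q₁.1 u v - Q₂.1 u v| ≤ N * Real.exp (2 * K * s) := fun s u v hv hu hus hs =>
    (hNQ u v hv hu (hus.trans hs)).1.trans (mono u s hus)
  have dPC : ∀ s u v, 0 ≤ v → v ≤ s → 0 ≤ u → u ≤ s → s ≤ T →
      |P₁.2 u v - P₂.2 u v| ≤ N * Real.exp (2 * K * s) := by
    intro s u v hv hvs hu hus hs
    rcases le_total v u with h | h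
    · exact (hNP u v hv h (hus.trans hs)).2.trans (mono u s hus)
    · rw [hP₁.symm_C u v hu hv, hP₂.symm_C u v hu hv]
      exact (hNP v u hu h (hvs.trans hs)).2.trans (mono v s hvs)
  have hM1 : M ≤ M ^ 2 := by nlinarith
  have hM2 : 1 ≤ M ^ 2 := by nlinarith
  have eA : ∀ d : ℝ, 3 * M ^ 2 * L * d * T = A * d := fun d => by rw [hA]; ring
  -- the three kinds of integrands
  have prod2 : ∀ {x y x' y' d : ℝ}, 0 ≤ d → |x - x'| ≤ L * d → |x'| ≤ L → |y| ≤ M → |y - y'| ≤ d →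
      |x * y - x' * y'| ≤ 3 * M ^ 2 * L * d := by
    intro x y x' y' d hd h1 h2 h3 h4
    refine (abs_mul_sub_mul_le _ _ _ _).trans ?_
    have t1 := mul_le_mul h1 h3 (abs_nonneg _) (by positivity)
    have t2 := mul_le_mul h2 h4 (abs_nonneg _) (by positivity)
    have hLd : 0 ≤ L * d := by positivity
    nlinarith
  have prod3 : ∀ {x y z x' y' z' d : ℝ}, 0 ≤ d → |x - x'| ≤ d → |x'| ≤ M → |y| ≤ M → |y'| ≤ M →
      |y - y'| ≤ d → |z| ≤ L → |z - z'| ≤ L * d → |x * y * z - x' * y' * z'| ≤ 3 * M ^ 2 * L * d := by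
    intro x y z x' y' z' d hd h1 h2 h3 h3' h4 h5 h6
    refine (abs_mul_mul_sub_le _ _ _ _ _ _).trans ?_
    have t1 := mul_le_mul (mul_le_mul h1 h3 (abs_nonneg _) hd) h5 (abs_nonneg _) (by positivity)
    have t2 := mul_le_mul (mul_le_mul h2 h4 (abs_nonneg _) (by positivity)) h5 (abs_nonneg _)
      (by positivity)
    have t3 := mul_le_mul (mul_le_mul h2 h3' (abs_nonneg _) (by positivity)) h6 (abs_nonneg _)
      (by positivity)
    have hLd : 0 ≤ L * d := by positivity
    nlinarith
  have lipd : ∀ {x y d : ℝ}, |x - y| ≤ d → L * |x - y| ≤ L * d := fun h =>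
    mul_le_mul_of_nonneg_left h (by linarith)
  have dμ : ∀ s, 0 ≤ s → s ≤ T →
      |muRC m a β P₁ s - muRC m a β P₂ s| ≤ β ^ 2 * (A * (N * Real.exp (2 * K * s))) := by
    intro s hs hsT
    have key := abs_integral_sub_le_of_const (T := T)
      (D := 3 * M ^ 2 * L * (N * Real.exp (2 * K * s))) hs (by linarith) (by positivity)
      (intervalIntegrable_muRC (m := m) (a := a) hc₁ s 0 s)
      (intervalIntegrable_muRC (m := m) (a := a) hc₂ s 0 s) fun u hu0 hus => by
        have huT := hus.trans hsT
        have d1 := dPC s s u hu0 hus hs le_rfl hsT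
        have l := (hL _ _ (hM₁ s u hs hsT hu0 huT).2 (hM₂ s u hs hsT hu0 huT).2).2.2
        have l' := (hL _ _ (hM₂ s u hs hsT hu0 huT).2 (hM₂ s u hs hsT hu0 huT).2).2.2.2
        exact prod2 (by positivity) (l.1.trans (lipd d1)) l'
          (hM₁ s u hs hsT hu0 huT).1 (dPR s s u hu0 hus le_rfl hsT)
    unfold muRC
    rw [show ∀ x y : ℝ, 1 / 2 + β ^ 2 * x - (1 / 2 + β ^ 2 * y) = β ^ 2 * (x - y) by
      intro x y; ring, abs_mul, abs_of_nonneg (sq_nonneg β), ← eA]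
    exact mul_le_mul_of_nonneg_left key (sq_nonneg β)
  have bμ : ∀ s, 0 ≤ s → s ≤ T → |muRC m a β P₁ s| ≤ 1 / 2 + β ^ 2 * A := by
    intro s hs hsT
    have key := abs_integral_sub_le_of_const (T := T) (D := 3 * M ^ 2 * L)
      (F := fun u => psi m a (P₁.2 s u) * P₁.1 s u) (G := fun _ => 0)
      hs (by linarith) (by positivity)
      (intervalIntegrable_muRC (m := m) (a := a) hc₁ s 0 s)
      intervalIntegrable_const fun u hu0 hus => by
        have huT := hus.trans hsT
        have l := (hL _ _ (hM₁ s u hs hsT hu0 huT).2 (hM₁ s u hs hsT hu0 huT).2).2.2.2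
        have := mul_le_mul l (hM₁ s u hs hsT hu0 huT).1 (abs_nonneg _) (by positivity)
        rw [sub_zero, abs_mul]
        nlinarith
    rw [intervalIntegral.integral_zero, sub_zero] at key
    unfold muRC
    refine (abs_add_le _ _).trans ?_
    rw [abs_mul, abs_of_nonneg (sq_nonneg β), abs_of_pos (by norm_num : (0 : ℝ) < 1 / 2)]
    have := mul_le_mul_of_nonneg_left key (sq_nonneg β)
    linarith
  have dmem : ∀ s t, 0 ≤ t → t ≤ s → s ≤ T →
      |memR m a P₁ Q₁.1 s t - memR m a P₂ Q₂.1 s t| ≤ A * (N * Real.exp (2 * K * s)) := by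
    intro s t ht hs hsT
    have hs0 := ht.trans hs
    rw [← eA]
    refine abs_integral_sub_le_of_const hs (by linarith) (by positivity)
      (intervalIntegrable_memR hc₁ hd₁.1 s t t s) (intervalIntegrable_memR hc₂ hd₂.1 s t t s)
      fun u htu hus => ?_
    have huT := hus.trans hsT
    have hu0 := ht.trans htu
    have l := (hL _ _ (hM₁ s u hs0 hsT hu0 huT).2 (hM₂ s u hs0 hsT hu0 huT).2).2.1
    exact prod3 (by positivity) (dQR s u t ht htu hus hsT) (hM₄ u t hu0 huT ht (hs.trans hsT)).1
      (hM₃ s u hs0 hsT hu0 huT).1 (hM₄ s u hs0 hsT hu0 huT).1 (dQR s s u hu0 hus le_rfl hsT) l.2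
      (l.1.trans (lipd (dPC s s u hu0 hus hs0 le_rfl hsT)))
  have dI1 : ∀ s t, 0 ≤ t → t ≤ s → s ≤ T →
      |I1 m a P₁ s t - I1 m a P₂ s t| ≤ A * (N * Real.exp (2 * K * s)) := by
    intro s t ht hs hsT
    have hs0 := ht.trans hs
    rw [← eA]
    refine abs_integral_sub_le_of_const hs0 (by linarith) (by positivity)
      (intervalIntegrable_I1 hc₁ s t 0 s) (intervalIntegrable_I1 hc₂ s t 0 s)
      fun u hu0 hus => ?_
    have huT := hus.trans hsT
    have l := (hL _ _ (hM₁ s u hs0 hsT hu0 huT).2 (hM₂ s u hs0 hsT hu0 huT).2).2.1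
    exact prod3 (by positivity) (dPC s u t ht hs hu0 hus hsT)
      (hM₂ u t hu0 huT ht (hs.trans hsT)).2
      (hM₁ s u hs0 hsT hu0 huT).1 (hM₂ s u hs0 hsT hu0 huT).1 (dPR s s u hu0 hus le_rfl hsT) l.2
      (l.1.trans (lipd (dPC s s u hu0 hus hs0 le_rfl hsT)))
  have dI2 : ∀ s t, 0 ≤ t → t ≤ s → s ≤ T →
      |I2 m a P₁ s t - I2 m a P₂ s t| ≤ A * (N * Real.exp (2 * K * s)) := by
    intro s t ht hs hsT
    have hs0 := ht.trans hs
    rw [← eA]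
    refine abs_integral_sub_le_of_const ht (by linarith) (by positivity)
      (intervalIntegrable_I2 hc₁ s t 0 t) (intervalIntegrable_I2 hc₂ s t 0 t)
      fun u hu0 hut => ?_
    have htT := hs.trans hsT
    have huT := hut.trans htT
    have l := (hL _ _ (hM₁ s u hs0 hsT hu0 huT).2 (hM₂ s u hs0 hsT hu0 huT).2).1
    have l' := (hL _ _ (hM₂ s u hs0 hsT hu0 huT).2 (hM₂ s u hs0 hsT hu0 huT).2).1.2
    exact prod2 (by positivity) (l.1.trans (lipd (dPC s s u hu0 (hut.trans hs) hs0 le_rfl hsT)))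
      l' (hM₁ t u ht htT hu0 huT).1 (dPR s t u hu0 hut hs hsT)
  intro s t ht hs hsT
  constructor
  · refine abs_le_of_abs_deriv_le (h := fun s => Q₁.1 s t - Q₂.1 s t) hs hN
      (by rw [h₁.admissible.diag_R t ht, h₂.admissible.diag_R t ht, sub_self])
      (fun v hv => ((h₁.eq_R v t ht hv).sub (h₂.eq_R v t ht hv)).congr_deriv (g' :=
        -(muRC m a β P₁ v * (Q₁.1 v t - Q₂.1 v t) +
          (muRC m a β P₁ v - muRC m a β P₂ v) * Q₂.1 v t) +
          β ^ 2 * (memR m a P₁ Q₁.1 v t - memR m a P₂ Q₂.1 v t)) (by ring))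
      (fun v hv hvs => ?_)
    have hv0 := ht.trans hv
    have hvT := hvs.trans hsT
    set d := N * Real.exp (2 * K * v)
    have hd0 : 0 ≤ d := by positivity
    have e1 := mul_le_mul (bμ v hv0 hvT) (dQR v v t ht hv le_rfl hvT) (abs_nonneg _)
      (by positivity)
    have e2 := mul_le_mul (dμ v hv0 hvT) (hM₄ v t hv0 hvT ht (hv.trans hvT)).1 (abs_nonneg _)
      (by positivity)
    have e3 := mul_le_mul_of_nonneg_left (dmem v t ht hv hvT) (sq_nonneg β)
    have e4 : 0 ≤ β ^ 2 * (A * d) := by positivity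
    refine (abs_add_le _ _).trans ?_
    rw [abs_neg]
    refine (add_le_add_left (abs_add_le _ _) _).trans ?_
    rw [abs_mul, abs_mul, abs_mul, abs_of_nonneg (sq_nonneg β), hK]
    linarith
  · refine abs_le_of_abs_deriv_le (h := fun s => Q₁.2 s t - Q₂.2 s t) hs hN
      (by rw [h₁.admissible.diag_C t ht, h₂.admissible.diag_C t ht, sub_self])
      (fun v hv => ((h₁.eq_C v t ht hv).sub (h₂.eq_C v t ht hv)).congr_deriv (g' :=
        -(muRC m a β P₁ v * (Q₁.2 v t - Q₂.2 v t) +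
          (muRC m a β P₁ v - muRC m a β P₂ v) * Q₂.2 v t) +
          β ^ 2 * ((I1 m a P₁ v t - I1 m a P₂ v t) + (I2 m a P₁ v t - I2 m a P₂ v t)))
        (by ring))
      (fun v hv hvs => ?_)
    have hv0 := ht.trans hv
    have hvT := hvs.trans hsT
    have e0 := (hNQ v t ht hv hvT).2
    set d := N * Real.exp (2 * K * v)
    have hd0 : 0 ≤ d := by positivity
    have e1 := mul_le_mul (bμ v hv0 hvT) e0 (abs_nonneg _) (by positivity)
    have e2 := mul_le_mul (dμ v hv0 hvT) (hM₄ v t hv0 hvT ht (hv.trans hvT)).2 (abs_nonneg _)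
      (by positivity)
    have e3 := mul_le_mul_of_nonneg_left
      ((abs_add_le _ _).trans (add_le_add (dI1 v t ht hv hvT) (dI2 v t ht hv hvT))) (sq_nonneg β)
    refine (abs_add_le _ _).trans ?_
    rw [abs_neg]
    refine (add_le_add_left (abs_add_le _ _) _).trans ?_
    rw [abs_mul, abs_mul, abs_mul, abs_of_nonneg (sq_nonneg β), hK]
    linarith

theorem IsPsi.exists_nearExp (hP₁ : IsAdmissible P₁) (hP₂ : IsAdmissible P₂)
    (h₁ : IsPsi m a β P₁ Q₁) (h₂ : IsPsi m a β P₂ Q₂) (T : ℝ) :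
    ∃ l, 0 < l ∧ ∀ N, 0 ≤ N → NearExp T l N P₁ P₂ → NearExp T l N Q₁ Q₂ →
      NearExp T l (N / 2) Q₁ Q₂ := by
  obtain ⟨l, hl, h⟩ := IsPsi.exists_nearExp_of_isCont hP₁.isCont_clamp hP₂.isCont_clamp
    h₁.admissible.isCont_clamp h₂.admissible.isCont_clamp
    (hP₁.congr (agree_clamp P₁)) (hP₂.congr (agree_clamp P₂))
    (h₁.congr (agree_clamp P₁) (agree_clamp Q₁)) (h₂.congr (agree_clamp P₂) (agree_clamp Q₂)) T
  exact ⟨l, hl, fun N hN hP hQ =>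
    (h N hN (hP.congr (agree_clamp _) (agree_clamp _))
      (hQ.congr (agree_clamp _) (agree_clamp _))).congr (agree_clamp _).symm (agree_clamp _).symm⟩

/-- Compactness supplies a crude first bound, valid with the weight since `e^{lu} ≥ 1`. Repeated
halving sends it to 0. -/
theorem agree_of_nearExp_half (hQ₁ : IsAdmissible Q₁) (hQ₂ : IsAdmissible Q₂)
    (h : ∀ T, ∃ l, 0 < l ∧ ∀ N, 0 ≤ N → NearExp T l N Q₁ Q₂ → NearExp T l (N / 2) Q₁ Q₂) :
    Agree Q₁ Q₂ := by
  have key : ∀ s t, 0 ≤ t → t ≤ s → |Q₁.1 s t - Q₂.1 s t| ≤ 0 ∧ |Q₁.2 s t - Q₂.2 s t| ≤ 0 := by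
    intro s t ht hs
    obtain ⟨l, hl, hh⟩ := h s
    obtain ⟨M₁, hM₁⟩ := hQ₁.isCont_clamp.exists_bound s
    obtain ⟨M₂, hM₂⟩ := hQ₂.isCont_clamp.exists_bound s
    have hs0 := ht.trans hs
    have hM : 0 ≤ M₁ + M₂ := add_nonneg
      ((abs_nonneg _).trans (hM₁ 0 0 le_rfl hs0 le_rfl hs0).1)
      ((abs_nonneg _).trans (hM₂ 0 0 le_rfl hs0 le_rfl hs0).1)
    have h0 : NearExp s l (M₁ + M₂) (clamp Q₁) (clamp Q₂) := by
      intro u v hv hu hus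
      have hu0 := hv.trans hu
      have e : M₁ + M₂ ≤ (M₁ + M₂) * Real.exp (l * u) :=
        le_mul_of_one_le_right hM (Real.one_le_exp (by positivity))
      have b₁ := hM₁ u v hu0 hus hv (hu.trans hus)
      have b₂ := hM₂ u v hu0 hus hv (hu.trans hus)
      exact ⟨(abs_sub _ _).trans ((add_le_add b₁.1 b₂.1).trans e),
        (abs_sub _ _).trans ((add_le_add b₁.2 b₂.2).trans e)⟩
    replace h0 := h0.congr (agree_clamp Q₁).symm (agree_clamp Q₂).symm
    have hn : ∀ n : ℕ, NearExp s l ((M₁ + M₂) * (1 / 2) ^ n) Q₁ Q₂ := by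
      intro n
      induction n with
      | zero => simpa using h0
      | succ n ih =>
        have := hh _ (by positivity) ih
        rwa [show (M₁ + M₂) * (1 / 2) ^ n / 2 = (M₁ + M₂) * (1 / 2) ^ (n + 1) by ring] at this
    have lim : Tendsto (fun n : ℕ => (M₁ + M₂) * (1 / 2) ^ n * Real.exp (l * s)) atTop (𝓝 0) := by
      have := ((tendsto_pow_atTop_nhds_zero_of_lt_one (r := (1 / 2 : ℝ)) (by norm_num)
        (by norm_num)).const_mul (M₁ + M₂)).mul_const (Real.exp (l * s))
      simpa using this
    exact ⟨ge_of_tendsto' lim fun n => (hn n s t ht hs le_rfl).1,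
      ge_of_tendsto' lim fun n => (hn n s t ht hs le_rfl).2⟩
  have e : ∀ {x y : ℝ}, |x - y| ≤ 0 → x = y := fun h =>
    sub_eq_zero.1 (abs_eq_zero.1 (le_antisymm h (abs_nonneg _)))
  refine ⟨fun s t ht hs => e (key s t ht hs).1, fun s t hs ht => ?_⟩
  rcases le_total t s with h | h
  · exact e (key s t ht h).2
  · rw [hQ₁.symm_C s t hs ht, hQ₂.symm_C s t hs ht]
    exact e (key t s hs h).2

theorem IsPsi.agree (hP : IsAdmissible P) (h₁ : IsPsi m a β P Q₁) (h₂ : IsPsi m a β P Q₂) :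
    Agree Q₁ Q₂ := by
  refine agree_of_nearExp_half h₁.admissible h₂.admissible fun T => ?_
  obtain ⟨l, hl, h⟩ := IsPsi.exists_nearExp hP hP h₁ h₂ T
  exact ⟨l, hl, fun N hN hQ => h N hN (fun s t _ _ _ => by
    simp only [sub_self, abs_zero]; exact ⟨by positivity, by positivity⟩) hQ⟩

theorem IsSphericalSolution.agree (h₁ : IsSphericalSolution m a β Q₁)
    (h₂ : IsSphericalSolution m a β Q₂) : Agree Q₁ Q₂ := by
  refine agree_of_nearExp_half h₁.admissible h₂.admissible fun T => ?_
  obtain ⟨l, hl, h⟩ := IsPsi.exists_nearExp h₁.admissible h₂.admissible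
    (isSphericalSolution_iff_isPsi.1 h₁) (isSphericalSolution_iff_isPsi.1 h₂) T
  exact ⟨l, hl, fun N hN hQ => h N hN hQ hQ⟩

end Uniqueness

end SphericalSpinGlass

namespace SphericalSpinGlass

variable {m : ℕ} {a : ℕ → ℝ} {β r : ℝ} {P P' Q Q' P₁ P₂ Q₁ Q₂ : TwoTime} {f f' f₁ f₂ : ℝ → ℝ → ℝ}

/-! ### Fixed points in uniformly closed sets. -/

section FixedPoint

/-- `K` is closed under uniform convergence. -/
def UnifClosed (K : Set TwoTime) : Prop := ∀ P, (∀ ε, 0 < ε → ∃ Q ∈ K, Near Q P ε) → P ∈ K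

/-- This is the Banach fixed-point argument with ratio `1/2`, carried out pointwise. The fixed point
is one only up to `Agree`, because nothing controls the iterates outside `Γ` and the quadrant. -/
theorem exists_agree_fixed {K : Set TwoTime} {T : TwoTime → TwoTime} (hT : MapsTo T K K)
    (hK : UnifClosed K) (hc : ∀ P ∈ K, ∀ Q ∈ K, ∀ ε, Near P Q ε → Near (T P) (T Q) (ε / 2))
    {P₀ : TwoTime} (h0 : P₀ ∈ K) {D : ℝ} (hD : Near P₀ (T P₀) D) : ∃ P ∈ K, Agree (T P) P := by
  set p : ℕ → TwoTime := fun n => T^[n] P₀ with hp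
  have hsucc : ∀ n, p (n + 1) = T (p n) := fun n => Function.iterate_succ_apply' T n P₀
  have hpK : ∀ n, p n ∈ K := by
    intro n
    induction n with
    | zero => exact h0
    | succ n ih => rw [hsucc]; exact hT ih
  have hpn : ∀ n, Near (p n) (p (n + 1)) (2 * D / 2 / 2 ^ n) := by
    intro n
    induction n with
    | zero => simpa [hp] using hD
    | succ n ih =>
      rw [hsucc, hsucc (n + 1)]
      have := hc _ (hpK n) _ (hpK (n + 1)) _ ih
      rwa [div_div, ← pow_succ] at this
  have c1 : ∀ s t, 0 ≤ t → t ≤ s → ∀ n, dist ((p n).1 s t) ((p (n + 1)).1 s t) ≤ 2 * D / 2 / 2 ^ n :=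
    fun s t ht hs n => (hpn n).1 s t ht hs
  have c2 : ∀ s t, 0 ≤ s → 0 ≤ t → ∀ n, dist ((p n).2 s t) ((p (n + 1)).2 s t) ≤ 2 * D / 2 / 2 ^ n :=
    fun s t hs ht n => (hpn n).2 s t hs ht
  set S : TwoTime := (fun s t => limUnder atTop fun n => (p n).1 s t,
    fun s t => limUnder atTop fun n => (p n).2 s t)
  have hS : ∀ n, Near (p n) S (2 * D / 2 ^ n) := fun n =>
    ⟨fun s t ht hs => dist_le_of_le_geometric_two_of_tendsto (c1 s t ht hs)
        (tendsto_nhds_limUnder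
          (cauchySeq_tendsto_of_complete (cauchySeq_of_le_geometric_two (c1 s t ht hs)))) n,
      fun s t hs ht => dist_le_of_le_geometric_two_of_tendsto (c2 s t hs ht)
        (tendsto_nhds_limUnder
          (cauchySeq_tendsto_of_complete (cauchySeq_of_le_geometric_two (c2 s t hs ht)))) n⟩
  have lim : Tendsto (fun n : ℕ => 2 * D / 2 ^ n) atTop (𝓝 0) := by
    have := (tendsto_pow_atTop_nhds_zero_of_lt_one (r := (1 / 2 : ℝ)) (by norm_num)
        (by norm_num)).const_mul (2 * D)
    simpa [div_eq_mul_inv] using this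
  have hSK : S ∈ K := by
    refine hK S fun ε hε => ?_
    obtain ⟨n, hn⟩ := (lim.eventually (gt_mem_nhds hε)).exists
    exact ⟨p n, hpK n, fun s t ht hs => ((hS n).1 s t ht hs).trans hn.le,
      fun s t hs ht => ((hS n).2 s t hs ht).trans hn.le⟩
  have hTS : ∀ n, Near (T (p n)) (T S) (2 * D / 2 ^ n / 2) := fun n =>
    hc _ (hpK n) _ hSK _ (hS n)
  have lim2 : Tendsto (fun n : ℕ => 2 * D / 2 ^ n / 2 + 2 * D / 2 ^ (n + 1)) atTop (𝓝 0) := by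
    simpa using (lim.div_const 2).add ((tendsto_add_atTop_iff_nat 1).2 lim)
  have e : ∀ {x y : ℝ} {q : ℕ → ℝ}, (∀ n, |q n - x| ≤ 2 * D / 2 ^ n / 2) →
      (∀ n, |q n - y| ≤ 2 * D / 2 ^ (n + 1)) → x = y := by
    intro x y q h1 h2
    have : |x - y| ≤ 0 := ge_of_tendsto' lim2 fun n => by
      refine (abs_sub_le x (q n) y).trans (add_le_add ?_ (h2 n))
      rw [abs_sub_comm]; exact h1 n
    exact sub_eq_zero.1 (abs_eq_zero.1 (le_antisymm this (abs_nonneg _)))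
  refine ⟨S, hSK, fun s t ht hs => e (q := fun n => (T (p n)).1 s t)
    (fun n => (hTS n).1 s t ht hs) fun n => ?_,
    fun s t hs ht => e (q := fun n => (T (p n)).2 s t)
    (fun n => (hTS n).2 s t hs ht) fun n => ?_⟩
  · rw [← hsucc]; exact (hS (n + 1)).1 s t ht hs
  · rw [← hsucc]; exact (hS (n + 1)).2 s t hs ht

theorem le_of_forall_approx {y b : ℝ} (h : ∀ ε, 0 < ε → ∃ x, |x - y| ≤ ε ∧ x ≤ b) : y ≤ b := by
  refine le_of_forall_pos_le_add fun ε hε => ?_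
  obtain ⟨x, hx, hb⟩ := h ε hε
  have := (abs_le.1 hx).1
  linarith

theorem ge_of_forall_approx {y b : ℝ} (h : ∀ ε, 0 < ε → ∃ x, |x - y| ≤ ε ∧ b ≤ x) : b ≤ y := by
  refine le_of_forall_pos_le_add fun ε hε => ?_
  obtain ⟨x, hx, hb⟩ := h ε hε
  have := (abs_le.1 hx).2
  linarith

theorem continuousOn_of_approx {X : Type*} [TopologicalSpace X] {F : X → ℝ} {S : Set X}
    (h : ∀ ε, 0 < ε → ∃ G : X → ℝ, ContinuousOn G S ∧ ∀ x ∈ S, |G x - F x| ≤ ε) :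
    ContinuousOn F S := by
  refine continuousOn_of_uniform_approx_of_continuousOn fun u hu => ?_
  obtain ⟨ε, hε, hεu⟩ := Metric.mem_uniformity_dist.1 hu
  obtain ⟨G, hG, hGF⟩ := h (ε / 2) (by positivity)
  refine ⟨G, hG, fun y hy => hεu ?_⟩
  rw [dist_comm, Real.dist_eq]
  exact (hGF y hy).trans_lt (by linarith)

theorem unifClosed_ASet : UnifClosed (ASet (1 / 6) r 1 2) := by
  intro P h
  replace h : ∀ ε, 0 < ε → ∃ Q, (IsAdmissible Q ∧ RBound r Q.1 ∧ CBound Q.2) ∧ Near Q P ε :=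
    fun ε hε => by
      obtain ⟨Q, hQ, hn⟩ := h ε hε
      exact ⟨Q, mem_ASet_iff.1 hQ, hn⟩
  refine mem_ASet_iff.2 ⟨⟨?_, ?_, fun t ht => ?_, fun t ht => ?_, fun s t hs ht => ?_⟩,
    fun s t ht hs => ⟨?_, ?_⟩, fun s t hs ht => ⟨?_, ?_⟩⟩
  · refine continuousOn_of_approx fun ε hε => ?_
    obtain ⟨Q, hQ, hn⟩ := h ε hε
    exact ⟨_, hQ.1.continuous_R, fun p hp => hn.1 p.1 p.2 hp.1 hp.2⟩
  · refine continuousOn_of_approx fun ε hε => ?_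
    obtain ⟨Q, hQ, hn⟩ := h ε hε
    exact ⟨_, hQ.1.continuous_C, fun p hp => hn.2 p.1 p.2 hp.1 hp.2⟩
  · refine le_antisymm (le_of_forall_approx fun ε hε => ?_) (ge_of_forall_approx fun ε hε => ?_) <;>
    · obtain ⟨Q, hQ, hn⟩ := h ε hε
      exact ⟨_, hn.1 t t ht le_rfl, by rw [hQ.1.diag_R t ht]⟩
  · refine le_antisymm (le_of_forall_approx fun ε hε => ?_) (ge_of_forall_approx fun ε hε => ?_) <;>
    · obtain ⟨Q, hQ, hn⟩ := h ε hε
      exact ⟨_, hn.2 t t ht ht, by rw [hQ.1.diag_C t ht]⟩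
  · refine eq_of_forall_dist_le fun ε hε => ?_
    obtain ⟨Q, hQ, hn⟩ := h (ε / 2) (by positivity)
    have h1 := hn.2 s t hs ht
    have h2 := hn.2 t s ht hs
    rw [hQ.1.symm_C s t hs ht, abs_sub_comm] at h1
    rw [Real.dist_eq]
    refine (abs_sub_le _ (Q.2 t s) _).trans ?_
    linarith
  · refine ge_of_forall_approx fun ε hε => ?_
    obtain ⟨Q, hQ, hn⟩ := h ε hε
    exact ⟨_, hn.1 s t ht hs, (hQ.2.1 s t ht hs).1⟩
  · refine le_of_forall_approx fun ε hε => ?_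
    obtain ⟨Q, hQ, hn⟩ := h ε hε
    exact ⟨_, hn.1 s t ht hs, (hQ.2.1 s t ht hs).2⟩
  · refine ge_of_forall_approx fun ε hε => ?_
    obtain ⟨Q, hQ, hn⟩ := h ε hε
    exact ⟨_, hn.2 s t hs ht, (hQ.2.2 s t hs ht).1⟩
  · refine le_of_forall_approx fun ε hε => ?_
    obtain ⟨Q, hQ, hn⟩ := h ε hε
    exact ⟨_, hn.2 s t hs ht, (hQ.2.2 s t hs ht).2⟩

theorem tendsto_of_approx {F : ℝ → ℝ} {l : ℝ}
    (h : ∀ ε, 0 < ε → ∃ G : ℝ → ℝ, (∀ t, 0 ≤ t → |G t - F t| ≤ ε) ∧ Tendsto G atTop (𝓝 l)) :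
    Tendsto F atTop (𝓝 l) := by
  rw [Metric.tendsto_nhds]
  intro ε hε
  obtain ⟨G, hG, hl⟩ := h (ε / 2) (by positivity)
  filter_upwards [Metric.tendsto_nhds.1 hl (ε / 2) (by positivity), eventually_ge_atTop 0]
    with t h1 h2
  have h3 := hG t h2
  rw [Real.dist_eq] at h1 ⊢
  rw [abs_sub_comm] at h3
  exact (abs_sub_le _ (G t) _).trans_lt (by linarith)

/-- The limits of the approximants vary with `ε` and no candidate is at hand, so the Cauchy
criterion is used. This is what makes `𝒮` uniformly closed. -/
theorem exists_tendsto_of_approx {F : ℝ → ℝ}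
    (h : ∀ ε, 0 < ε → ∃ G : ℝ → ℝ, (∀ t, 0 ≤ t → |G t - F t| ≤ ε) ∧
      ∃ l, Tendsto G atTop (𝓝 l)) : ∃ l, Tendsto F atTop (𝓝 l) := by
  refine cauchy_map_iff_exists_tendsto.1 (Metric.cauchy_iff.2 ⟨inferInstance, fun ε hε => ?_⟩)
  obtain ⟨G, hG, l, hl⟩ := h (ε / 5) (by positivity)
  obtain ⟨t₀, ht₀⟩ := eventually_atTop.1
    ((Metric.tendsto_nhds.1 hl (ε / 5) (by positivity)).and (eventually_ge_atTop (0 : ℝ)))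
  have key : ∀ t, t₀ ≤ t → |F t - l| ≤ 2 * (ε / 5) := by
    intro t ht
    obtain ⟨h1, h2⟩ := ht₀ t ht
    have h3 := hG t h2
    rw [Real.dist_eq] at h1
    rw [abs_sub_comm] at h3
    exact (abs_sub_le _ (G t) _).trans (by linarith)
  refine ⟨F '' Ici t₀, image_mem_map (Ici_mem_atTop t₀), ?_⟩
  rintro _ ⟨x, hx, rfl⟩ _ ⟨y, hy, rfl⟩
  have h1 := key x hx
  have h2 := key y hy
  rw [abs_sub_comm] at h2
  rw [Real.dist_eq]
  exact (abs_sub_le _ l _).trans_lt (by linarith)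

theorem Near.mono {ε ε' : ℝ} (h : Near P Q ε) (hε : ε ≤ ε') : Near P Q ε' :=
  ⟨fun s t ht hs => (h.1 s t ht hs).trans hε, fun s t hs ht => (h.2 s t hs ht).trans hε⟩

/-- The pairs in `ASet` with prescribed limits. -/
def LimSet (r : ℝ) (Rf Cf : ℝ → ℝ) : Set TwoTime :=
  {P | P ∈ ASet (1 / 6) r 1 2 ∧ HasFdtLimits P Rf Cf}

theorem unifClosed_LimSet (Rf Cf : ℝ → ℝ) : UnifClosed (LimSet r Rf Cf) := by
  intro P h
  refine ⟨unifClosed_ASet P fun ε hε => ?_, fun τ hτ => ⟨tendsto_of_approx fun ε hε => ?_,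
    tendsto_of_approx fun ε hε => ?_⟩⟩
  · obtain ⟨Q, hQ, hn⟩ := h ε hε
    exact ⟨Q, hQ.1, hn⟩
  · obtain ⟨Q, hQ, hn⟩ := h ε hε
    exact ⟨_, fun t ht => hn.1 (t + τ) t ht (by linarith), (hQ.2 τ hτ).1⟩
  · obtain ⟨Q, hQ, hn⟩ := h ε hε
    exact ⟨_, fun t ht => hn.2 (t + τ) t (by linarith) ht, (hQ.2 τ hτ).2⟩

theorem unifClosed_SSet : UnifClosed (SSet (1 / 6) r 1 2) := by
  intro P h
  have h1 : ∀ τ, ∃ l, 0 ≤ τ → Tendsto (fun t => P.1 (t + τ) t) atTop (𝓝 l) := by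
    intro τ
    rcases lt_or_ge τ 0 with hτ | hτ
    · exact ⟨0, fun h => absurd h (not_le.2 hτ)⟩
    obtain ⟨l, hl⟩ := exists_tendsto_of_approx (F := fun t => P.1 (t + τ) t) fun ε hε => by
      obtain ⟨Q, ⟨-, Rf, Cf, hQ⟩, hn⟩ := h ε hε
      exact ⟨_, fun t ht => hn.1 (t + τ) t ht (by linarith), _, (hQ τ hτ).1⟩
    exact ⟨l, fun _ => hl⟩
  have h2 : ∀ τ, ∃ l, 0 ≤ τ → Tendsto (fun t => P.2 (t + τ) t) atTop (𝓝 l) := by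
    intro τ
    rcases lt_or_ge τ 0 with hτ | hτ
    · exact ⟨0, fun h => absurd h (not_le.2 hτ)⟩
    obtain ⟨l, hl⟩ := exists_tendsto_of_approx (F := fun t => P.2 (t + τ) t) fun ε hε => by
      obtain ⟨Q, ⟨-, Rf, Cf, hQ⟩, hn⟩ := h ε hε
      exact ⟨_, fun t ht => hn.2 (t + τ) t (by linarith) ht, _, (hQ τ hτ).2⟩
    exact ⟨l, fun _ => hl⟩
  choose Rf hRf using h1
  choose Cf hCf using h2
  refine ⟨unifClosed_ASet P fun ε hε => ?_, Rf, Cf, fun τ hτ => ⟨hRf τ hτ, hCf τ hτ⟩⟩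
  obtain ⟨Q, hQ, hn⟩ := h ε hε
  exact ⟨Q, hQ.1, hn⟩

end FixedPoint

end SphericalSpinGlass

namespace SphericalSpinGlass

variable {m : ℕ} {a : ℕ → ℝ} {β r : ℝ} {P P' Q Q' P₁ P₂ Q₁ Q₂ : TwoTime} {f f' f₁ f₂ : ℝ → ℝ → ℝ}

/-! ### Long-time limits of linear equations. -/

section Limits

/-- This serves memory integrals over the whole past, written in the lag `θ`: the range grows to a
half-line while exponential decay in the lag dominates. -/
theorem tendsto_integral_Ioi_of_dominated {F : ℝ → ℝ → ℝ} {F' : ℝ → ℝ} {w K : ℝ} {b : ℝ → ℝ}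
    (hb : Tendsto b atTop atTop) (hF : ∀ t, Continuous (F t))
    (hbd : ∀ t, 0 ≤ t → ∀ θ, w < θ → θ ≤ b t → |F t θ| ≤ K * Real.exp (-(1 / 6) * θ))
    (hK : 0 ≤ K)
    (hl : ∀ θ, w < θ → Tendsto (fun t => F t θ) atTop (𝓝 (F' θ))) :
    Tendsto (fun t => ∫ θ in w..b t, F t θ) atTop (𝓝 (∫ θ in Ioi w, F' θ)) := by
  have key : Tendsto (fun t => ∫ θ in Ioi w, (Iic (b t)).indicator (F t) θ) atTop
      (𝓝 (∫ θ in Ioi w, F' θ)) := by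
    refine MeasureTheory.tendsto_integral_filter_of_dominated_convergence
      (fun θ => K * Real.exp (-(1 / 6) * θ))
      (Eventually.of_forall fun t => ((hF t).aestronglyMeasurable.indicator measurableSet_Iic)) ?_
      ((exp_neg_integrableOn_Ioi w (by norm_num)).const_mul K) ?_
    · filter_upwards [eventually_ge_atTop (0 : ℝ)] with t ht
      filter_upwards [MeasureTheory.ae_restrict_mem measurableSet_Ioi] with θ hθ
      by_cases h : θ ∈ Iic (b t)
      · rw [indicator_of_mem h]
        exact hbd t ht θ hθ h
      · rw [indicator_of_notMem h, norm_zero]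
        positivity
    · filter_upwards [MeasureTheory.ae_restrict_mem measurableSet_Ioi] with θ hθ
      refine (hl θ hθ).congr' ?_
      filter_upwards [hb.eventually_ge_atTop θ] with t ht
      rw [indicator_of_mem (mem_Iic.2 ht)]
  refine key.congr' ?_
  filter_upwards [hb.eventually_ge_atTop w] with t ht
  rw [intervalIntegral.integral_of_le ht, MeasureTheory.setIntegral_indicator measurableSet_Iic,
    Ioi_inter_Iic]

/-- The solution of `h' = -μ h + g`, `h(0) = 1` for a constant `μ`. -/
noncomputable def limSol (μ : ℝ) (g : ℝ → ℝ) (τ : ℝ) : ℝ :=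
  Real.exp (-(μ * τ)) * (1 + ∫ w in (0 : ℝ)..τ, Real.exp (μ * w) * g w)

/-- The integral of `μ` up to time `t` cancels, so only the window `[t, t + τ]` matters. There `μ`
is nearly constant for large `t`. -/
theorem linSol_shift {μ : ℝ → ℝ} {g : ℝ → ℝ → ℝ} (hμ : Continuous μ) (t τ : ℝ) :
    linSol μ g (t + τ) t = Real.exp (-∫ x in (0 : ℝ)..τ, μ (t + x)) *
      (1 + ∫ w in (0 : ℝ)..τ, Real.exp (∫ x in (0 : ℝ)..w, μ (t + x)) * g (t + w) t) := by
  have h1 : ∀ w, ∫ x in (0 : ℝ)..t + w, μ x =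
      (∫ x in (0 : ℝ)..t, μ x) + ∫ x in (0 : ℝ)..w, μ (t + x) := by
    intro w
    rw [intervalIntegral.integral_comp_add_left, add_zero,
      intervalIntegral.integral_add_adjacent_intervals (hμ.intervalIntegrable _ _)
        (hμ.intervalIntegrable _ _)]
  have h2 : ∫ v in t..t + τ, Real.exp (∫ x in (0 : ℝ)..v, μ x) * g v t =
      Real.exp (∫ x in (0 : ℝ)..t, μ x) *
        ∫ w in (0 : ℝ)..τ, Real.exp (∫ x in (0 : ℝ)..w, μ (t + x)) * g (t + w) t := by
    rw [← intervalIntegral.integral_const_mul]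
    have := intervalIntegral.integral_comp_add_left (a := 0) (b := τ)
      (fun v => Real.exp (∫ x in (0 : ℝ)..v, μ x) * g v t) t
    rw [add_zero] at this
    rw [← this]
    refine intervalIntegral.integral_congr fun w _ => ?_
    simp only [h1, Real.exp_add]
    ring
  rw [linSol, h2, h1, neg_add, Real.exp_add]
  have e : Real.exp (-∫ x in (0 : ℝ)..t, μ x) * Real.exp (∫ x in (0 : ℝ)..t, μ x) = 1 := by
    rw [← Real.exp_add]; simp
  linear_combination (Real.exp (-∫ x in (0 : ℝ)..τ, μ (t + x)) * (1 +
    ∫ w in (0 : ℝ)..τ, Real.exp (∫ x in (0 : ℝ)..w, μ (t + x)) * g (t + w) t)) * e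

theorem tendsto_linSol {μ : ℝ → ℝ} {g : ℝ → ℝ → ℝ} {μ' K : ℝ} {g' : ℝ → ℝ} (hμ : Continuous μ)
    (hg : Continuous fun p : ℝ × ℝ => g p.1 p.2) (hμl : Tendsto μ atTop (𝓝 μ'))
    (hgb : ∀ s t, 0 ≤ t → t ≤ s → |g s t| ≤ K)
    (hgl : ∀ w, 0 ≤ w → Tendsto (fun t => g (t + w) t) atTop (𝓝 (g' w))) {τ : ℝ} (hτ : 0 ≤ τ) :
    Tendsto (fun t => linSol μ g (t + τ) t) atTop (𝓝 (limSol μ' g' τ)) := by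
  have hK : 0 ≤ K := (abs_nonneg _).trans (hgb 0 0 le_rfl le_rfl)
  have hev : ∀ᶠ t in atTop, ∀ x, 0 ≤ x → |μ (t + x)| ≤ |μ'| + 1 := by
    obtain ⟨t₀, h⟩ := eventually_atTop.1
      (hμl.abs.eventually (gt_mem_nhds (lt_add_one |μ'|)))
    filter_upwards [eventually_ge_atTop t₀] with t ht x hx
    exact (h (t + x) (by linarith)).le
  have hint : ∀ w, 0 ≤ w → Tendsto (fun t => ∫ x in (0 : ℝ)..w, μ (t + x)) atTop (𝓝 (μ' * w)) := by
    intro w hw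
    have := intervalIntegral.tendsto_integral_filter_of_dominated_convergence (a := 0) (b := w)
      (μ := MeasureTheory.volume) (l := atTop) (F := fun t x => μ (t + x)) (f := fun _ => μ')
      (fun _ => |μ'| + 1)
      (Eventually.of_forall fun t => (by fun_prop : Continuous fun x => μ (t + x)).aestronglyMeasurable)
      (by
        filter_upwards [hev] with t ht
        refine Eventually.of_forall fun x hx => ht x ?_
        rw [uIoc_of_le hw] at hx
        exact hx.1.le) intervalIntegrable_const
      (Eventually.of_forall fun x _ => hμl.comp (tendsto_atTop_add_const_right _ x tendsto_id))
    simpa [mul_comm] using this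
  have hM : ∀ t, Continuous fun w => ∫ x in (0 : ℝ)..w, μ (t + x) := fun t =>
    intervalIntegral.continuous_primitive
      (fun _ _ => (by fun_prop : Continuous fun x => μ (t + x)).intervalIntegrable _ _) 0
  simp only [linSol_shift hμ, limSol]
  refine ((hint τ hτ).neg.rexp).mul (tendsto_const_nhds.add ?_)
  refine intervalIntegral.tendsto_integral_filter_of_dominated_convergence
    (fun _ => Real.exp ((|μ'| + 1) * τ) * K)
    (Eventually.of_forall fun t => ((Real.continuous_exp.comp (hM t)).mul
      (continuous_section hg (by fun_prop) continuous_const)).aestronglyMeasurable) ?_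
    intervalIntegrable_const ?_
  · filter_upwards [hev, eventually_ge_atTop 0] with t ht ht0
    refine Eventually.of_forall fun w hw => ?_
    rw [uIoc_of_le hτ] at hw
    rw [norm_mul]
    refine mul_le_mul ?_ (hgb _ _ ht0 (by linarith [hw.1])) (norm_nonneg _) (Real.exp_pos _).le
    rw [Real.norm_eq_abs, Real.abs_exp, Real.exp_le_exp]
    have := intervalIntegral.norm_integral_le_of_norm_le_const (a := 0) (b := w)
      (f := fun x => μ (t + x)) (C := |μ'| + 1) (fun x hx => ht x (by
        rw [uIoc_of_le hw.1.le] at hx; exact hx.1.le))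
    rw [sub_zero, abs_of_pos hw.1] at this
    refine (le_abs_self _).trans (this.trans ?_)
    exact mul_le_mul_of_nonneg_left hw.2 (by positivity)
  · refine Eventually.of_forall fun w hw => ?_
    rw [uIoc_of_le hτ] at hw
    exact ((hint w hw.1.le).rexp).mul (hgl w hw.1.le)

variable {Rf Cf : ℝ → ℝ}

theorem HasFdtLimits.congr (h : HasFdtLimits P Rf Cf) (hP : Agree P Q) :
    HasFdtLimits Q Rf Cf := by
  refine fun τ hτ => ⟨(h τ hτ).1.congr' ?_, (h τ hτ).2.congr' ?_⟩
  · filter_upwards [eventually_ge_atTop 0] with t ht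
    exact hP.1 _ _ ht (by linarith)
  · filter_upwards [eventually_ge_atTop 0] with t ht
    exact hP.2 _ _ (by linarith) ht

theorem tendsto_shift {f : ℝ → ℝ → ℝ} {g : ℝ → ℝ}
    (h : ∀ τ, 0 ≤ τ → Tendsto (fun t => f (t + τ) t) atTop (𝓝 (g τ)))
    {x y : ℝ} (hxy : y ≤ x) : Tendsto (fun t => f (t + x) (t + y)) atTop (𝓝 (g (x - y))) := by
  refine ((h (x - y) (sub_nonneg.2 hxy)).comp
    (tendsto_atTop_add_const_right _ y tendsto_id)).congr fun t => ?_
  simp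

/-- Limits are prescribed only for non-negative lags. Symmetry of `C` supplies the others, with the
absolute value as even extension. -/
theorem HasFdtLimits.tendsto_C (h : HasFdtLimits P Rf Cf)
    (hs : ∀ s t, 0 ≤ s → 0 ≤ t → P.2 s t = P.2 t s) (x y : ℝ) :
    Tendsto (fun t => P.2 (t + x) (t + y)) atTop (𝓝 (Cf |x - y|)) := by
  rcases le_total y x with hxy | hxy
  · rw [abs_of_nonneg (sub_nonneg.2 hxy)]
    exact tendsto_shift (fun τ hτ => (h τ hτ).2) hxy
  · rw [abs_sub_comm, abs_of_nonneg (sub_nonneg.2 hxy)]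
    refine (tendsto_shift (fun τ hτ => (h τ hτ).2) hxy).congr' ?_
    filter_upwards [eventually_ge_atTop (-x), eventually_ge_atTop (-y)] with t h1 h2
    exact hs _ _ (by linarith) (by linarith)

end Limits

end SphericalSpinGlass

namespace SphericalSpinGlass

variable {m : ℕ} {a : ℕ → ℝ} {β r : ℝ} {P P' Q Q' P₁ P₂ Q₁ Q₂ : TwoTime} {f f' f₁ f₂ : ℝ → ℝ → ℝ}
  {Rf Cf ff : ℝ → ℝ}

/-! ### Limits of the memory terms. -/

section MemoryLimits

/-- The stationary form of `memR`. -/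
noncomputable def memRLim (m : ℕ) (a : ℕ → ℝ) (f C : ℝ → ℝ) (w : ℝ) : ℝ :=
  ∫ θ in (0 : ℝ)..w, f (w - θ) * f θ * nu2 m a (C θ)

/-- The stationary form of `I1`. -/
noncomputable def I1Lim (m : ℕ) (a : ℕ → ℝ) (R C : ℝ → ℝ) (w : ℝ) : ℝ :=
  ∫ θ in Ioi (0 : ℝ), C (w - θ) * R θ * nu2 m a (C θ)

/-- The stationary form of `I2`. -/
noncomputable def I2Lim (m : ℕ) (a : ℕ → ℝ) (R C : ℝ → ℝ) (w : ℝ) : ℝ :=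
  ∫ θ in Ioi w, nu1 m a (C θ) * R (θ - w)

theorem RBound.abs_le_one (hr : 0 < r) (h : RBound r f) {s t : ℝ} (ht : 0 ≤ t) (hs : t ≤ s) :
    |f s t| ≤ 1 := by
  rw [abs_of_nonneg (h s t ht hs).1]
  exact h.le_one hr ht hs

theorem CBound.abs_le_two {c : ℝ → ℝ → ℝ} (h : CBound c) {s t : ℝ} (hs : 0 ≤ s) (ht : 0 ≤ t) :
    |c s t| ≤ 2 := by
  rw [abs_of_nonneg (h s t hs ht).1]
  exact h.le_two hs ht

theorem CBound.abs_nu2_le {c : ℝ → ℝ → ℝ} (h : CBound c) {s t : ℝ} (hs : 0 ≤ s) (ht : 0 ≤ t) :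
    |nu2 m a (c s t)| ≤ nu2 m a 2 := by
  rw [abs_of_nonneg (nu2_nonneg m a (h s t hs ht).1)]
  exact nu2_mono m a (h s t hs ht).1 (h.le_two hs ht)

theorem CBound.abs_nu1_le {c : ℝ → ℝ → ℝ} (h : CBound c) {s t : ℝ} (hs : 0 ≤ s) (ht : 0 ≤ t) :
    |nu1 m a (c s t)| ≤ 2 * nu2 m a 2 * Real.exp (-(1 / 6) * |s - t|) := by
  obtain ⟨h1, h2⟩ := h s t hs ht
  rw [abs_of_nonneg (nu1_nonneg m a h1)]
  refine (nu1_le_mul_two m a h1 (h.le_two hs ht)).trans ?_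
  have := mul_le_mul_of_nonneg_left h2 (nu2_nonneg m a (x := 2) (by norm_num))
  linarith

theorem CBound.abs_psi_le {c : ℝ → ℝ → ℝ} (h : CBound c) {s t : ℝ} (hs : 0 ≤ s) (ht : 0 ≤ t) :
    |psi m a (c s t)| ≤ 4 * nu2 m a 2 := by
  obtain ⟨h1, -⟩ := h s t hs ht
  rw [abs_of_nonneg (psi_nonneg m a h1)]
  have h2 := h.le_two hs ht
  refine (psi_le_mul_two m a h1 h2).trans ?_
  have := mul_le_mul_of_nonneg_left h2 (nu2_nonneg m a (x := 2) (by norm_num))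
  linarith

theorem tendsto_muRC (hr : 0 < r) (hc : IsCont P) (hR : RBound r P.1) (hC : CBound P.2)
    (hsy : ∀ s t, 0 ≤ s → 0 ≤ t → P.2 s t = P.2 t s) (hl : HasFdtLimits P Rf Cf)
    (he : ∀ x, Cf |x| = Cf x) :
    Tendsto (muRC m a β P) atTop (𝓝 (muFdt m a β 0 Rf Cf)) := by
  have hK := nu2_nonneg m a (x := 2) (by norm_num)
  unfold muFdt
  rw [add_zero]
  refine tendsto_const_nhds.add (tendsto_const_nhds.mul ?_)
  have e : ∀ s, ∫ u in (0 : ℝ)..s, psi m a (P.2 s u) * P.1 s u =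
      ∫ θ in (0 : ℝ)..s, psi m a (P.2 s (s - θ)) * P.1 s (s - θ) := by
    intro s
    rw [intervalIntegral.integral_comp_sub_left (fun u => psi m a (P.2 s u) * P.1 s u)]
    simp
  simp only [e]
  refine tendsto_integral_Ioi_of_dominated (K := 4 * nu2 m a 2) tendsto_id (fun t => ?_)
    (fun t ht θ hθ hθt => ?_) (by positivity) fun θ hθ => ?_
  · exact ((continuous_psi m a).comp (continuous_section hc.2 continuous_const (by fun_prop))).mul
      (continuous_section hc.1 continuous_const (by fun_prop))
  · have h0 : 0 ≤ t - θ := sub_nonneg.2 hθt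
    rw [abs_mul]
    refine mul_le_mul (hC.abs_psi_le ht h0) ?_ (abs_nonneg _) (by positivity)
    refine (abs_le_exp_of_rBound hr hR h0 (by linarith)).trans (le_of_eq ?_)
    rw [show t - (t - θ) = θ by ring, abs_of_pos hθ]
  · have h1 := hl.tendsto_C hsy 0 (-θ)
    have h2 := tendsto_shift (fun τ hτ => (hl τ hτ).1) (x := 0) (y := -θ) (by linarith)
    simp only [add_zero, zero_sub, neg_neg, ← sub_eq_add_neg, he] at h1 h2
    exact (((continuous_psi m a).tendsto _).comp h1).mul h2

theorem tendsto_memR (hr : 0 < r) (hc : IsCont P) (hC : CBound P.2)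
    (hsy : ∀ s t, 0 ≤ s → 0 ≤ t → P.2 s t = P.2 t s) (hl : HasFdtLimits P Rf Cf)
    (he : ∀ x, Cf |x| = Cf x) (hfc : Continuous fun p : ℝ × ℝ => f p.1 p.2) (hf : RBound r f)
    (hfl : ∀ τ, 0 ≤ τ → Tendsto (fun t => f (t + τ) t) atTop (𝓝 (ff τ))) {w : ℝ} (hw : 0 ≤ w) :
    Tendsto (fun t => memR m a P f (t + w) t) atTop (𝓝 (memRLim m a ff Cf w)) := by
  have hK := nu2_nonneg m a (x := 2) (by norm_num)
  have e : ∀ t, memR m a P f (t + w) t = ∫ θ in (0 : ℝ)..w,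
      f (t + (w - θ)) t * f (t + w) (t + (w - θ)) * nu2 m a (P.2 (t + w) (t + (w - θ))) := by
    intro t
    have := intervalIntegral.integral_comp_sub_left (a := 0) (b := w)
      (fun u => f u t * f (t + w) u * nu2 m a (P.2 (t + w) u)) (t + w)
    simp only [sub_zero, add_sub_cancel_right, add_sub_assoc] at this
    exact this.symm
  simp only [e]
  refine intervalIntegral.tendsto_integral_filter_of_dominated_convergence
    (fun _ => 1 * 1 * nu2 m a 2) (Eventually.of_forall fun t => ?_) ?_ intervalIntegrable_const
    (Eventually.of_forall fun θ hθ => ?_)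
  · exact (((continuous_section hfc (by fun_prop) continuous_const).mul
      (continuous_section hfc continuous_const (by fun_prop))).mul
      ((continuous_nu2 m a).comp
        (continuous_section hc.2 continuous_const (by fun_prop)))).aestronglyMeasurable
  · filter_upwards [eventually_ge_atTop 0] with t ht
    refine Eventually.of_forall fun θ hθ => ?_
    rw [uIoc_of_le hw] at hθ
    have h0 : t ≤ t + (w - θ) := by linarith [hθ.2]
    have h1 : t + (w - θ) ≤ t + w := by linarith [hθ.1]
    rw [norm_mul, norm_mul]
    exact mul_le_mul (mul_le_mul (hf.abs_le_one hr ht h0) (hf.abs_le_one hr (ht.trans h0) h1)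
      (abs_nonneg _) zero_le_one) (hC.abs_nu2_le (by linarith) (ht.trans h0)) (abs_nonneg _)
      (by norm_num)
  · rw [uIoc_of_le hw] at hθ
    have h1 := hl.tendsto_C hsy w (w - θ)
    have h2 := tendsto_shift hfl (x := w) (y := w - θ) (by linarith [hθ.1])
    rw [show w - (w - θ) = θ by ring] at h1 h2
    rw [he] at h1
    exact ((hfl (w - θ) (by linarith [hθ.2])).mul h2).mul
      (((continuous_nu2 m a).tendsto _).comp h1)

/-- The substitution `u = t + w - θ` makes the lag the integration variable, and the decay of `R` in
`θ` gives the dominating function. For `I2` the same substitution is dominated through the decay of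
`ν'(C)`. -/
theorem tendsto_I1 (hr : 0 < r) (hc : IsCont P) (hR : RBound r P.1) (hC : CBound P.2)
    (hsy : ∀ s t, 0 ≤ s → 0 ≤ t → P.2 s t = P.2 t s) (hl : HasFdtLimits P Rf Cf)
    (he : ∀ x, Cf |x| = Cf x) (w : ℝ) :
    Tendsto (fun t => I1 m a P (t + w) t) atTop (𝓝 (I1Lim m a Rf Cf w)) := by
  have hK := nu2_nonneg m a (x := 2) (by norm_num)
  have e : ∀ t, I1 m a P (t + w) t = ∫ θ in (0 : ℝ)..t + w,
      P.2 (t + (w - θ)) t * P.1 (t + w) (t + (w - θ)) * nu2 m a (P.2 (t + w) (t + (w - θ))) := by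
    intro t
    have := intervalIntegral.integral_comp_sub_left (a := 0) (b := t + w)
      (fun u => P.2 u t * P.1 (t + w) u * nu2 m a (P.2 (t + w) u)) (t + w)
    simp only [sub_zero, sub_self, add_sub_assoc t w] at this
    exact this.symm
  simp only [e]
  refine tendsto_integral_Ioi_of_dominated (K := 2 * nu2 m a 2)
    (tendsto_atTop_add_const_right _ w tendsto_id) (fun t => ?_)
    (fun t ht θ hθ hθt => ?_) (by positivity) fun θ hθ => ?_
  · exact ((continuous_section hc.2 (by fun_prop) continuous_const).mul
      (continuous_section hc.1 continuous_const (by fun_prop))).mul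
      ((continuous_nu2 m a).comp (continuous_section hc.2 continuous_const (by fun_prop)))
  · have h0 : 0 ≤ t + (w - θ) := by
      have : θ ≤ t + w := hθt
      linarith
    rw [abs_mul, abs_mul]
    have h1 := abs_le_exp_of_rBound hr hR h0 (s := t + w) (by linarith)
    rw [show t + w - (t + (w - θ)) = θ by ring, abs_of_pos hθ] at h1
    refine (mul_le_mul (mul_le_mul (hC.abs_le_two h0 ht) h1 (abs_nonneg _) zero_le_two)
      (hC.abs_nu2_le (by linarith) h0) (abs_nonneg _) (by positivity)).trans (le_of_eq (by ring))
  · have h1 := hl.tendsto_C hsy w (w - θ)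
    have h2 := tendsto_shift (fun τ hτ => (hl τ hτ).1) (x := w) (y := w - θ) (by linarith)
    have h3 := hl.tendsto_C hsy (w - θ) 0
    rw [show w - (w - θ) = θ by ring] at h1 h2
    simp only [he, add_zero, sub_zero] at h1 h3
    exact (h3.mul h2).mul (((continuous_nu2 m a).tendsto _).comp h1)

theorem tendsto_I2 (hr : 0 < r) (hc : IsCont P) (hR : RBound r P.1) (hC : CBound P.2)
    (hsy : ∀ s t, 0 ≤ s → 0 ≤ t → P.2 s t = P.2 t s) (hl : HasFdtLimits P Rf Cf)
    (he : ∀ x, Cf |x| = Cf x) {w : ℝ} (hw : 0 ≤ w) :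
    Tendsto (fun t => I2 m a P (t + w) t) atTop (𝓝 (I2Lim m a Rf Cf w)) := by
  have hK := nu2_nonneg m a (x := 2) (by norm_num)
  have e : ∀ t, I2 m a P (t + w) t = ∫ θ in w..t + w,
      nu1 m a (P.2 (t + w) (t + (w - θ))) * P.1 t (t + (w - θ)) := by
    intro t
    have := intervalIntegral.integral_comp_sub_left (a := w) (b := t + w)
      (fun u => nu1 m a (P.2 (t + w) u) * P.1 t u) (t + w)
    simp only [sub_self, add_sub_assoc t w, add_zero] at this
    exact this.symm
  simp only [e]
  refine tendsto_integral_Ioi_of_dominated (K := 2 * nu2 m a 2)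
    (tendsto_atTop_add_const_right _ w tendsto_id) (fun t => ?_)
    (fun t ht θ hθ hθt => ?_) (by positivity) fun θ hθ => ?_
  · exact ((continuous_nu1 m a).comp (continuous_section hc.2 continuous_const (by fun_prop))).mul
      (continuous_section hc.1 continuous_const (by fun_prop))
  · have h0 : 0 ≤ t + (w - θ) := by
      have : θ ≤ t + w := hθt
      linarith
    rw [abs_mul]
    have h1 := hC.abs_nu1_le (m := m) (a := a) (s := t + w) (by linarith) h0
    rw [show t + w - (t + (w - θ)) = θ by ring, abs_of_nonneg (hw.trans hθ.le)] at h1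
    exact (mul_le_mul h1 (hR.abs_le_one hr h0 (by linarith)) (abs_nonneg _)
      (by positivity)).trans (le_of_eq (mul_one _))
  · have h1 := hl.tendsto_C hsy w (w - θ)
    have h2 := tendsto_shift (fun τ hτ => (hl τ hτ).1) (x := 0) (y := w - θ) (by linarith)
    rw [show w - (w - θ) = θ by ring] at h1
    rw [show 0 - (w - θ) = θ - w by ring] at h2
    simp only [he, add_zero] at h1 h2
    exact (((continuous_nu1 m a).tendsto _).comp h1).mul h2

/-- The action of the step map on limits. -/
noncomputable def fdtStep (m : ℕ) (a : ℕ → ℝ) (β : ℝ) (R C f : ℝ → ℝ) : (ℝ → ℝ) × (ℝ → ℝ) :=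
  (limSol (muFdt m a β 0 R C) fun w => β ^ 2 * memRLim m a f C w,
    limSol (muFdt m a β 0 R C) fun w => β ^ 2 * (I1Lim m a R C w + I2Lim m a R C w))

/-- The forcing `g'` is known only as a pointwise limit, hence measurable and bounded on the
half-line, and this suffices for a continuous primitive. Through the fixed-point identity, the
limits `R_fdt` and `C_fdt` thereby gain their continuity. -/
theorem continuousOn_limSol {g : ℝ → ℝ → ℝ} {μ' K : ℝ} {g' : ℝ → ℝ}
    (hg : Continuous fun p : ℝ × ℝ => g p.1 p.2)
    (hgb : ∀ s t, 0 ≤ t → t ≤ s → |g s t| ≤ K)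
    (hgl : ∀ w, 0 ≤ w → Tendsto (fun t => g (t + w) t) atTop (𝓝 (g' w))) :
    ContinuousOn (limSol μ' g') (Ici 0) := by
  set G : ℝ → ℝ := (Ici 0).indicator fun w => Real.exp (μ' * w) * g' w with hG
  have hGm : MeasureTheory.AEStronglyMeasurable G MeasureTheory.volume := by
    refine aestronglyMeasurable_of_tendsto_ae (u := (atTop : Filter ℝ))
      (f := fun t => (Ici 0).indicator fun w => Real.exp (μ' * w) * g (t + w) t)
      (fun t => ?_) (Eventually.of_forall fun w => ?_)
    · exact ((by fun_prop : Continuous fun w => Real.exp (μ' * w)).mul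
        (continuous_section hg (by fun_prop) continuous_const)).aestronglyMeasurable.indicator
        measurableSet_Ici
    · by_cases hw : w ∈ Ici (0 : ℝ)
      · simp only [hG, indicator_of_mem hw]
        exact tendsto_const_nhds.mul (hgl w hw)
      · simp only [hG, indicator_of_notMem hw]
        exact tendsto_const_nhds
  have hK : 0 ≤ K := (abs_nonneg _).trans (hgb 0 0 le_rfl le_rfl)
  have hg' : ∀ w, 0 ≤ w → |g' w| ≤ K := fun w hw => by
    refine le_of_tendsto (hgl w hw).abs ?_
    filter_upwards [eventually_ge_atTop 0] with t ht
    exact hgb _ _ ht (by linarith)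
  have hGi : ∀ x y, IntervalIntegrable G MeasureTheory.volume x y := by
    intro x y
    rw [intervalIntegrable_iff]
    obtain ⟨B, hB⟩ := (isCompact_uIcc (a := x) (b := y)).exists_bound_of_continuousOn
      (f := fun w => Real.exp (μ' * w)) (by fun_prop)
    refine MeasureTheory.Measure.integrableOn_of_bounded (M := B * K) (by simp [uIoc]) hGm ?_
    filter_upwards [MeasureTheory.ae_restrict_mem measurableSet_uIoc] with w hw
    have hBw := hB w (uIoc_subset_uIcc hw)
    by_cases h : w ∈ Ici (0 : ℝ)
    · simp only [hG, indicator_of_mem h, norm_mul]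
      exact mul_le_mul hBw (hg' w h) (norm_nonneg _) ((norm_nonneg _).trans hBw)
    · simp only [hG, indicator_of_notMem h, norm_zero]
      exact mul_nonneg ((norm_nonneg _).trans hBw) hK
  have hcont : Continuous fun τ => Real.exp (-(μ' * τ)) * (1 + ∫ w in (0 : ℝ)..τ, G w) :=
    (by fun_prop : Continuous fun τ => Real.exp (-(μ' * τ))).mul
      (continuous_const.add (intervalIntegral.continuous_primitive hGi 0))
  refine hcont.continuousOn.congr fun τ hτ => ?_
  simp only [limSol]
  congr 2
  refine intervalIntegral.integral_congr fun w hw => ?_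
  rw [uIcc_of_le hτ] at hw
  simp only [hG, indicator_of_mem (mem_Ici.2 hw.1)]

/-- The step map acts on limits through `fdtStep`. -/
theorem hasFdtLimits_stepMap (hr : 0 < r) (hβ : β ^ 2 * nu2 m a 2 = r ^ 2)
    (hP : P ∈ LimSet r Rf Cf) (he : ∀ x, Cf |x| = Cf x)
    (hfc : ContinuousOn (fun p : ℝ × ℝ => f p.1 p.2) Gam) (hf : RBound r f)
    (hfl : ∀ τ, 0 ≤ τ → Tendsto (fun t => f (t + τ) t) atTop (𝓝 (ff τ))) :
    HasFdtLimits (stepMap m a β P f) (fdtStep m a β Rf Cf ff).1 (fdtStep m a β Rf Cf ff).2 ∧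
      ContinuousOn (fdtStep m a β Rf Cf ff).1 (Ici 0) ∧
      ContinuousOn (fdtStep m a β Rf Cf ff).2 (Ici 0) := by
  have hc := isCont_clamp_of_mem hP.1
  obtain ⟨hA, hR, hC⟩ := mem_ASet_iff.1 (mem_ASet_congr hP.1 (agree_clamp P))
  have hl := hP.2.congr (agree_clamp P)
  have hfc' := continuous_clampR hfc
  have hf' := hf.congr (agreeR_clampR f)
  have hfl' : ∀ τ, 0 ≤ τ → Tendsto (fun t => clampR f (t + τ) t) atTop (𝓝 (ff τ)) := by
    intro τ hτ
    refine (hfl τ hτ).congr' ?_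
    filter_upwards [eventually_ge_atTop 0] with t ht
    exact agreeR_clampR f _ _ ht (by linarith)
  have hμc := continuous_muRC (m := m) (a := a) (β := β) hc
  have hμl := tendsto_muRC (m := m) (a := a) (β := β) hr hc hR hC hA.symm_C hl he
  have g1c : Continuous fun p : ℝ × ℝ => β ^ 2 * memR m a (clamp P) (clampR f) p.1 p.2 :=
    continuous_const.mul (continuous_memR hc hfc')
  have g2c : Continuous fun p : ℝ × ℝ =>
      β ^ 2 * (I1 m a (clamp P) p.1 p.2 + I2 m a (clamp P) p.1 p.2) :=
    continuous_const.mul ((continuous_I1 hc).add (continuous_I2 hc))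
  have g1b : ∀ s t, 0 ≤ t → t ≤ s → |β ^ 2 * memR m a (clamp P) (clampR f) s t| ≤ 12 * r := by
    intro s t ht hs
    rw [abs_of_nonneg (mul_nonneg (sq_nonneg β) (memR_nonneg hC hf' ht hs))]
    refine (memR_le hr hβ hc hC hfc' hf' ht hs).trans ?_
    have h1 := wt_le_one hr (sub_nonneg.2 hs)
    have h2 : Real.exp (-(1 / 6) * (s - t)) ≤ 1 := Real.exp_le_one_iff.2 (by linarith)
    have := mul_le_one₀ h1 (Real.exp_pos _).le h2
    nlinarith
  have g2b : ∀ s t, 0 ≤ t → t ≤ s →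
      |β ^ 2 * (I1 m a (clamp P) s t + I2 m a (clamp P) s t)| ≤ 8 * r := by
    intro s t ht hs
    rw [abs_of_nonneg (mul_nonneg (sq_nonneg β)
      (add_nonneg (I1_nonneg hR hC ht hs) (I2_nonneg hR hC ht hs)))]
    have h1 := I1_le hr hβ hc hR hC ht hs
    have h1' := I2_le hr hβ hc hR hC ht hs
    have h2 : Real.exp (-(1 / 6) * (s - t)) ≤ 1 := Real.exp_le_one_iff.2 (by linarith)
    nlinarith
  have g1l : ∀ w, 0 ≤ w → Tendsto (fun t => β ^ 2 * memR m a (clamp P) (clampR f) (t + w) t) atTop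
      (𝓝 (β ^ 2 * memRLim m a ff Cf w)) := fun w hw =>
    tendsto_const_nhds.mul (tendsto_memR hr hc hC hA.symm_C hl he hfc' hf' hfl' hw)
  have g2l : ∀ w, 0 ≤ w → Tendsto (fun t => β ^ 2 *
      (I1 m a (clamp P) (t + w) t + I2 m a (clamp P) (t + w) t)) atTop
      (𝓝 (β ^ 2 * (I1Lim m a Rf Cf w + I2Lim m a Rf Cf w))) := fun w hw =>
    tendsto_const_nhds.mul ((tendsto_I1 hr hc hR hC hA.symm_C hl he w).add
      (tendsto_I2 hr hc hR hC hA.symm_C hl he hw))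
  refine ⟨fun τ hτ => ⟨?_, ?_⟩, ?_, ?_⟩
  · exact tendsto_linSol (g := fun s t => β ^ 2 * memR m a (clamp P) (clampR f) s t)
      hμc g1c hμl g1b g1l hτ
  · have := tendsto_linSol
      (g := fun s t => β ^ 2 * (I1 m a (clamp P) s t + I2 m a (clamp P) s t))
      hμc g2c hμl g2b g2l hτ
    refine this.congr fun t => ?_
    simp only [stepMap, stepSol, max_eq_left (by linarith : t ≤ t + τ),
      min_eq_right (by linarith : t ≤ t + τ)]
  · exact continuousOn_limSol (g := fun s t => β ^ 2 * memR m a (clamp P) (clampR f) s t)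
      g1c g1b g1l
  · exact continuousOn_limSol
      (g := fun s t => β ^ 2 * (I1 m a (clamp P) s t + I2 m a (clamp P) s t)) g2c g2b g2l

end MemoryLimits

end SphericalSpinGlass

namespace SphericalSpinGlass

variable {m : ℕ} {a : ℕ → ℝ} {β r : ℝ} {R C f : ℝ → ℝ}

/-! ### The stationary (FDT) equations. -/

section Stationary

theorem mem_BSet_iff : (R, C) ∈ BSet (1 / 6) r 1 2 ↔ R 0 = 1 ∧ C 0 = 1 ∧
    (∀ τ, 0 ≤ C τ ∧ C τ = C (-τ) ∧ C τ ≤ 2 * Real.exp (-(1 / 6) * |τ|)) ∧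
    ∀ τ, 0 ≤ τ → 0 ≤ R τ ∧ R τ ≤ wt r τ * Real.exp (-(1 / 6) * τ) := by
  simp only [BSet, mem_ofPred_eq, one_mul, wt]

theorem BSet.even (h : (R, C) ∈ BSet (1 / 6) r 1 2) (x : ℝ) : C |x| = C x := by
  rcases abs_choice x with e | e
  · rw [e]
  · rw [e, ← ((mem_BSet_iff.1 h).2.2.1 x).2.1]

theorem BSet.C_le_two (h : (R, C) ∈ BSet (1 / 6) r 1 2) (x : ℝ) : C x ≤ 2 := by
  have h1 := ((mem_BSet_iff.1 h).2.2.1 x).2.2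
  have h2 := exp_neg_abs_le_one x
  linarith

theorem BSet.R_le_exp (hr : 0 < r) (h : (R, C) ∈ BSet (1 / 6) r 1 2) {x : ℝ} (hx : 0 ≤ x) :
    |R x| ≤ Real.exp (-(1 / 6) * x) := by
  obtain ⟨h1, h2⟩ := (mem_BSet_iff.1 h).2.2.2 x hx
  rw [abs_of_nonneg h1]
  exact h2.trans (mul_le_of_le_one_left (Real.exp_pos _).le (wt_le_one hr hx))

theorem half_le_muFdt (h : (R, C) ∈ BSet (1 / 6) r 1 2) : 1 / 2 ≤ muFdt m a β 0 R C := by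
  unfold muFdt
  have : 0 ≤ ∫ θ in Ioi (0 : ℝ), psi m a (C θ) * R θ :=
    MeasureTheory.setIntegral_nonneg measurableSet_Ioi fun θ hθ =>
      mul_nonneg (psi_nonneg m a ((mem_BSet_iff.1 h).2.2.1 θ).1)
        ((mem_BSet_iff.1 h).2.2.2 θ (mem_Ioi.1 hθ).le).1
  nlinarith [sq_nonneg β]

theorem hasDerivWithinAt_limSol {μ : ℝ} {g : ℝ → ℝ} (hg : ContinuousOn g (Ici 0)) {τ : ℝ}
    (hτ : 0 ≤ τ) :
    HasDerivWithinAt (limSol μ g) (-μ * limSol μ g τ + g τ) (Ici 0) τ := by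
  set G : ℝ → ℝ := fun w => Real.exp (μ * w) * g (max w 0) with hG
  have hGc : Continuous G := (by fun_prop : Continuous fun w => Real.exp (μ * w)).mul
    (hg.comp_continuous (by fun_prop) fun _ => mem_Ici.2 (le_max_right _ _))
  have e : ∀ x ∈ Ici (0 : ℝ), limSol μ g x =
      Real.exp (-(μ * x)) * (1 + ∫ w in (0 : ℝ)..x, G w) := by
    intro x hx
    simp only [limSol]
    congr 2
    refine intervalIntegral.integral_congr fun w hw => ?_
    rw [uIcc_of_le hx] at hw
    simp only [hG, max_eq_left hw.1]
  have d1 : HasDerivAt (fun x => Real.exp (-(μ * x))) (Real.exp (-(μ * τ)) * -(μ * 1)) τ :=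
    ((hasDerivAt_id τ).const_mul μ).neg.exp
  have d2 := (hGc.integral_hasStrictDerivAt 0 τ).hasDerivAt.const_add 1
  refine ((d1.mul d2).hasDerivWithinAt.congr e (e τ hτ)).congr_deriv ?_
  rw [e τ hτ]
  have e1 : Real.exp (-(μ * τ)) * Real.exp (μ * τ) = 1 := by rw [← Real.exp_add]; simp
  simp only [hG, max_eq_left hτ]
  linear_combination (g τ) * e1

theorem continuousOn_memRLim (hf : ContinuousOn f (Ici 0)) (hC : Continuous C) :
    ContinuousOn (memRLim m a f C) (Ici 0) := by
  have hf' : Continuous fun x => f (max x 0) :=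
    hf.comp_continuous (by fun_prop) fun _ => mem_Ici.2 (le_max_right _ _)
  have hc : Continuous fun w => ∫ θ in (0 : ℝ)..w,
      f (max (w - θ) 0) * f (max θ 0) * nu2 m a (C θ) := by
    refine continuous_parametric_integral ?_ continuous_const continuous_id
    exact ((hf'.comp (by fun_prop : Continuous fun p : ℝ × ℝ => p.1 - p.2)).mul
      (hf'.comp continuous_snd)).mul (((continuous_nu2 m a).comp hC).comp continuous_snd)
  refine hc.continuousOn.congr fun w hw => intervalIntegral.integral_congr fun θ hθ => ?_
  rw [uIcc_of_le hw] at hθ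
  simp only [max_eq_left hθ.1, max_eq_left (sub_nonneg.2 hθ.2)]

theorem aestronglyMeasurable_R (hRc : ContinuousOn R (Ici 0)) :
    MeasureTheory.AEStronglyMeasurable R (MeasureTheory.volume.restrict (Ioi 0)) :=
  (hRc.mono Ioi_subset_Ici_self).aestronglyMeasurable measurableSet_Ioi

theorem continuous_I1Lim (hr : 0 < r) (hB : (R, C) ∈ BSet (1 / 6) r 1 2)
    (hRc : ContinuousOn R (Ici 0)) (hC : Continuous C) : Continuous (I1Lim m a R C) := by
  have hK := nu2_nonneg m a (x := 2) (by norm_num)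
  refine MeasureTheory.continuous_of_dominated
    (bound := fun θ => 2 * nu2 m a 2 * Real.exp (-(1 / 6) * θ)) (fun w => ?_) (fun w => ?_)
    ((exp_neg_integrableOn_Ioi 0 (by norm_num)).const_mul _) (Eventually.of_forall fun θ => ?_)
  · exact (((hC.comp (by fun_prop : Continuous fun θ => w - θ)).aestronglyMeasurable).mul
      (aestronglyMeasurable_R hRc)).mul ((continuous_nu2 m a).comp hC).aestronglyMeasurable
  · filter_upwards [MeasureTheory.ae_restrict_mem measurableSet_Ioi] with θ hθ
    have c := ((mem_BSet_iff.1 hB).2.2.1 θ).1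
    have c' := ((mem_BSet_iff.1 hB).2.2.1 (w - θ)).1
    rw [norm_mul, norm_mul]
    refine (mul_le_mul (mul_le_mul (?_ : ‖C (w - θ)‖ ≤ 2) (BSet.R_le_exp hr hB (mem_Ioi.1 hθ).le)
      (abs_nonneg _) zero_le_two) (?_ : ‖nu2 m a (C θ)‖ ≤ nu2 m a 2) (abs_nonneg _)
      (by positivity)).trans (le_of_eq (by ring))
    · rw [Real.norm_of_nonneg c']; exact BSet.C_le_two hB _
    · rw [Real.norm_of_nonneg (nu2_nonneg m a c)]
      exact nu2_mono m a c (BSet.C_le_two hB _)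
  · exact ((hC.comp (by fun_prop : Continuous fun w => w - θ)).mul continuous_const).mul
      continuous_const

/-- Shifting the variable frees the domain from `w`, as dominated convergence in the parameter
requires. -/
theorem I2Lim_eq (w : ℝ) :
    I2Lim m a R C w = ∫ θ in Ioi (0 : ℝ), nu1 m a (C (θ + w)) * R θ := by
  unfold I2Lim
  rw [← MeasureTheory.integral_indicator measurableSet_Ioi,
    ← MeasureTheory.integral_indicator measurableSet_Ioi,
    ← MeasureTheory.integral_sub_right_eq_self
      ((Ioi (0 : ℝ)).indicator fun θ => nu1 m a (C (θ + w)) * R θ) w]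
  congr 1
  ext θ
  by_cases h : w < θ
  · rw [indicator_of_mem (mem_Ioi.2 h), indicator_of_mem (mem_Ioi.2 (sub_pos.2 h)),
      sub_add_cancel]
  · rw [indicator_of_notMem (by simpa using h), indicator_of_notMem (by simpa using h)]

theorem continuous_I2Lim (hr : 0 < r) (hB : (R, C) ∈ BSet (1 / 6) r 1 2)
    (hRc : ContinuousOn R (Ici 0)) (hC : Continuous C) : Continuous (I2Lim m a R C) := by
  have hK := nu2_nonneg m a (x := 2) (by norm_num)
  simp only [funext (I2Lim_eq (m := m) (a := a) (R := R) (C := C))]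
  refine MeasureTheory.continuous_of_dominated
    (bound := fun θ => nu2 m a 2 * 2 * Real.exp (-(1 / 6) * θ)) (fun w => ?_) (fun w => ?_)
    ((exp_neg_integrableOn_Ioi 0 (by norm_num)).const_mul _) (Eventually.of_forall fun θ => ?_)
  · exact (((continuous_nu1 m a).comp
      (hC.comp (by fun_prop : Continuous fun θ => θ + w))).aestronglyMeasurable).mul
      (aestronglyMeasurable_R hRc)
  · filter_upwards [MeasureTheory.ae_restrict_mem measurableSet_Ioi] with θ hθ
    have c := ((mem_BSet_iff.1 hB).2.2.1 (θ + w)).1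
    rw [norm_mul]
    refine mul_le_mul ?_ (BSet.R_le_exp hr hB (mem_Ioi.1 hθ).le) (abs_nonneg _) (by positivity)
    rw [Real.norm_of_nonneg (nu1_nonneg m a c)]
    refine (nu1_le_mul_two m a c (BSet.C_le_two hB _)).trans ?_
    exact mul_le_mul_of_nonneg_left (BSet.C_le_two hB _) hK
  · exact ((continuous_nu1 m a).comp (hC.comp (by fun_prop : Continuous fun w => θ + w))).mul
      continuous_const

theorem continuous_of_even (he : ∀ x, C |x| = C x) (hC : ContinuousOn C (Ici 0)) :
    Continuous C := by
  have : Continuous fun x => C |x| := hC.comp_continuous continuous_abs fun x => abs_nonneg x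
  simpa only [he] using this

theorem fdtStep_deriv (hr : 0 < r) (hB : (R, C) ∈ BSet (1 / 6) r 1 2)
    (hRc : ContinuousOn R (Ici 0)) (hC : Continuous C) {τ : ℝ} (hτ : 0 ≤ τ) :
    HasDerivWithinAt (fdtStep m a β R C R).1 (-(muFdt m a β 0 R C) * (fdtStep m a β R C R).1 τ +
        β ^ 2 * memRLim m a R C τ) (Ici 0) τ ∧
    HasDerivWithinAt (fdtStep m a β R C R).2 (-(muFdt m a β 0 R C) * (fdtStep m a β R C R).2 τ +
        β ^ 2 * (I1Lim m a R C τ + I2Lim m a R C τ)) (Ici 0) τ :=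
  ⟨hasDerivWithinAt_limSol (g := fun w => β ^ 2 * memRLim m a R C w)
      (continuousOn_const.mul (continuousOn_memRLim hRc hC)) hτ,
    hasDerivWithinAt_limSol (g := fun w => β ^ 2 * (I1Lim m a R C w + I2Lim m a R C w))
      (continuous_const.mul
        ((continuous_I1Lim hr hB hRc hC).add (continuous_I2Lim hr hB hRc hC))).continuousOn hτ⟩

theorem isFdtSolution_of_fixed (hr : 0 < r) (hB : (R, C) ∈ BSet (1 / 6) r 1 2)
    (hRc : ContinuousOn R (Ici 0)) (hC : Continuous C)
    (h1 : ∀ τ, 0 ≤ τ → R τ = (fdtStep m a β R C R).1 τ)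
    (h2 : ∀ τ, 0 ≤ τ → C τ = (fdtStep m a β R C R).2 τ) : IsFdtSolution m a β 0 R C where
  eq_R τ hτ := by
    have := (fdtStep_deriv (m := m) (a := a) (β := β) hr hB hRc hC hτ).1
    rw [← h1 τ hτ] at this
    exact this.congr h1 (h1 τ hτ)
  eq_C τ hτ := by
    have := (fdtStep_deriv (m := m) (a := a) (β := β) hr hB hRc hC hτ).2
    rw [← h2 τ hτ] at this
    refine (this.congr h2 (h2 τ hτ)).congr_deriv ?_
    simp only [I1Lim, I2Lim]
    ring

/-- A solution and its image under `fdtStep` obey linear equations with the same damping and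
forcing, both computed from `(R, C)`. Their difference starts at 0 and solves the homogeneous
equation. Continuity is read off from differentiability. -/
theorem IsFdtSolution.fixed (hr : 0 < r) (hB : (R, C) ∈ BSet (1 / 6) r 1 2)
    (h : IsFdtSolution m a β 0 R C) :
    ContinuousOn R (Ici 0) ∧ Continuous C ∧
      (∀ τ, 0 ≤ τ → R τ = (fdtStep m a β R C R).1 τ) ∧
      ∀ τ, 0 ≤ τ → C τ = (fdtStep m a β R C R).2 τ := by
  have hRc : ContinuousOn R (Ici 0) := fun τ hτ => (h.eq_R τ hτ).continuousWithinAt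
  have hCc : Continuous C := continuous_of_even (BSet.even hB)
    fun τ hτ => (h.eq_C τ hτ).continuousWithinAt
  have hμ : ∀ s : ℝ, 0 ≤ s → 1 / 2 ≤ muFdt m a β 0 R C := fun _ _ => half_le_muFdt hB
  have e : ∀ {x y : ℝ}, |x - y| ≤ 0 → x = y := fun h =>
    sub_eq_zero.1 (abs_eq_zero.1 (le_antisymm h (abs_nonneg _)))
  obtain ⟨hR0, hC0, -⟩ := mem_BSet_iff.1 hB
  refine ⟨hRc, hCc, fun τ hτ => e ?_, fun τ hτ => e ?_⟩
  · refine abs_le_of_linear_ode (h := fun s => R s - (fdtStep m a β R C R).1 s)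
      (μ := fun _ => muFdt m a β 0 R C) (g := fun _ => 0) (fun s hs => ?_) hμ
      (by simp [fdtStep, limSol, hR0]) (fun s _ => by simp) τ hτ
    refine ((h.eq_R s hs).sub (fdtStep_deriv (m := m) (a := a) (β := β) hr hB hRc hCc hs).1
      ).congr_deriv ?_
    simp only [memRLim]
    ring
  · refine abs_le_of_linear_ode (h := fun s => C s - (fdtStep m a β R C R).2 s)
      (μ := fun _ => muFdt m a β 0 R C) (g := fun _ => 0) (fun s hs => ?_) hμ
      (by simp [fdtStep, limSol, hC0]) (fun s _ => by simp) τ hτ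
    refine ((h.eq_C s hs).sub (fdtStep_deriv (m := m) (a := a) (β := β) hr hB hRc hCc hs).2
      ).congr_deriv ?_
    simp only [I1Lim, I2Lim]
    ring

/-- The two-time functions built from a stationary pair. -/
def stationary (R C : ℝ → ℝ) : TwoTime := (fun s t => R (s - t), fun s t => C (s - t))

/-- Any continuous pair in `ℬ` is realised as limits of a pair in `𝒜`. This gives the starting point
for iterations in `LimSet`. -/
theorem stationary_mem_LimSet (hB : (R, C) ∈ BSet (1 / 6) r 1 2)
    (hRc : ContinuousOn R (Ici 0)) (hC : Continuous C) : stationary R C ∈ LimSet r R C := by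
  obtain ⟨hR0, hC0, hCb, hRb⟩ := mem_BSet_iff.1 hB
  refine ⟨mem_ASet_iff.2 ⟨⟨?_, ?_, fun t _ => by simp [stationary, hR0],
    fun t _ => by simp [stationary, hC0], fun s t _ _ => ?_⟩,
    fun s t _ hs => hRb _ (sub_nonneg.2 hs), fun s t _ _ => ⟨(hCb _).1, (hCb _).2.2⟩⟩,
    fun τ _ => by simp [stationary]⟩
  · exact hRc.comp (by fun_prop : ContinuousOn (fun p : ℝ × ℝ => p.1 - p.2) Gam)
      fun p hp => mem_Ici.2 (sub_nonneg.2 hp.2)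
  · exact (hC.comp (by fun_prop : Continuous fun p : ℝ × ℝ => p.1 - p.2)).continuousOn
  · change C (s - t) = C (t - s)
    rw [(hCb (s - t)).2.1, neg_sub]

end Stationary

end SphericalSpinGlass

namespace SphericalSpinGlass

variable {m : ℕ} {a : ℕ → ℝ} {β r L : ℝ} {P P' Q Q' P₁ P₂ Q₁ Q₂ : TwoTime} {Rf Cf : ℝ → ℝ}

/-! ### Existence, contraction and identification of the limits. -/

section Solutions

theorem near_two_of_mem (hr : 0 < r) (hP : P ∈ ASet (1 / 6) r 1 2)
    (hQ : Q ∈ ASet (1 / 6) r 1 2) : Near P Q 2 := by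
  obtain ⟨-, h1, h2⟩ := mem_ASet_iff.1 hP
  obtain ⟨-, h3, h4⟩ := mem_ASet_iff.1 hQ
  refine ⟨fun s t ht hs => abs_le.2 ?_, fun s t hs ht => abs_le.2 ?_⟩
  · have a1 := (h1 s t ht hs).1
    have a2 := h1.le_one hr ht hs
    have a3 := (h3 s t ht hs).1
    have a4 := h3.le_one hr ht hs
    constructor <;> linarith
  · have a1 := (h2 s t hs ht).1
    have a2 := h2.le_two hs ht
    have a3 := (h4 s t hs ht).1
    have a4 := h4.le_two hs ht
    constructor <;> linarith

theorem near_zero (P : TwoTime) : Near P P 0 :=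
  ⟨fun _ _ _ _ => by simp, fun _ _ _ _ => by simp⟩

theorem isStep_stepMap_of_mem (hP : P ∈ ASet (1 / 6) r 1 2) (hQ : Q ∈ ASet (1 / 6) r 1 2) :
    IsStep m a β P Q.1 (stepMap m a β P Q.1) :=
  isStep_stepMap (mem_ASet_iff.1 hP).1 (mem_ASet_iff.1 hQ).1.continuous_R

theorem stepMap_mem_ASet (hr : 0 < r) (hr' : r ≤ 1 / 300) (hβ : β ^ 2 * nu2 m a 2 = r ^ 2)
    (hP : P ∈ ASet (1 / 6) r 1 2) (hQ : Q ∈ ASet (1 / 6) r 1 2) :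
    stepMap m a β P Q.1 ∈ ASet (1 / 6) r 1 2 :=
  (isStep_stepMap_of_mem hP hQ).mem_ASet hr hr' hβ hP (mem_ASet_iff.1 hQ).1.continuous_R
    (mem_ASet_iff.1 hQ).2.1

/-- `HasFdtLimits` leaves negative lags free, so `C_fdt` may be replaced by its even extension. -/
theorem exists_mem_LimSet_of_mem_SSet (hP : P ∈ SSet (1 / 6) r 1 2) :
    ∃ Rf Cf : ℝ → ℝ, P ∈ LimSet r Rf Cf ∧ ∀ x, Cf |x| = Cf x := by
  obtain ⟨hA, Rf, Cf, h⟩ := hP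
  refine ⟨Rf, fun x => Cf |x|, ⟨hA, fun τ hτ => ?_⟩, fun x => by simp⟩
  simp only [abs_of_nonneg hτ]
  exact h τ hτ

theorem stepMap_mem_SSet (hr : 0 < r) (hr' : r ≤ 1 / 300) (hβ : β ^ 2 * nu2 m a 2 = r ^ 2)
    (hP : P ∈ SSet (1 / 6) r 1 2) (hQ : Q ∈ SSet (1 / 6) r 1 2) :
    stepMap m a β P Q.1 ∈ SSet (1 / 6) r 1 2 := by
  obtain ⟨Rf, Cf, hl, he⟩ := exists_mem_LimSet_of_mem_SSet hP
  obtain ⟨hQA, ff, _, hQl⟩ := hQ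
  obtain ⟨hQa, hQb, -⟩ := mem_ASet_iff.1 hQA
  exact ⟨stepMap_mem_ASet hr hr' hβ hP.1 hQA, _, _,
    (hasFdtLimits_stepMap hr hβ hl he hQa.continuous_R hQb fun τ hτ => (hQl τ hτ).1).1⟩

theorem isPsi_of_agree_stepMap (hP : P ∈ ASet (1 / 6) r 1 2) (hQ : Q ∈ ASet (1 / 6) r 1 2)
    (h : Agree (stepMap m a β P Q.1) Q) : IsPsi m a β P Q :=
  isPsi_iff_isStep.2 ((isStep_stepMap_of_mem hP hQ).congr (agree_refl P) (fun _ _ _ _ => rfl) h)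

/-- Existence of the image of `P` under `Ψ` in a closed set invariant under the linearised map. -/
theorem exists_isPsi_mem (hr : 0 < r) (hr' : r ≤ 1 / 300) (hβ : β ^ 2 * nu2 m a 2 = r ^ 2)
    (hP : P ∈ ASet (1 / 6) r 1 2) {K : Set TwoTime} (hKA : K ⊆ ASet (1 / 6) r 1 2)
    (hK : UnifClosed K) (hT : ∀ Q ∈ K, stepMap m a β P Q.1 ∈ K) (hQ : Q ∈ K) :
    ∃ Q ∈ K, IsPsi m a β P Q := by
  obtain ⟨L, hL⟩ := exists_lipBound m a
  -- Since `P` is fixed, only the `1/4` of `IsStep.near` enters, and no smallness of `β² L` is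
  -- needed.
  obtain ⟨S, hS, h⟩ := exists_agree_fixed (T := fun Q => stepMap m a β P Q.1) hT hK
    (fun Q₁ h₁ Q₂ h₂ ε hε => by
      obtain ⟨a₁, b₁, -⟩ := mem_ASet_iff.1 (hKA h₁)
      obtain ⟨a₂, b₂, -⟩ := mem_ASet_iff.1 (hKA h₂)
      have hε0 : 0 ≤ ε := (abs_nonneg _).trans (hε.1 0 0 le_rfl le_rfl)
      exact (IsStep.near hL hr hr' hβ hP hP a₁.continuous_R b₁ a₂.continuous_R b₂
        (isStep_stepMap_of_mem hP (hKA h₁)) (isStep_stepMap_of_mem hP (hKA h₂)) (near_zero P)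
        hε.1).mono (by rw [mul_zero, mul_zero]; linarith))
    hQ (near_two_of_mem hr (hKA hQ) (hKA (hT Q hQ)))
  exact ⟨S, hS, isPsi_of_agree_stepMap hP (hKA hS) h⟩

theorem psiMapsTo_ASet (hr : 0 < r) (hr' : r ≤ 1 / 300) (hβ : β ^ 2 * nu2 m a 2 = r ^ 2) :
    PsiMapsTo m a β (ASet (1 / 6) r 1 2) (ASet (1 / 6) r 1 2) := by
  intro P hP
  obtain ⟨Q, hQ, h⟩ := exists_isPsi_mem hr hr' hβ hP subset_rfl unifClosed_ASet
    (fun Q hQ => stepMap_mem_ASet hr hr' hβ hP hQ) hP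
  exact ⟨Q, hQ, h, fun Q' h' => h'.agree (mem_ASet_iff.1 hP).1 h⟩

theorem psiMapsTo_SSet (hr : 0 < r) (hr' : r ≤ 1 / 300) (hβ : β ^ 2 * nu2 m a 2 = r ^ 2) :
    PsiMapsTo m a β (SSet (1 / 6) r 1 2) (SSet (1 / 6) r 1 2) := by
  intro P hP
  obtain ⟨Q, hQ, h⟩ := exists_isPsi_mem hr hr' hβ hP.1 (fun _ h => h.1) unifClosed_SSet
    (fun Q hQ => stepMap_mem_SSet hr hr' hβ hP hQ) hP
  exact ⟨Q, hQ, h, fun Q' h' => h'.agree (mem_ASet_iff.1 hP.1).1 h⟩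

/-- Existence of a fixed point of `Ψ` in an invariant closed set. -/
theorem exists_fixed_mem (hr : 0 < r) (hr' : r ≤ 1 / 300) (hβ : β ^ 2 * nu2 m a 2 = r ^ 2)
    (hL : LipBound m a L) (hβL : 432 * (β ^ 2 * L) ≤ 1 / 16)
    {K : Set TwoTime} (hKA : K ⊆ ASet (1 / 6) r 1 2)
    (hK : UnifClosed K) (hT : ∀ Q ∈ K, stepMap m a β Q Q.1 ∈ K) (hQ : Q ∈ K) :
    ∃ Q ∈ K, IsPsi m a β Q Q ∧ Agree (stepMap m a β Q Q.1) Q := by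
  -- Both arguments now move, with total ratio `1/4 + 1/16 ≤ 1/2`.
  obtain ⟨S, hS, h⟩ := exists_agree_fixed (T := fun Q => stepMap m a β Q Q.1) hT hK
    (fun Q₁ h₁ Q₂ h₂ ε hε => by
      obtain ⟨a₁, b₁, -⟩ := mem_ASet_iff.1 (hKA h₁)
      obtain ⟨a₂, b₂, -⟩ := mem_ASet_iff.1 (hKA h₂)
      have hε0 : 0 ≤ ε := (abs_nonneg _).trans (hε.1 0 0 le_rfl le_rfl)
      exact (IsStep.near hL hr hr' hβ (hKA h₁) (hKA h₂) a₁.continuous_R b₁ a₂.continuous_R b₂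
        (isStep_stepMap_of_mem (hKA h₁) (hKA h₁)) (isStep_stepMap_of_mem (hKA h₂) (hKA h₂)) hε
        hε.1).mono (by nlinarith))
    hQ (near_two_of_mem hr (hKA hQ) (hKA (hT Q hQ)))
  exact ⟨S, hS, isPsi_of_agree_stepMap (hKA hS) (hKA hS) h, h⟩

theorem near_iSup (h : ∃ D, Near P Q D) :
    Near P Q (udist P Q) ∧ NearR P.1 Q.1 (⨆ p : Gam, |P.1 p.1.1 p.1.2 - Q.1 p.1.1 p.1.2|) := by
  obtain ⟨D, hD⟩ := h
  have b1 : BddAbove (range fun p : Gam => |P.1 p.1.1 p.1.2 - Q.1 p.1.1 p.1.2|) :=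
    ⟨D, by rintro _ ⟨p, rfl⟩; exact hD.1 _ _ p.2.1 p.2.2⟩
  have b2 : BddAbove (range fun p : Quad => |P.2 p.1.1 p.1.2 - Q.2 p.1.1 p.1.2|) :=
    ⟨D, by rintro _ ⟨p, rfl⟩; exact hD.2 _ _ p.2.1 p.2.2⟩
  have h1 : NearR P.1 Q.1 (⨆ p : Gam, |P.1 p.1.1 p.1.2 - Q.1 p.1.1 p.1.2|) :=
    fun s t ht hs => le_ciSup b1 (⟨(s, t), ht, hs⟩ : Gam)
  have n1 : 0 ≤ ⨆ p : Gam, |P.1 p.1.1 p.1.2 - Q.1 p.1.1 p.1.2| :=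
    Real.iSup_nonneg fun _ => abs_nonneg _
  have n2 : 0 ≤ ⨆ p : Quad, |P.2 p.1.1 p.1.2 - Q.2 p.1.1 p.1.2| :=
    Real.iSup_nonneg fun _ => abs_nonneg _
  refine ⟨⟨fun s t ht hs => (h1 s t ht hs).trans (le_add_of_nonneg_right n2),
    fun s t hs ht => ?_⟩, h1⟩
  exact (le_ciSup b2 (⟨(s, t), hs, ht⟩ : Quad)).trans (le_add_of_nonneg_left n1)

theorem psiContracts_ASet (hr : 0 < r) (hr' : r ≤ 1 / 300) (hβ : β ^ 2 * nu2 m a 2 = r ^ 2)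
    (hL : LipBound m a L) (hβL : 432 * (β ^ 2 * L) ≤ 1 / 16) :
    PsiContracts m a β (ASet (1 / 6) r 1 2) := by
  refine ⟨psiMapsTo_ASet hr hr' hβ, 1 / 2, by norm_num, by norm_num,
    fun P₁ hP₁ P₂ hP₂ Q₁ Q₂ h₁ h₂ => ?_⟩
  -- An arbitrary image satisfies the bounds because it agrees with the one constructed in `𝒜`.
  have mem : ∀ {P Q}, P ∈ ASet (1 / 6) r 1 2 → IsPsi m a β P Q → Q ∈ ASet (1 / 6) r 1 2 := by
    intro P Q hP h
    obtain ⟨S, hS, -, hu⟩ := psiMapsTo_ASet (m := m) (a := a) hr hr' hβ P hP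
    exact mem_ASet_congr hS (hu Q h).symm
  have hQ₁ := mem hP₁ h₁
  have hQ₂ := mem hP₂ h₂
  obtain ⟨a₁, b₁, -⟩ := mem_ASet_iff.1 hQ₁
  obtain ⟨a₂, b₂, -⟩ := mem_ASet_iff.1 hQ₂
  have key := IsStep.near hL hr hr' hβ hP₁ hP₂ a₁.continuous_R b₁ a₂.continuous_R b₂
    (isPsi_iff_isStep.1 h₁) (isPsi_iff_isStep.1 h₂)
    (near_iSup ⟨2, near_two_of_mem hr hP₁ hP₂⟩).1
    (near_iSup ⟨2, near_two_of_mem hr hQ₁ hQ₂⟩).2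
  have hd : 0 ≤ udist P₁ P₂ := (abs_nonneg _).trans
    ((near_iSup ⟨2, near_two_of_mem hr hP₁ hP₂⟩).1.1 0 0 le_rfl le_rfl)
  have : Nonempty Gam := ⟨⟨(0, 0), le_rfl, le_rfl⟩⟩
  have : Nonempty Quad := ⟨⟨(0, 0), le_rfl, le_rfl⟩⟩
  set η := ⨆ p : Gam, |Q₁.1 p.1.1 p.1.2 - Q₂.1 p.1.1 p.1.2| with hη
  -- `Ψ` is implicit, so `η` occurs on both sides. Absorbing it bounds `η` by `1/12` of the distance
  -- of the data. The correlations obey the same bound, and the total ratio `1/6` is below the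
  -- claimed `1/2`.
  have k1 : η ≤ η / 4 + 432 * (β ^ 2 * L * udist P₁ P₂) :=
    ciSup_le fun p => key.1 _ _ p.2.1 p.2.2
  have k2 : (⨆ p : Quad, |Q₁.2 p.1.1 p.1.2 - Q₂.2 p.1.1 p.1.2|) ≤
      η / 4 + 432 * (β ^ 2 * L * udist P₁ P₂) :=
    ciSup_le fun p => key.2 _ _ p.2.1 p.2.2
  have k3 : 432 * (β ^ 2 * L * udist P₁ P₂) ≤ 1 / 16 * udist P₁ P₂ := by
    have := mul_le_mul_of_nonneg_right hβL hd
    linarith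
  have e : udist Q₁ Q₂ = η + ⨆ p : Quad, |Q₁.2 p.1.1 p.1.2 - Q₂.2 p.1.1 p.1.2| := rfl
  rw [e]
  linarith

/-- The stationary pair formed from the decay bounds themselves serves, with `C` at half its bound
so that it equals 1 on the diagonal. -/
theorem SSet_nonempty (hr : 0 < r) : (SSet (1 / 6) r 1 2).Nonempty := by
  set R : ℝ → ℝ := fun x => wt r (max x 0) * Real.exp (-(1 / 6) * x)
  set C : ℝ → ℝ := fun x => Real.exp (-(1 / 6) * |x|)
  have hB : (R, C) ∈ BSet (1 / 6) r 1 2 := by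
    refine mem_BSet_iff.2 ⟨by simp [R, wt_zero], by simp [C],
      fun τ => ⟨(Real.exp_pos _).le, by simp [C], ?_⟩, fun τ hτ => ⟨?_, ?_⟩⟩
    · have : 0 < Real.exp (-(1 / 6) * |τ|) := Real.exp_pos _
      simp only [C]
      linarith
    · exact mul_nonneg (wt_pos hr (le_max_right _ _)).le (Real.exp_pos _).le
    · simp only [R, max_eq_left hτ, le_refl]
  have hR : Continuous R := ((continuousOn_wt hr).comp_continuous (by fun_prop)
    fun _ => mem_Ici.2 (le_max_right _ _)).mul (by fun_prop)
  have h := stationary_mem_LimSet hB hR.continuousOn (by fun_prop : Continuous C)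
  exact ⟨_, h.1, R, C, h.2⟩

theorem mem_BSet_of_mem_LimSet (h : P ∈ LimSet r Rf Cf) (he : ∀ x, Cf |x| = Cf x) :
    (Rf, Cf) ∈ BSet (1 / 6) r 1 2 := by
  obtain ⟨hA, hl⟩ := h
  obtain ⟨hP, hR, hC⟩ := mem_ASet_iff.1 hA
  have c0 : ∀ τ, 0 ≤ τ → 0 ≤ Cf τ ∧ Cf τ ≤ 2 * Real.exp (-(1 / 6) * |τ|) := by
    intro τ hτ
    refine ⟨ge_of_tendsto (hl τ hτ).2 ?_, le_of_tendsto (hl τ hτ).2 ?_⟩ <;>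
      filter_upwards [eventually_ge_atTop 0] with t ht
    · exact (hC _ _ (by linarith) ht).1
    · simpa using (hC (t + τ) t (by linarith) ht).2
  refine mem_BSet_iff.2 ⟨?_, ?_, fun τ => ⟨?_, ?_, ?_⟩, fun τ hτ => ⟨?_, ?_⟩⟩
  · refine tendsto_nhds_unique (hl 0 le_rfl).1 (tendsto_const_nhds.congr' ?_)
    filter_upwards [eventually_ge_atTop 0] with t ht
    rw [add_zero, hP.diag_R t ht]
  · refine tendsto_nhds_unique (hl 0 le_rfl).2 (tendsto_const_nhds.congr' ?_)
    filter_upwards [eventually_ge_atTop 0] with t ht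
    rw [add_zero, hP.diag_C t ht]
  · rw [← he]; exact (c0 _ (abs_nonneg τ)).1
  · rw [← he, ← he (-τ), abs_neg]
  · rw [← he]; simpa using (c0 _ (abs_nonneg τ)).2
  · refine ge_of_tendsto (hl τ hτ).1 ?_
    filter_upwards [eventually_ge_atTop 0] with t ht
    exact (hR _ _ ht (by linarith)).1
  · refine le_of_tendsto (hl τ hτ).1 ?_
    filter_upwards [eventually_ge_atTop 0] with t ht
    simpa using (hR (t + τ) t ht (by linarith)).2

/-- The limits of a fixed point of the step map are fixed by `fdtStep`, by uniqueness of limits.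
They are then continuous, so the integral identity can be differentiated. -/
theorem isFdtSolution_of_agree (hr : 0 < r) (hβ : β ^ 2 * nu2 m a 2 = r ^ 2)
    (h : P ∈ LimSet r Rf Cf) (he : ∀ x, Cf |x| = Cf x) (hP : Agree (stepMap m a β P P.1) P) :
    IsFdtSolution m a β 0 Rf Cf := by
  obtain ⟨hA, hl⟩ := h
  obtain ⟨ha, hR, -⟩ := mem_ASet_iff.1 hA
  obtain ⟨h1, h2, h3⟩ := hasFdtLimits_stepMap (m := m) (a := a) (f := P.1) (ff := Rf) hr hβ
    ⟨hA, hl⟩ he ha.continuous_R hR fun τ hτ => (hl τ hτ).1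
  replace h1 := h1.congr hP
  have e1 : ∀ τ, 0 ≤ τ → Rf τ = (fdtStep m a β Rf Cf Rf).1 τ := fun τ hτ =>
    tendsto_nhds_unique (hl τ hτ).1 (h1 τ hτ).1
  have e2 : ∀ τ, 0 ≤ τ → Cf τ = (fdtStep m a β Rf Cf Rf).2 τ := fun τ hτ =>
    tendsto_nhds_unique (hl τ hτ).2 (h1 τ hτ).2
  exact isFdtSolution_of_fixed hr (mem_BSet_of_mem_LimSet ⟨hA, hl⟩ he) (h2.congr e1)
    (continuous_of_even he (h3.congr e2)) e1 e2

/-- The step map moves the limits by `fdtStep`, which fixes an FDT solution. -/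
theorem stepMap_mem_LimSet (hr : 0 < r) (hr' : r ≤ 1 / 300) (hβ : β ^ 2 * nu2 m a 2 = r ^ 2)
    (hB : (Rf, Cf) ∈ BSet (1 / 6) r 1 2) (h : IsFdtSolution m a β 0 Rf Cf)
    (hP : P ∈ LimSet r Rf Cf) : stepMap m a β P P.1 ∈ LimSet r Rf Cf := by
  obtain ⟨ha, hR, -⟩ := mem_ASet_iff.1 hP.1
  obtain ⟨-, -, e1, e2⟩ := h.fixed hr hB
  have hl := (hasFdtLimits_stepMap (m := m) (a := a) hr hβ hP (BSet.even hB) ha.continuous_R hR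
    fun τ hτ => (hP.2 τ hτ).1).1
  refine ⟨stepMap_mem_ASet hr hr' hβ hP.1 hP.1, fun τ hτ => ?_⟩
  rw [e1 τ hτ, e2 τ hτ]
  exact hl τ hτ

end Solutions

end SphericalSpinGlass

theorem proposition4p2 :
    ∃ c₁ : ℝ, 0 < c₁ ∧ ∃ M₁ : ℝ, 2 ≤ M₁ ∧
    ∀ (m : ℕ) (a : ℕ → ℝ), 2 ≤ m → a m ≠ 0 →
      -- the constants `δ = 1/6`, `ρ = c₁`, `c = 2`, `r = r(β)` make `𝒜` and `𝒮` invariant under `Ψ`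
      (∀ β : ℝ, 0 < β → SphericalSpinGlass.rate m a β ≤ 1 / (3 * M₁) →
        SphericalSpinGlass.PsiMapsTo m a β
          (SphericalSpinGlass.ASet (1 / 6) (SphericalSpinGlass.rate m a β) c₁ 2)
          (SphericalSpinGlass.ASet (1 / 6) (SphericalSpinGlass.rate m a β) c₁ 2) ∧
        SphericalSpinGlass.PsiMapsTo m a β
          (SphericalSpinGlass.SSet (1 / 6) (SphericalSpinGlass.rate m a β) c₁ 2)
          (SphericalSpinGlass.SSet (1 / 6) (SphericalSpinGlass.rate m a β) c₁ 2)) ∧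
      ∃ β₁ : ℝ, 0 < β₁ ∧ ∀ β : ℝ, 0 < β → β < β₁ →
        SphericalSpinGlass.rate m a β ≤ 1 / (3 * M₁) ∧
        -- `Ψ` is a contraction on `𝒜`
        SphericalSpinGlass.PsiContracts m a β
          (SphericalSpinGlass.ASet (1 / 6) (SphericalSpinGlass.rate m a β) c₁ 2) ∧
        -- the spherical equations have exactly one solution
        ∃ P : SphericalSpinGlass.TwoTime,
          SphericalSpinGlass.IsSphericalSolution m a β P ∧
          (∀ P', SphericalSpinGlass.IsSphericalSolution m a β P' →
            SphericalSpinGlass.Agree P' P) ∧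
          -- it is the unique fixed point of `Ψ` in `𝒮`
          P ∈ SphericalSpinGlass.SSet (1 / 6) (SphericalSpinGlass.rate m a β) c₁ 2 ∧
          SphericalSpinGlass.IsPsi m a β P P ∧
          (∀ P' ∈ SphericalSpinGlass.SSet (1 / 6) (SphericalSpinGlass.rate m a β) c₁ 2,
            SphericalSpinGlass.IsPsi m a β P' P' → SphericalSpinGlass.Agree P' P) ∧
          -- its limits form the unique solution in `ℬ` of the FDT equations with `I = 0`
          ∃ Rf Cf : ℝ → ℝ,
            SphericalSpinGlass.HasFdtLimits P Rf Cf ∧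
            (Rf, Cf) ∈ SphericalSpinGlass.BSet (1 / 6) (SphericalSpinGlass.rate m a β) c₁ 2 ∧
            SphericalSpinGlass.IsFdtSolution m a β 0 Rf Cf ∧
            ∀ R C : ℝ → ℝ,
              (R, C) ∈ SphericalSpinGlass.BSet (1 / 6) (SphericalSpinGlass.rate m a β) c₁ 2 →
              SphericalSpinGlass.IsFdtSolution m a β 0 R C →
              (∀ τ, 0 ≤ τ → R τ = Rf τ) ∧ ∀ τ, C τ = Cf τ := by
  -- The value `M₁ = 100` turns the condition on the rate into `r ≤ 1/300`. It is not sharp.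
  refine ⟨1, one_pos, 100, by norm_num, fun m a hm ha => ?_⟩
  have hν := SphericalSpinGlass.nu2_two_pos m a hm ha
  have hsq := Real.sqrt_pos.2 hν
  have hrate : ∀ β : ℝ, 0 < β → 0 < SphericalSpinGlass.rate m a β ∧
      β ^ 2 * SphericalSpinGlass.nu2 m a 2 = SphericalSpinGlass.rate m a β ^ 2 := fun β hβ => by
    refine ⟨mul_pos hβ hsq, ?_⟩
    rw [SphericalSpinGlass.rate, mul_pow, Real.sq_sqrt hν.le]
  refine ⟨fun β hβ hr' => ?_, ?_⟩
  · obtain ⟨hr, hβr⟩ := hrate β hβ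
    replace hr' : SphericalSpinGlass.rate m a β ≤ 1 / 300 := hr'.trans (by norm_num)
    exact ⟨SphericalSpinGlass.psiMapsTo_ASet hr hr' hβr,
      SphericalSpinGlass.psiMapsTo_SSet hr hr' hβr⟩
  obtain ⟨L, hL⟩ := SphericalSpinGlass.exists_lipBound m a
  have hL0 : 0 < L := one_pos.trans_le hL.one_le
  -- The three bounds give `β² ≤ β`, `r(β) ≤ 1/300` and, with `6912 = 432 * 16`, the contraction
  -- condition `432 β² L ≤ 1/16`.
  refine ⟨min 1 (min (1 / (300 * Real.sqrt (SphericalSpinGlass.nu2 m a 2))) (1 / (6912 * L))),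
    by positivity, fun β hβ hβ₁ => ?_⟩
  obtain ⟨hr, hβr⟩ := hrate β hβ
  have b1 : β < 1 := hβ₁.trans_le (min_le_left _ _)
  have b2 := hβ₁.trans_le ((min_le_right _ _).trans (min_le_left _ _))
  have b3 := hβ₁.trans_le ((min_le_right _ _).trans (min_le_right _ _))
  rw [lt_div_iff₀ (by positivity)] at b2 b3
  have hr' : SphericalSpinGlass.rate m a β ≤ 1 / 300 := by
    rw [SphericalSpinGlass.rate]; linarith
  have hβL : 432 * (β ^ 2 * L) ≤ 1 / 16 := by
    have : β ^ 2 * L ≤ β * L := mul_le_mul_of_nonneg_right (by nlinarith) hL0.le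
    linarith
  refine ⟨hr'.trans (by norm_num), SphericalSpinGlass.psiContracts_ASet hr hr' hβr hL hβL, ?_⟩
  obtain ⟨S, hS⟩ := SphericalSpinGlass.SSet_nonempty hr
  obtain ⟨P, hPS, hPP, hPagree⟩ := SphericalSpinGlass.exists_fixed_mem hr hr' hβr hL hβL
    (fun _ h => h.1) SphericalSpinGlass.unifClosed_SSet
    (fun Q hQ => SphericalSpinGlass.stepMap_mem_SSet hr hr' hβr hQ hQ) hS
  have hsol := SphericalSpinGlass.isSphericalSolution_iff_isPsi.2 hPP
  have huniq : ∀ P', SphericalSpinGlass.IsPsi m a β P' P' → SphericalSpinGlass.Agree P' P :=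
    fun P' h => (SphericalSpinGlass.isSphericalSolution_iff_isPsi.2 h).agree hsol
  obtain ⟨Rf, Cf, hlim, heven⟩ := SphericalSpinGlass.exists_mem_LimSet_of_mem_SSet hPS
  refine ⟨P, hsol, fun P' h => h.agree hsol, hPS, hPP, fun P' _ h => huniq P' h, Rf, Cf, hlim.2,
    SphericalSpinGlass.mem_BSet_of_mem_LimSet hlim heven,
    SphericalSpinGlass.isFdtSolution_of_agree hr hβr hlim heven hPagree, fun R C hB h => ?_⟩
  -- Iterating inside `LimSet r R C` yields a spherical solution with limits `R` and `C`. By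
  -- uniqueness it agrees with `P`, so the limits coincide.
  obtain ⟨hRc, hCc, -⟩ := h.fixed hr hB
  obtain ⟨P', hP', hPP', -⟩ := SphericalSpinGlass.exists_fixed_mem hr hr' hβr hL hβL
    (fun _ h => h.1) (SphericalSpinGlass.unifClosed_LimSet R C)
    (fun Q hQ => SphericalSpinGlass.stepMap_mem_LimSet hr hr' hβr hB h hQ)
    (SphericalSpinGlass.stationary_mem_LimSet hB hRc hCc)
  have hl' := hP'.2.congr (huniq P' hPP')
  refine ⟨fun τ hτ => tendsto_nhds_unique (hl' τ hτ).1 (hlim.2 τ hτ).1, fun τ => ?_⟩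
  rw [← SphericalSpinGlass.BSet.even hB, ← heven]
  exact tendsto_nhds_unique (hl' _ (abs_nonneg τ)).2 (hlim.2 _ (abs_nonneg τ)).2
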